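/- Let $\mathbb A$ be a set of activities, $\tau\notin\mathbb A$. An event is a finite sequence $a_1.\cdots.a_k$ of activities (one per level of the hierarchy), a trace is a finite sequence of events, and a (hierarchical event) log is a finite multiset of traces. **Trees.** Hierarchical process trees are built from $\tau$, activities $a\in\mathbb A$, recursion leaves $\vartriangle_f$ ($f\in\mathbb A$), named subtrees $\triangledown_f(P)$, and $\otimes(P_1,\dots,P_n)$ with $\otimes\in\{\times,\to,\wedge,\circlearrowleft\}$ and $n\ge1$ ($n\ge2$ for $\circlearrowleft$). Languages: $\mathcal L(\tau)=\{\varepsilon\}$, $\mathcal L(a)=\{\langle a\rangle\}$, $\mathcal L(\vartriangle_f)=\{\langle\vartriangle_f\rangle\}$; $\times,\to,\wedge$ denote union, concatenation and shuffle of the languages of the children; $\mathcal L(\circlearrowleft(P_1,\dots,P_n))$ consists of all $t_1t_1't_2t_2'\cdots t_{m-1}'t_m$ ($m\ge1$) with $t_i\in\mathcal L(P_1)$, $t_i'\in\bigcup_{j\ge2}\mathcal L(P_j)$. $\mathcal L(\triangledown_f(P))$ is the least set $M$ containing every trace obtained from some $\langle x_1,\dots,x_n\rangle\in\mathcal L(P)$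 by replacing each event $x_i=p.\vartriangle_f$ by a sequence $p.t$ with $t\in M$, leaving other events unchanged, and finally prefixing all events by $f$; here $p.\langle y_1,\dots,y_m\rangle=\langle p.y_1,\dots,p.y_m\rangle$. $\Sigma(P)$ is the set of all activities in $P$, including the $f$ of nodes $\triangledown_f$, $\vartriangle_f$; $\Sigma(L)$ is the set of activities occurring in $L$ at any level. **Class.** $P$ is in the rediscoverable class if at all its operator nodes (including named subtree nodes, where only (iii) says something): (i) different children have disjoint $\Sigma$; (ii) for a loop, no activity is both the topmost activity of the first event of a trace of $\mathcal L(P_1)$ and the topmost activity of the last event of a trace of $\mathcal L(P_1)$ (the topmost activity of $a_1.\cdots$ is $a_1$, that of a bare $\vartriangle_f$ is $f$); (iii) no child is $\tau$; and (iv) every leaf $\vartriangle_f$ of $P$ lies below a node $\triangledown_f$. **Completeness.** $L$ is directly-follows complete w.r.t. $P$ if every pair of events that occurs consecutively in a trace of $\mathcal L(P)$ also occurs consecutively in a trace of $L$, every first (last) event of a trace of $\mathcal L(P)$ is a first (last) event of a trace of $L$, and $\Sigma(P)\subseteq\Sigma(L)$. **Naïve Discovery**, run on $L$, takes the first case that applies: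 1. all traces are $\varepsilon$ (or $L$ is empty): return $\tau$; 2. all traces are $\langle a\rangle$ for one $a\in\mathbb A$: return $a$; 3. all events start with the same activity $f$ and some event has length $\ge2$: return $\triangledown_f(P')$, where $P'$ is the result for the log obtained by deleting the first activity of every event and dropping events that become empty; 4. $\varepsilon\in L$: return $\times(P',\tau)$ with $P'$ the result for the non-empty traces of $L$; 5. consider the graph $G$ of $L$ on the topmost activities of its events, with an edge $a\to b$ iff an event with topmost activity $a$ is directly followed by one with topmost activity $b$ in some trace; $\mathrm{Start}$, $\mathrm{End}$ are the topmost activities of first, last events of traces. A cut is a partition $(S_1,\dots,S_n)$ of the nodes into non-empty sets such that: for $\times$, there are no edges between different parts; for $\to$, for all $i<j$, $a\in S_i$, $b\in S_j$, there is a path from $a$ to $b$ and none from $b$ to $a$; for $\wedge$, every part meets $\mathrm{Start}$ and $\mathrm{End}$ and all edges between different parts are present; for $\circlearrowleft$, $\mathrm{Start}\cup\mathrm{End}\subseteq S_1$, there are no edges between different $S_i,S_j$ with $i,j\ge2$, and for $b\in S_i$, $i\ge2$: an edge from $a\in S_1$ to $b$ implies $a\in\mathrm{End}$ and that all nodes of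 $\mathrm{End}$ have an edge to $b$, and an edge from $b$ to $a\in S_1$ implies $a\in\mathrm{Start}$ and that $b$ has edges to all nodes of $\mathrm{Start}$. For the first operator $\otimes$ in the order $\times,\to,\wedge,\circlearrowleft$ with a cut of at least two parts, choose a cut with the maximal number of parts and return $\otimes(P_1',\dots,P_n')$, with $P_i'$ the result for the sublog $L_i$: for $\times$, the traces of $L$ whose events all have topmost activity in $S_i$; for $\to$ and $\wedge$, the traces of $L$ restricted to the events with topmost activity in $S_i$; for $\circlearrowleft$, the maximal non-empty runs of such events in the traces of $L$; 6. otherwise return the flower model $\circlearrowleft(\tau,\hat x_1,\dots,\hat x_m)$, where $x_1,\dots,x_m$ are the distinct events of $L$ and $\hat x=\triangledown_{a_1}(\cdots\triangledown_{a_{k-1}}(a_k))$ for $x=a_1.\cdots.a_k$. **Theorem (Naïve Discovery preserves language rediscoverability).** Let $P$ be a hierarchical process tree in the rediscoverable class and let $L$ be a log with $t\in\mathcal L(P)$ for all $t\in L$ that is directly-follows complete w.r.t. $P$. Then Naïve Discovery, run on $L$, returns a tree, and every tree $P'$ that it may return (for any choice among maximal cuts and any numbering) satisfies $\mathcal L(P')=\mathcal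 L(P)$. -/

import Mathlib

namespace HierDisc

universe u

/-! ### Hierarchical event logs -/

/-- An event: the sequence of activities executed at the successive levels of the hierarchy. -/
abbrev Event (A : Type u) := List A

/-- A hierarchical trace: a sequence of events. -/
abbrev Trace (A : Type u) := List (Event A)

/-- A hierarchical event log: a (finite) multiset of hierarchical traces. -/
abbrev EventLog (A : Type u) := Multiset (Trace A)

/-- Hierarchical projection of a trace: remove the first `i` activities of every event; events
with nothing left disappear (so `⟨g.a, g.b, c⟩` projects to `⟨a, b⟩` for `i = 1`). -/
def projectTrace {A : Type u} (i : ℕ) (t : Trace A) : Trace A :=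
  (t.map (fun x => x.drop i)).filter (fun x => !x.isEmpty)

/-- Hierarchical projection of a log. -/
def project {A : Type u} (i : ℕ) (L : EventLog A) : EventLog A :=
  L.map (projectTrace i)

/-- The activities of a log, at all levels of the hierarchy. -/
def logActivities {A : Type u} (L : EventLog A) : Set A :=
  {a | ∃ t ∈ L, ∃ x ∈ t, a ∈ x}

/-! ### Hierarchical process trees -/

/-- The ordinary process tree operators: exclusive choice, sequence, parallel (interleaved)
execution, structured loop. -/
inductive Op : Type
  | xor
  | seq
  | par
  | loop

/-- A structured loop has a body and at least one loop-back path; the other operators have at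
least one child. -/
def Op.minArity : Op → ℕ
  | .loop => 2
  | _ => 1

/-- Hierarchical process trees over the activities `A`; for a loop, child `0` is the body and the
other children are the loop-back paths. -/
inductive HTree (A : Type u) : Type u
  /-- the silent activity `τ` -/
  | tau : HTree A
  /-- an activity -/
  | act (a : A) : HTree A
  /-- an operator node `⊗(P₁, …, Pₙ)` -/
  | node (op : Op) (n : ℕ) (hn : op.minArity ≤ n) (c : Fin n → HTree A) : HTree A
  /-- the named subtree `▽_f(P)` -/
  | named (f : A) (P : HTree A) : HTree A
  /-- the recursion leaf `△_f` -/
  | recur (f : A) : HTree A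

/-- The events in the language of a tree: `a₁.….aₖ` (when `mark = none`) or `a₁.….aₖ.△_g`
(when `mark = some g`), where `△_g` is a recursive call that is not resolved yet. -/
@[ext]
structure MEvent (A : Type u) : Type u where
  path : List A
  mark : Option A

/-- Traces over events that may carry an unresolved recursive call. -/
abbrev MTrace (A : Type u) := List (MEvent A)

/-- Concatenation `p.x` of a sequence of activities and an event. -/
def MEvent.prepend {A : Type u} (p : List A) (x : MEvent A) : MEvent A :=
  ⟨p ++ x.path, x.mark⟩

/-- Concatenation `p.⟨x₁, …, xₙ⟩ = ⟨p.x₁, …, p.xₙ⟩`. -/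
def prependTrace {A : Type u} (p : List A) (t : MTrace A) : MTrace A :=
  t.map (MEvent.prepend p)

/-- `Interleave ts t`: the sequence `t` belongs to the shuffle `ts 0 ⋄ … ⋄ ts (n-1)`. -/
inductive Interleave {X : Type u} {n : ℕ} : (Fin n → List X) → List X → Prop
  | nil : Interleave (fun _ => []) []
  | cons (i : Fin n) (x : X) {ts : Fin n → List X} {t : List X} (h : Interleave ts t) :
      Interleave (Function.update ts i (x :: ts i)) (x :: t)

/-- `t₁ · t'₁ · t₂ · t'₂ ⋯ t'_{m-1} · t_m` with all `tᵢ` in `B` and all `t'ᵢ` in `R`. -/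
inductive LoopLang {X : Type u} (B R : Set (List X)) : List X → Prop
  | body {t : List X} (ht : t ∈ B) : LoopLang B R t
  | step {t r s : List X} (ht : t ∈ B) (hr : r ∈ R) (hs : LoopLang B R s) :
      LoopLang B R (t ++ r ++ s)

/-- The language join functions of the ordinary operators. -/
def Op.join {X : Type u} (op : Op) {n : ℕ} (Ls : Fin n → Set (List X)) : Set (List X) :=
  match op with
  | .xor => {t | ∃ i, t ∈ Ls i}
  | .seq => {t | ∃ ts : Fin n → List X, (∀ i, ts i ∈ Ls i) ∧ t = (List.ofFn ts).flatten}
  | .par => {t | ∃ ts : Fin n → List X, (∀ i, ts i ∈ Ls i) ∧ Interleave ts t}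
  | .loop => {t | LoopLang {s | ∃ i : Fin n, i.val = 0 ∧ s ∈ Ls i}
                           {s | ∃ i : Fin n, i.val ≠ 0 ∧ s ∈ Ls i} t}

mutual

/-- The language `▽ˡ_f(L)` of a named subtree: the least solution of its recursive definition.
A trace of `L` has its recursive calls to `f` resolved, and every event then gets the prefix `f`. -/
inductive NamedLang {A : Type u} (f : A) (L : Set (MTrace A)) : MTrace A → Prop
  | intro {xs t : MTrace A} (hx : xs ∈ L) (ht : Resolve f L xs t) :
      NamedLang f L (prependTrace [f] t)

/-- `Resolve f L ⟨x₁, …, xₙ⟩ t`: `t = t₁ ⋯ tₙ` with `tᵢ ∈ ψ_f(xᵢ)`, where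
`ψ_f(p.△_f) = p.▽ˡ_f(L)` and `ψ_f(x) = {⟨x⟩}` if `x` does not end in `△_f`. -/
inductive Resolve {A : Type u} (f : A) (L : Set (MTrace A)) : MTrace A → MTrace A → Prop
  | nil : Resolve f L [] []
  | keep {x : MEvent A} {xs t : MTrace A} (hx : x.mark ≠ some f) (h : Resolve f L xs t) :
      Resolve f L (x :: xs) (x :: t)
  | recurse {p : List A} {xs s t : MTrace A} (hs : NamedLang f L s) (h : Resolve f L xs t) :
      Resolve f L (⟨p, some f⟩ :: xs) (prependTrace p s ++ t)

end

/-- The language of a hierarchical process tree. -/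
def HTree.lang {A : Type u} : HTree A → Set (MTrace A)
  | .tau => {[]}
  | .act a => {[⟨[a], none⟩]}
  | .node op _ _ c => op.join (fun i => (c i).lang)
  | .named f P => {t | NamedLang f P.lang t}
  | .recur f => {[⟨[], some f⟩]}

/-- The set `Σ(P)` of activities in a tree. -/
def HTree.activities {A : Type u} : HTree A → Set A
  | .tau => ∅
  | .act a => {a}
  | .node _ _ _ c => {a | ∃ i, a ∈ (c i).activities}
  | .named f P => insert f P.activities
  | .recur f => {f}

/-! ### Directly-follows completeness -/

/-- The traces of a log, seen as traces without unresolved recursive calls. -/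
def logTraces {A : Type u} (L : EventLog A) : Set (MTrace A) :=
  {s | ∃ t ∈ L, s = t.map (fun x => (⟨x, none⟩ : MEvent A))}

/-- Some trace is of the form `⟨…, x, y, …⟩`. -/
def Follows {X : Type u} (T : Set (List X)) (x y : X) : Prop :=
  ∃ t ∈ T, [x, y] <:+: t

/-- The first symbols of the traces. -/
def starts {X : Type u} (T : Set (List X)) : Set X :=
  {x | ∃ t ∈ T, t.head? = some x}

/-- The last symbols of the traces. -/
def ends {X : Type u} (T : Set (List X)) : Set X :=
  {x | ∃ t ∈ T, t.getLast? = some x}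

/-- The log `L` is directly-follows complete to `P`; the symbols are complete events, so that all
levels of the hierarchy are taken into account. -/
structure DFComplete {A : Type u} (L : EventLog A) (P : HTree A) : Prop where
  follows : ∀ x y, Follows P.lang x y → Follows (logTraces L) x y
  start : starts P.lang ⊆ starts (logTraces L)
  last : ends P.lang ⊆ ends (logTraces L)
  activities : P.activities ⊆ logActivities L

/-! ### The class of language-rediscoverable models -/

/-- The activity of an event at the topmost level. An unresolved call `△_f` counts as `f`, the
first activity of everything it can be resolved to. -/
def MEvent.topActivity {A : Type u} (x : MEvent A) : Option A :=
  x.path.head?.or x.mark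

/-- The start activities of a language. -/
def startActivities {A : Type u} (T : Set (MTrace A)) : Set A :=
  {a | ∃ x ∈ starts T, x.topActivity = some a}

/-- The end activities of a language. -/
def endActivities {A : Type u} (T : Set (MTrace A)) : Set A :=
  {a | ∃ x ∈ ends T, x.topActivity = some a}

/-- At every operator node: no duplicate activities, disjoint start and end activities of the body
of a loop, and no child `τ`. -/
def HTree.NodesOK {A : Type u} : HTree A → Prop
  | .tau => True
  | .act _ => True
  | .node op _ _ c =>
      (∀ i j, i ≠ j → Disjoint (c i).activities (c j).activities) ∧
      (op = Op.loop → ∀ i, i.val = 0 →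
        Disjoint (startActivities (c i).lang) (endActivities (c i).lang)) ∧
      (∀ i, c i ≠ .tau) ∧
      ∀ i, (c i).NodesOK
  | .named _ P => P ≠ .tau ∧ P.NodesOK
  | .recur _ => True

/-- Every recursion leaf `△_f` lies below a named subtree node `▽_f`, or `f ∈ C`, where `C` holds
the names on the path that leads to the tree. -/
def HTree.RecursionBound {A : Type u} : HTree A → Set A → Prop
  | .tau, _ => True
  | .act _, _ => True
  | .node _ _ _ c, C => ∀ i, (c i).RecursionBound C
  | .named f P, C => P.RecursionBound (insert f C)
  | .recur f, C => f ∈ C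

/-- The class of language-rediscoverable models. -/
def HTree.Rediscoverable {A : Type u} (P : HTree A) : Prop :=
  P.NodesOK ∧ P.RecursionBound ∅

/-! ### The directly-follows graph of a log and its cuts

The graph is formed with the activities at the topmost level of the log. -/

/-- The nodes of the directly-follows graph. -/
def topAlphabet {A : Type u} (L : EventLog A) : Set A :=
  {a | ∃ t ∈ L, ∃ x ∈ t, x.head? = some a}

/-- The edges of the directly-follows graph. -/
def Edge {A : Type u} (L : EventLog A) (a b : A) : Prop :=
  ∃ t ∈ L, ∃ x y : Event A, [x, y] <:+: t ∧ x.head? = some a ∧ y.head? = some b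

/-- The start activities of the directly-follows graph. -/
def graphStart {A : Type u} (L : EventLog A) : Set A :=
  {a | ∃ t ∈ L, ∃ x : Event A, t.head? = some x ∧ x.head? = some a}

/-- The end activities of the directly-follows graph. -/
def graphEnd {A : Type u} (L : EventLog A) : Set A :=
  {a | ∃ t ∈ L, ∃ x : Event A, t.getLast? = some x ∧ x.head? = some a}

/-- Pairwise disjoint non-empty sets whose union is the set of nodes. -/
structure IsPartition {A : Type u} (L : EventLog A) {n : ℕ} (S : Fin n → Set A) : Prop where
  nonempty : ∀ i, (S i).Nonempty
  disjoint : ∀ i j, i ≠ j → Disjoint (S i) (S j)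
  cover : (⋃ i, S i) = topAlphabet L

/-- Exclusive choice: no edges between different parts. -/
def XorCut {A : Type u} (L : EventLog A) {n : ℕ} (S : Fin n → Set A) : Prop :=
  ∀ i j, i ≠ j → ∀ a ∈ S i, ∀ b ∈ S j, ¬ Edge L a b

/-- Sequence: from every node of a part there are paths to all nodes of later parts, and no paths
to nodes of earlier parts. -/
def SeqCut {A : Type u} (L : EventLog A) {n : ℕ} (S : Fin n → Set A) : Prop :=
  ∀ i j, i < j → ∀ a ∈ S i, ∀ b ∈ S j,
    Relation.TransGen (Edge L) a b ∧ ¬ Relation.TransGen (Edge L) b a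

/-- Parallel: every part has a start and an end activity, and all edges between different parts
are present. -/
def ParCut {A : Type u} (L : EventLog A) {n : ℕ} (S : Fin n → Set A) : Prop :=
  (∀ i, (S i ∩ graphStart L).Nonempty ∧ (S i ∩ graphEnd L).Nonempty) ∧
  ∀ i j, i ≠ j → ∀ a ∈ S i, ∀ b ∈ S j, Edge L a b

/-- Loop: part `0` is the body and holds all start and end activities; it is left only from end
activities, and from all of them alike, and is entered only at start activities, and at all of them
alike; there are no edges between different loop-back parts. -/
structure LoopCut {A : Type u} (L : EventLog A) {n : ℕ} (S : Fin n → Set A) : Prop where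
  body : ∀ i : Fin n, i.val = 0 → graphStart L ∪ graphEnd L ⊆ S i
  leave : ∀ i j : Fin n, i.val = 0 → j.val ≠ 0 → ∀ a ∈ S i, ∀ b ∈ S j,
    Edge L a b → a ∈ graphEnd L ∧ ∀ a' ∈ graphEnd L, Edge L a' b
  enter : ∀ i j : Fin n, i.val = 0 → j.val ≠ 0 → ∀ a ∈ S i, ∀ b ∈ S j,
    Edge L b a → a ∈ graphStart L ∧ ∀ a' ∈ graphStart L, Edge L b a'
  separate : ∀ i j : Fin n, i.val ≠ 0 → j.val ≠ 0 → i ≠ j → ∀ a ∈ S i, ∀ b ∈ S j, ¬ Edge L a b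

/-- The cuts for an operator. -/
def IsCut {A : Type u} (L : EventLog A) (op : Op) {n : ℕ} (S : Fin n → Set A) : Prop :=
  IsPartition L S ∧
    match op with
    | .xor => XorCut L S
    | .seq => SeqCut L S
    | .par => ParCut L S
    | .loop => LoopCut L S

/-- Some cut for `op` has at least two parts. -/
def HasCut {A : Type u} (L : EventLog A) (op : Op) : Prop :=
  ∃ (n : ℕ) (S : Fin n → Set A), 2 ≤ n ∧ IsCut L op S

/-- The order in which the operators are tried: choice, sequence, parallel, loop. -/
def Op.rank : Op → ℕ
  | .xor => 0
  | .seq => 1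
  | .par => 2
  | .loop => 3

/-- `op` is the first operator with a non-trivial cut, and `S` is a non-trivial cut for `op` with
the largest possible number of parts. -/
structure Selected {A : Type u} (L : EventLog A) (op : Op) {n : ℕ} (S : Fin n → Set A) :
    Prop where
  cut : IsCut L op S
  nontrivial : 2 ≤ n
  maximal : ∀ (m : ℕ) (S' : Fin m → Set A), IsCut L op S' → m ≤ n
  first : ∀ op' : Op, op'.rank < op.rank → ¬ HasCut L op'

/-! ### Log splitting -/

/-- The topmost activity of the event lies in the given part. -/
def InPart {A : Type u} (S : Set A) (x : Event A) : Prop :=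
  ∃ a ∈ S, x.head? = some a

open Classical in
/-- The sublog for the part `S` of a cut. Exclusive choice: the traces that lie in `S`. Sequence
and parallel: the traces restricted to `S` (for a sequence cut, this is the `S`-block of the trace).
Loop: the maximal non-empty runs of events in `S`. -/
noncomputable def splitLog {A : Type u} (op : Op) (L : EventLog A) (S : Set A) : EventLog A :=
  match op with
  | .xor => L.filter (fun t => ∀ x ∈ t, InPart S x)
  | .seq => L.map (fun t => t.filter (fun x => decide (InPart S x)))
  | .par => L.map (fun t => t.filter (fun x => decide (InPart S x)))
  | .loop => L.bind (fun t =>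
      (((t.splitOnP (fun x => decide (¬ InPart S x))).filter (fun r => !r.isEmpty) :
        List (Trace A)) : Multiset (Trace A)))

/-! ### Naive Discovery -/

/-- The tree with the single trace `⟨x⟩`: `▽_{a₁}(⋯ ▽_{aₖ₋₁}(aₖ))` for `x = a₁.….aₖ`. -/
def eventTree {A : Type u} : Event A → HTree A
  | [] => .tau
  | [a] => .act a
  | a :: b :: x => .named a (eventTree (b :: x))

/-- The guard of the named subtree case: all events have topmost activity `f`, and there is a lower
level. -/
def SubtreeCase {A : Type u} (L : EventLog A) (f : A) : Prop :=
  (∀ t ∈ L, ∀ x ∈ t, x.head? = some f) ∧ ∃ t ∈ L, ∃ x ∈ t, 2 ≤ x.length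

/-- None of the two base cases and not the named subtree case. -/
def NoBaseCase {A : Type u} (L : EventLog A) : Prop :=
  (¬ ∀ t ∈ L, t = []) ∧ (∀ a : A, ¬ ∀ t ∈ L, t = [[a]]) ∧ ∀ f : A, ¬ SubtreeCase L f

open Classical in
/-- `Naive L P`: Naive Discovery, run on the log `L`, may return the tree `P`. The only freedom is
the choice (and numbering) of a maximal cut and the numbering of the events in the flower model. -/
inductive Naive {A : Type u} : EventLog A → HTree A → Prop
  /-- the log is empty or has only empty traces -/
  | silent {L : EventLog A} (h : ∀ t ∈ L, t = []) : Naive L .tau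
  /-- all traces consist of one and the same lowest-level activity -/
  | single {L : EventLog A} (a : A) (h₀ : ¬ ∀ t ∈ L, t = []) (h : ∀ t ∈ L, t = [[a]]) :
      Naive L (.act a)
  /-- named subtree -/
  | subtree {L : EventLog A} (f : A) {P : HTree A} (h : SubtreeCase L f)
      (hP : Naive (project 1 L) P) : Naive L (.named f P)
  /-- some, but not all, traces are empty -/
  | emptyTraces {L : EventLog A} {P : HTree A} (h : NoBaseCase L) (h₀ : [] ∈ L)
      (hP : Naive (L.filter (fun t => t ≠ [])) P) :
      Naive L (.node .xor 2 (Nat.le_succ 1) ![P, .tau])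
  /-- split the log and recurse on the sublogs -/
  | split {L : EventLog A} (op : Op) {n : ℕ} (S : Fin n → Set A) (hn : op.minArity ≤ n)
      {c : Fin n → HTree A} (h : NoBaseCase L) (h₀ : [] ∉ L) (hS : Selected L op S)
      (hc : ∀ i, Naive (splitLog op L (S i)) (c i)) : Naive L (.node op n hn c)
  /-- no split is possible: the flower model `↺(τ, x₁, …, xₘ)` over the events of the log -/
  | flower {L : EventLog A} (es : List (Event A)) (hn : Op.loop.minArity ≤ es.length + 1)
      (h : NoBaseCase L) (h₀ : [] ∉ L) (hS : ∀ op : Op, ¬ HasCut L op) (hnd : es.Nodup)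
      (hes : ∀ x, x ∈ es ↔ ∃ t ∈ L, x ∈ t) :
      Naive L (.node .loop (es.length + 1) hn
        (Fin.cons .tau (fun i => eventTree (es.get i))))

end HierDisc

namespace HierDisc

universe u

/-! ### Consecutive elements of lists -/

section Lists

variable {X Y : Type u}

-- The argument has two halves: the language of the tree is brought into a normal form, and the
-- algorithm is shown to recover every normal form from a complete log.
--
-- First half. In a non-empty language of non-empty traces, each event is a first event or directly
-- follows another one, so a directly-follows complete log contains every event of the language
-- (`Complete.exists_mem`). As the log is finite, event lengths are bounded (`Complete.bounded`). If
-- a call `△_f` could be resolved completely, resolving it with a trace that holds a longest event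
-- of `▽_f(P)` would give a strictly longer one. Hence traces with a call to `f` contribute nothing
-- to the resolved language, and `▽_f` merely prefixes `f` (`clean_named`). Children without
-- resolved traces disappear from choices and from loop-backs. What remains is built from single
-- activities by prefixing and by joins over disjoint alphabets. Unary nodes collapse, nested
-- choices, sequences and parallels merge, a loop in the body of a loop is absorbed, and a choice
-- among loop-backs becomes several loop-backs. The result is `NF` (`HTree.exists_nf`).
--
-- Second half, by induction on `NF`. Completeness makes the graph of the log equal to that of the
-- language, and the children of a node form a cut (`IsFamily.isCut`). A language whose topmost
-- operator differs from `op` cannot be divided by an `op`-cut (`NF.indivisible`): choices have no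
-- paths between children, sequences are connected but have no edges backwards, parallels and loops
-- are strongly connected, and a body activity and a loop-back activity linked both ways would
-- violate the start/end condition on the body. So no earlier operator has a cut, and for the right
-- operator every cut is coarser than the one given by the children; a maximal cut must equal it.
-- The loop body needs its own argument (`NF.tops_subset_body`), since loop cuts are asymmetric. The
-- numbering is forced for sequences and for the loop body, and is irrelevant otherwise
-- (`NFChildren.exists_perm`, `join_perm`). Finally each sublog is complete for its child
-- (`IsFamily.splitLog_complete`), so the induction closes in `NF.rediscovered`.

theorem pair_infix_append {x y : X} {u v : List X} :
    [x, y] <:+: u ++ v ↔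
      [x, y] <:+: u ∨ [x, y] <:+: v ∨ (u.getLast? = some x ∧ v.head? = some y) := by
  rw [List.infix_append_iff]
  constructor
  · rintro (h | h | ⟨l₁, l₂, hl, h₁, h₂⟩)
    · exact Or.inl h
    · exact Or.inr (Or.inl h)
    · rcases l₁ with _ | ⟨a, _ | ⟨b, l⟩⟩
      · simp at hl
        subst hl
        exact Or.inr (Or.inl h₂.isInfix)
      · simp at hl
        obtain ⟨rfl, rfl⟩ := hl
        obtain ⟨u', rfl⟩ := h₁
        obtain ⟨v', rfl⟩ := h₂
        simp
      · simp at hl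
        obtain ⟨rfl, rfl, rfl, rfl⟩ := hl
        exact Or.inl h₁.isInfix
  · rintro (h | h | ⟨h₁, h₂⟩)
    · exact Or.inl h
    · exact Or.inr (Or.inl h)
    · refine Or.inr (Or.inr ⟨[x], [y], rfl, ?_, ?_⟩)
      · obtain ⟨u', rfl⟩ := List.getLast?_eq_some_iff.1 h₁
        exact ⟨u', rfl⟩
      · obtain ⟨v', rfl⟩ := List.head?_eq_some_iff.1 h₂
        exact ⟨v', rfl⟩

theorem pair_infix_iff {x y : X} {t : List X} :
    [x, y] <:+: t ↔ ∃ u v, t = u ++ x :: y :: v := by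
  constructor
  · rintro ⟨u, v, rfl⟩
    exact ⟨u, v, by simp⟩
  · rintro ⟨u, v, rfl⟩
    exact ⟨u, v, by simp⟩

/-- This is why directly-follows completeness, which speaks of first events and of pairs only,
forces every event of the language into the log. -/
theorem head?_or_follows {x : X} {t : List X} (hx : x ∈ t) :
    t.head? = some x ∨ ∃ z, [z, x] <:+: t := by
  obtain ⟨u, v, rfl⟩ := List.append_of_mem hx
  rcases u.eq_nil_or_concat with rfl | ⟨u', z, rfl⟩
  · simp
  · exact Or.inr ⟨z, pair_infix_iff.2 ⟨u', v, by simp⟩⟩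

/-- The crossing found is the first one: everything up to `a` satisfies `p`. The order of the first
exit and the last return matters for sequences inside a loop body. -/
theorem exists_crossing {p : X → Prop} {t : List X} {x y : X} (hx : t.head? = some x)
    (hpx : p x) (hy : y ∈ t) (hpy : ¬ p y) :
    ∃ u a b v, t = u ++ a :: b :: v ∧ (∀ z ∈ u, p z) ∧ p a ∧ ¬ p b := by
  induction t generalizing x with
  | nil => simp at hx
  | cons c t ih =>
    simp at hx
    subst hx
    cases t with
    | nil =>
      simp at hy
      subst hy
      exact absurd hpx hpy
    | cons d t =>
      by_cases hd : p d
      · have hy' : y ∈ d :: t := by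
          rcases List.mem_cons.1 hy with rfl | h
          · exact absurd hpx hpy
          · exact h
        obtain ⟨u, a, b, v, h, hu, ha, hb⟩ := ih (x := d) rfl hd hy'
        exact ⟨c :: u, a, b, v, by simp [h], by simpa using ⟨hpx, hu⟩, ha, hb⟩
      · exact ⟨[], c, d, t, rfl, by simp, hpx, hd⟩

theorem exists_crossing_last {p : X → Prop} {t : List X} {x y : X}
    (hx : t.getLast? = some x) (hpx : p x) (hy : y ∈ t) (hpy : ¬ p y) :
    ∃ u a b v, t = u ++ a :: b :: v ∧ (∀ z ∈ v, p z) ∧ ¬ p a ∧ p b := by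
  obtain ⟨u, a, b, v, h, hu, ha, hb⟩ := exists_crossing (p := p) (t := t.reverse) (x := x) (y := y)
    (by simpa using hx) hpx (by simpa using hy) hpy
  refine ⟨v.reverse, b, a, u.reverse, ?_, by simpa using hu, hb, ha⟩
  rw [← List.reverse_reverse t, h]
  simp

/-- A concatenation, cut at one of its blocks. -/
theorem flatten_ofFn_split {n : ℕ} (ts : Fin n → List X) (i : Fin n) :
    ∃ p q, (List.ofFn ts).flatten = p ++ ts i ++ q ∧ (∀ x, x ∈ p ↔ ∃ j < i, x ∈ ts j) ∧
      ∀ x, x ∈ q ↔ ∃ j > i, x ∈ ts j := by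
  induction n with
  | zero => exact i.elim0
  | succ n ih =>
    rw [List.ofFn_succ, List.flatten_cons]
    refine Fin.cases ?_ (fun k => ?_) i
    · refine ⟨[], (List.ofFn fun i => ts i.succ).flatten, by simp, by simp, fun x => ?_⟩
      simp only [List.mem_flatten, List.mem_ofFn]
      constructor
      · rintro ⟨_, ⟨j, rfl⟩, hx⟩
        exact ⟨j.succ, Fin.succ_pos j, hx⟩
      · rintro ⟨j, hj, hx⟩
        obtain ⟨j, rfl⟩ := Fin.exists_succ_eq_of_ne_zero hj.ne'
        exact ⟨_, ⟨j, rfl⟩, hx⟩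
    · obtain ⟨p, q, h, hp, hq⟩ := ih (fun i => ts i.succ) k
      refine ⟨ts 0 ++ p, q, by rw [h]; simp, fun x => ?_, fun x => ?_⟩
      · rw [List.mem_append, hp]
        constructor
        · rintro (hx | ⟨j, hj, hx⟩)
          · exact ⟨0, Fin.succ_pos k, hx⟩
          · exact ⟨j.succ, Fin.succ_lt_succ_iff.2 hj, hx⟩
        · rintro ⟨j, hj, hx⟩
          rcases Fin.eq_zero_or_eq_succ j with rfl | ⟨j, rfl⟩
          · exact Or.inl hx
          · exact Or.inr ⟨j, Fin.succ_lt_succ_iff.1 hj, hx⟩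
      · rw [hq]
        constructor
        · rintro ⟨j, hj, hx⟩
          exact ⟨j.succ, Fin.succ_lt_succ_iff.2 hj, hx⟩
        · rintro ⟨j, hj, hx⟩
          obtain ⟨j, rfl⟩ := Fin.exists_succ_eq_of_ne_zero (Fin.ne_zero_of_lt hj)
          exact ⟨j, Fin.succ_lt_succ_iff.1 hj, hx⟩

theorem Interleave.mem_iff {n : ℕ} {ts : Fin n → List X} {t : List X} (h : Interleave ts t)
    {x : X} : x ∈ t ↔ ∃ i, x ∈ ts i := by
  induction h with
  | nil => simp
  | @cons i y ts t h ih =>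
    rw [List.mem_cons, ih]
    constructor
    · rintro (rfl | ⟨j, hj⟩)
      · exact ⟨i, by simp⟩
      · refine ⟨j, ?_⟩
        by_cases hji : j = i
        · subst hji
          simp [hj]
        · simpa [hji] using hj
    · rintro ⟨j, hj⟩
      by_cases hji : j = i
      · subst hji
        simp at hj
        rcases hj with rfl | hj
        · exact Or.inl rfl
        · exact Or.inr ⟨_, hj⟩
      · exact Or.inr ⟨j, by simpa [hji] using hj⟩

/-- When each symbol reveals its strand, a shuffle can be undone by filtering. Together with
`interleave_filter` this makes shuffles over disjoint alphabets a matter of restrictions. -/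
theorem Interleave.filter_eq {n : ℕ} {p : Fin n → X → Bool} {ts : Fin n → List X} {t : List X}
    (h : Interleave ts t) (hp : ∀ i j, ∀ x ∈ ts j, p i x = decide (i = j)) (i : Fin n) :
    t.filter (p i) = ts i := by
  induction h with
  | nil => simp
  | @cons k y ts t h ih =>
    have hts : ∀ i j, ∀ x ∈ ts j, p i x = decide (i = j) := by
      intro i j x hx
      refine hp i j x ?_
      by_cases hjk : j = k
      · subst hjk
        simp [hx]
      · simpa [hjk] using hx
    have hy := hp i k y (by simp)
    rw [List.filter_cons, hy, ih hts]
    by_cases hik : i = k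
    · subst hik
      simp
    · simp [hik]

theorem interleave_filter {n : ℕ} (p : Fin n → X → Bool) (t : List X)
    (hp : ∀ x ∈ t, ∃ i, ∀ j, p j x = decide (j = i)) :
    Interleave (fun i => t.filter (p i)) t := by
  induction t with
  | nil => exact Interleave.nil
  | cons x t ih =>
    obtain ⟨i, hi⟩ := hp x (by simp)
    convert Interleave.cons i x (ih fun y hy => hp y (by simp [hy])) using 1
    funext j
    rw [List.filter_cons, hi j]
    by_cases hji : j = i
    · subst hji
      simp
    · simp [hji]

theorem Interleave.map {n : ℕ} (f : X → Y) {ts : Fin n → List X} {t : List X}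
    (h : Interleave ts t) : Interleave (fun i => (ts i).map f) (t.map f) := by
  induction h with
  | nil => exact Interleave.nil
  | @cons i x ts t h ih =>
    rw [List.map_cons]
    convert Interleave.cons i (f x) ih using 1
    funext j
    by_cases hji : j = i
    · subst hji
      simp
    · simp [hji]

theorem Interleave.exists_of_map {n : ℕ} {f : X → Y} {us : Fin n → List Y} {s : List Y}
    (h : Interleave us s) {t : List X} (hs : s = t.map f) :
    ∃ ts : Fin n → List X, (∀ i, us i = (ts i).map f) ∧ Interleave ts t := by
  induction h generalizing t with
  | nil =>
    obtain rfl := List.map_eq_nil_iff.1 hs.symm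
    exact ⟨fun _ => [], by simp, Interleave.nil⟩
  | @cons i y us s h ih =>
    obtain ⟨x, t', rfl, rfl, rfl⟩ := List.map_eq_cons_iff.1 hs.symm
    obtain ⟨ts, hts, hi⟩ := ih rfl
    refine ⟨Function.update ts i (x :: ts i), fun j => ?_, Interleave.cons i x hi⟩
    by_cases hji : j = i
    · subst hji
      simp [hts]
    · simp [hji, hts]

theorem Interleave.perm {n : ℕ} (σ : Equiv.Perm (Fin n)) {ts : Fin n → List X} {t : List X}
    (h : Interleave ts t) : Interleave (fun i => ts (σ i)) t := by
  induction h with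
  | nil => exact Interleave.nil
  | @cons i x ts t h ih =>
    convert Interleave.cons (σ.symm i) x ih using 1
    funext j
    by_cases hj : σ j = i
    · subst hj
      simp
    · have : j ≠ σ.symm i := fun h => hj (by simp [h])
      simp [hj, this]

theorem flatten_ofFn_of_map {n : ℕ} {f : X → Y} {us : Fin n → List Y} {t : List X}
    (h : t.map f = (List.ofFn us).flatten) :
    ∃ ts : Fin n → List X, (∀ i, us i = (ts i).map f) ∧ t = (List.ofFn ts).flatten := by
  induction n generalizing t with
  | zero => exact ⟨fun _ => [], fun i => i.elim0, by simpa using h⟩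
  | succ n ih =>
    rw [List.ofFn_succ, List.flatten_cons, List.map_eq_append_iff] at h
    obtain ⟨t₁, t₂, rfl, h₁, h₂⟩ := h
    obtain ⟨ts, hts, rfl⟩ := ih h₂
    refine ⟨Fin.cons t₁ ts, fun i => ?_, by simp [List.ofFn_succ]⟩
    refine Fin.cases ?_ (fun j => ?_) i
    · simp [h₁]
    · simp [hts]

theorem map_flatten_ofFn {n : ℕ} (f : X → Y) (ts : Fin n → List X) :
    (List.ofFn ts).flatten.map f = (List.ofFn fun i => (ts i).map f).flatten := by
  rw [List.map_flatten, List.map_ofFn]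
  rfl

/-! ### Joins of languages -/

theorem LoopLang.mono {B B' R R' : Set (List X)} (hB : B ⊆ B') (hR : R ⊆ R') {t : List X}
    (h : LoopLang B R t) : LoopLang B' R' t := by
  induction h with
  | body ht => exact .body (hB ht)
  | step ht hr _ ih => exact .step (hB ht) (hR hr) ih

/-- The constructor `step` prepends a single body trace; here two whole loop traces are glued. -/
theorem LoopLang.trans {B R : Set (List X)} {t r s : List X} (ht : LoopLang B R t) (hr : r ∈ R)
    (hs : LoopLang B R s) : LoopLang B R (t ++ r ++ s) := by
  induction ht with
  | body ht => exact .step ht hr hs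
  | @step t₁ r₁ s₁ ht hr₁ _ ih =>
    have := LoopLang.step ht hr₁ ih
    simpa using this

theorem LoopLang.of_map {f : X → Y} {B R : Set (List Y)} {s : List Y} (h : LoopLang B R s)
    {t : List X} (hs : s = t.map f) :
    LoopLang {t | t.map f ∈ B} {t | t.map f ∈ R} t := by
  induction h generalizing t with
  | body ht =>
    subst hs
    exact .body ht
  | @step u r v hu hr hv ih =>
    obtain ⟨t₁, t₂, rfl, h₁, rfl⟩ := List.map_eq_append_iff.1 hs.symm
    obtain ⟨t₃, t₄, rfl, rfl, rfl⟩ := List.map_eq_append_iff.1 h₁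
    exact .step hu hr (ih rfl)

theorem LoopLang.map {f : X → Y} {B R : Set (List Y)} {t : List X}
    (h : LoopLang {t | t.map f ∈ B} {t | t.map f ∈ R} t) : LoopLang B R (t.map f) := by
  induction h with
  | body ht => exact .body ht
  | @step u r v hu hr hv ih =>
    rw [List.map_append, List.map_append]
    exact .step hu hr ih

theorem LoopLang.exists_mem {B R : Set (List X)} {t : List X} (h : LoopLang B R t) {x : X}
    (hx : x ∈ t) : (∃ s ∈ B, x ∈ s) ∨ ∃ s ∈ R, x ∈ s := by
  induction h with
  | body ht => exact Or.inl ⟨_, ht, hx⟩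
  | step ht hr _ ih =>
    simp only [List.mem_append] at hx
    rcases hx with (hx | hx) | hx
    · exact Or.inl ⟨_, ht, hx⟩
    · exact Or.inr ⟨_, hr, hx⟩
    · exact ih hx

theorem loop_join_mono {n m : ℕ} {Ts : Fin n → Set (List X)} {Us : Fin m → Set (List X)}
    (hB : ∀ i, i.val = 0 → ∀ s ∈ Ts i, ∃ j, j.val = 0 ∧ s ∈ Us j)
    (hR : ∀ i, i.val ≠ 0 → ∀ s ∈ Ts i, ∃ j, j.val ≠ 0 ∧ s ∈ Us j) :
    Op.loop.join Ts ⊆ Op.loop.join Us := by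
  intro t ht
  refine LoopLang.mono ?_ ?_ (show LoopLang _ _ t from ht)
  · rintro s ⟨i, hi, hs⟩
    exact hB i hi s hs
  · rintro s ⟨i, hi, hs⟩
    exact hR i hi s hs

/-- Joins only rearrange symbols, so a decomposition of `t.map f` lifts to one of `t`. Applied to
`plain`, this lets passing to the resolved traces commute with operators. -/
theorem map_mem_join_iff {op : Op} {n : ℕ} (f : X → Y) (Ts : Fin n → Set (List Y)) (t : List X) :
    t.map f ∈ op.join Ts ↔ t ∈ op.join fun i => {s | s.map f ∈ Ts i} := by
  cases op with
  | xor => exact Iff.rfl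
  | seq =>
    constructor
    · rintro ⟨us, hus, h⟩
      obtain ⟨ts, hts, rfl⟩ := flatten_ofFn_of_map h
      exact ⟨ts, fun i => by simpa [← hts i] using hus i, rfl⟩
    · rintro ⟨ts, hts, rfl⟩
      exact ⟨fun i => (ts i).map f, hts, map_flatten_ofFn f ts⟩
  | par =>
    constructor
    · rintro ⟨us, hus, h⟩
      obtain ⟨ts, hts, h⟩ := h.exists_of_map rfl
      exact ⟨ts, fun i => by simpa [← hts i] using hus i, h⟩
    · rintro ⟨ts, hts, h⟩
      exact ⟨fun i => (ts i).map f, hts, h.map f⟩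
  | loop =>
    constructor
    · intro h
      exact LoopLang.of_map h rfl
    · intro h
      exact LoopLang.map h

theorem exists_mem_of_mem_join {op : Op} {n : ℕ} {Ts : Fin n → Set (List X)} {t : List X}
    (ht : t ∈ op.join Ts) {x : X} (hx : x ∈ t) : ∃ i, ∃ s ∈ Ts i, x ∈ s := by
  cases op with
  | xor => exact let ⟨i, hi⟩ := ht; ⟨i, t, hi, hx⟩
  | seq =>
    obtain ⟨ts, hts, rfl⟩ := ht
    simp only [List.mem_flatten, List.mem_ofFn] at hx
    obtain ⟨_, ⟨i, rfl⟩, hx⟩ := hx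
    exact ⟨i, _, hts i, hx⟩
  | par =>
    obtain ⟨ts, hts, h⟩ := ht
    obtain ⟨i, hi⟩ := h.mem_iff.1 hx
    exact ⟨i, _, hts i, hi⟩
  | loop =>
    rcases LoopLang.exists_mem ht hx with ⟨s, ⟨i, _, hs⟩, hx⟩ | ⟨s, ⟨i, _, hs⟩, hx⟩
    · exact ⟨i, s, hs, hx⟩
    · exact ⟨i, s, hs, hx⟩

/-- Injectivity turns images into preimages, which reduces the claim to `map_mem_join_iff`; all
symbols of a trace on the right lie in the range of `f`. -/
theorem image_map_join {op : Op} {n : ℕ} {f : X → Y} (hf : Function.Injective f)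
    (Ts : Fin n → Set (List X)) :
    List.map f '' op.join Ts = op.join fun i => List.map f '' Ts i := by
  have key : ∀ t, t.map f ∈ op.join (fun i => List.map f '' Ts i) ↔ t ∈ op.join Ts := by
    intro t
    rw [map_mem_join_iff]
    have : ∀ i, {s : List X | s.map f ∈ List.map f '' Ts i} = Ts i := by
      intro i
      ext s
      simp [List.map_injective_iff.2 hf |>.eq_iff]
    simp only [this]
  ext s
  constructor
  · rintro ⟨t, ht, rfl⟩
    exact (key t).2 ht
  · intro hs
    have hmem : ∀ y ∈ s, ∃ x, f x = y := by
      intro y hy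
      obtain ⟨i, _, ⟨t, _, rfl⟩, hy⟩ := exists_mem_of_mem_join hs hy
      obtain ⟨x, _, rfl⟩ := List.mem_map.1 hy
      exact ⟨x, rfl⟩
    obtain ⟨t, rfl⟩ : ∃ t : List X, t.map f = s := by
      have : s ∈ Set.range (List.map f) := by
        rw [Set.range_list_map]
        exact hmem
      exact this
    exact ⟨t, (key t).1 hs, rfl⟩

/-- The freedom of numbering that the algorithm retains: any for choice and parallel, none for a
sequence, any that keeps the body first for a loop. -/
theorem join_perm {op : Op} {n : ℕ} (σ : Equiv.Perm (Fin n)) (hseq : op = .seq → σ = 1)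
    (hloop : op = .loop → ∀ i, (σ i).val = 0 ↔ i.val = 0) (Ts : Fin n → Set (List X)) :
    (op.join fun i => Ts (σ i)) = op.join Ts := by
  cases op with
  | xor =>
    ext t
    exact σ.exists_congr_left.trans (by simp [Op.join])
  | seq => simp [hseq rfl]
  | par =>
    ext t
    constructor
    · rintro ⟨ts, hts, h⟩
      exact ⟨fun i => ts (σ.symm i), fun i => by simpa using hts (σ.symm i), h.perm σ.symm⟩
    · rintro ⟨ts, hts, h⟩
      exact ⟨fun i => ts (σ i), fun i => hts _, h.perm σ⟩
  | loop =>
    have h := hloop rfl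
    ext t
    constructor
    · refine fun ht => loop_join_mono (fun i hi s hs => ⟨σ i, (h i).2 hi, hs⟩)
        (fun i hi s hs => ⟨σ i, mt (h i).1 hi, hs⟩) ht
    · refine fun ht => loop_join_mono (fun i hi s hs => ⟨σ.symm i, (h _).1 (by simpa), by simpa⟩)
        (fun i hi s hs => ⟨σ.symm i, fun e => hi (by simpa using (h _).2 e), by simpa⟩) ht

end Lists

-- Languages with disjoint topmost activities and their joins

section Languages

variable {A : Type u}

/-- The topmost activities of the events of a language. -/
def tops (T : Set (Trace A)) : Set A :=
  {a | ∃ t ∈ T, ∃ x ∈ t, x.head? = some a}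

/-- The directly-follows relation of a language on topmost activities. -/
def DFEdge (T : Set (Trace A)) (a b : A) : Prop :=
  ∃ x y : Event A, Follows T x y ∧ x.head? = some a ∧ y.head? = some b

/-- The topmost activities of the first events. -/
def firstTops (T : Set (Trace A)) : Set A :=
  {a | ∃ x ∈ starts T, x.head? = some a}

/-- The topmost activities of the last events. -/
def lastTops (T : Set (Trace A)) : Set A :=
  {a | ∃ x ∈ ends T, x.head? = some a}

open Classical in
/-- The events of a trace with topmost activity in `V`. -/
noncomputable def restrict (V : Set A) (t : Trace A) : Trace A :=
  t.filter (fun x => decide (InPart V x))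

open Classical in
/-- The events of a trace with topmost activity not in `V`. -/
noncomputable def restrictCompl (V : Set A) (t : Trace A) : Trace A :=
  t.filter (fun x => decide (¬ InPart V x))

/-- A non-empty language of non-empty traces of non-empty events. -/
structure Proper (T : Set (Trace A)) : Prop where
  nonempty : T.Nonempty
  ne_nil : ∀ t ∈ T, t ≠ []
  event_ne_nil : ∀ t ∈ T, ∀ x ∈ t, x ≠ []

/-- Proper languages with pairwise disjoint topmost activities. -/
structure IsFamily {n : ℕ} (Ts : Fin n → Set (Trace A)) : Prop where
  proper : ∀ i, Proper (Ts i)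
  disjoint : ∀ i j, i ≠ j → Disjoint (tops (Ts i)) (tops (Ts j))

theorem Proper.inPart {T : Set (Trace A)} (hT : Proper T) {t : Trace A} (ht : t ∈ T) {x : Event A}
    (hx : x ∈ t) : InPart (tops T) x := by
  cases x with
  | nil => exact absurd rfl (hT.event_ne_nil t ht _ hx)
  | cons a x => exact ⟨a, ⟨t, ht, _, hx, rfl⟩, rfl⟩

theorem mem_loop_body {X : Type u} {n : ℕ} {Ts : Fin n → Set (List X)} {i : Fin n}
    (hi : i.val = 0) {t : List X} (ht : t ∈ Ts i) : t ∈ Op.loop.join Ts :=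
  LoopLang.body (show t ∈ {s | ∃ i : Fin n, i.val = 0 ∧ s ∈ Ts i} from ⟨i, hi, ht⟩)

theorem mem_loop_step {X : Type u} {n : ℕ} {Ts : Fin n → Set (List X)} {i j : Fin n}
    (hi : i.val = 0) {t : List X} (ht : t ∈ Ts i) (hj : j.val ≠ 0) {r : List X} (hr : r ∈ Ts j)
    {s : List X} (hs : s ∈ Op.loop.join Ts) : t ++ r ++ s ∈ Op.loop.join Ts :=
  LoopLang.step (show t ∈ {s | ∃ i : Fin n, i.val = 0 ∧ s ∈ Ts i} from ⟨i, hi, ht⟩)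
    (show r ∈ {s | ∃ i : Fin n, i.val ≠ 0 ∧ s ∈ Ts i} from ⟨j, hj, hr⟩) hs

theorem mem_of_starts {X : Type u} {T : Set (List X)} {x : X} (h : x ∈ starts T) :
    ∃ t ∈ T, x ∈ t :=
  let ⟨t, ht, hx⟩ := h
  ⟨t, ht, List.mem_of_mem_head? hx⟩

theorem mem_of_ends {X : Type u} {T : Set (List X)} {x : X} (h : x ∈ ends T) :
    ∃ t ∈ T, x ∈ t :=
  let ⟨t, ht, hx⟩ := h
  ⟨t, ht, List.mem_of_mem_getLast? hx⟩

theorem Follows.mem_left {X : Type u} {T : Set (List X)} {x y : X} (h : Follows T x y) :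
    ∃ t ∈ T, x ∈ t :=
  let ⟨t, ht, hx⟩ := h
  ⟨t, ht, hx.subset (by simp)⟩

theorem Follows.mem_right {X : Type u} {T : Set (List X)} {x y : X} (h : Follows T x y) :
    ∃ t ∈ T, y ∈ t :=
  let ⟨t, ht, hx⟩ := h
  ⟨t, ht, hx.subset (by simp)⟩

theorem Proper.tops_nonempty {T : Set (Trace A)} (hT : Proper T) : (tops T).Nonempty := by
  obtain ⟨t, ht⟩ := hT.nonempty
  obtain ⟨x, hx⟩ := List.exists_mem_of_ne_nil t (hT.ne_nil t ht)
  obtain ⟨a, ha, _⟩ := hT.inPart ht hx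
  exact ⟨a, ha⟩

theorem Proper.exists_head {T : Set (Trace A)} (hT : Proper T) {t : Trace A} (ht : t ∈ T) :
    ∃ x, t.head? = some x ∧ ∃ a ∈ firstTops T, x.head? = some a := by
  cases t with
  | nil => exact absurd rfl (hT.ne_nil _ ht)
  | cons x t =>
    obtain ⟨a, _, ha⟩ := hT.inPart ht (List.mem_cons_self ..)
    exact ⟨x, rfl, a, ⟨x, ⟨_, ht, rfl⟩, ha⟩, ha⟩

theorem Proper.exists_last {T : Set (Trace A)} (hT : Proper T) {t : Trace A} (ht : t ∈ T) :
    ∃ x, t.getLast? = some x ∧ ∃ a ∈ lastTops T, x.head? = some a := by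
  have hne := hT.ne_nil _ ht
  have hl := List.getLast?_eq_some_getLast hne
  obtain ⟨a, _, ha⟩ := hT.inPart ht (List.getLast_mem hne)
  exact ⟨_, hl, a, ⟨_, ⟨_, ht, hl⟩, ha⟩, ha⟩

theorem firstTops_subset (T : Set (Trace A)) : firstTops T ⊆ tops T := by
  rintro a ⟨x, hx, ha⟩
  obtain ⟨t, ht, hx⟩ := mem_of_starts hx
  exact ⟨t, ht, x, hx, ha⟩

theorem lastTops_subset (T : Set (Trace A)) : lastTops T ⊆ tops T := by
  rintro a ⟨x, hx, ha⟩
  obtain ⟨t, ht, hx⟩ := mem_of_ends hx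
  exact ⟨t, ht, x, hx, ha⟩

theorem DFEdge.left {T : Set (Trace A)} {a b : A} (h : DFEdge T a b) : a ∈ tops T := by
  obtain ⟨x, y, h, hx, hy⟩ := h
  obtain ⟨t, ht, hx'⟩ := h.mem_left
  exact ⟨t, ht, x, hx', hx⟩

theorem DFEdge.right {T : Set (Trace A)} {a b : A} (h : DFEdge T a b) : b ∈ tops T := by
  obtain ⟨x, y, h, hx, hy⟩ := h
  obtain ⟨t, ht, hy'⟩ := h.mem_right
  exact ⟨t, ht, y, hy', hy⟩

theorem firstTops_nonempty {T : Set (Trace A)} (hT : Proper T) : (firstTops T).Nonempty := by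
  obtain ⟨t, ht⟩ := hT.nonempty
  obtain ⟨_, _, a, ha, _⟩ := hT.exists_head ht
  exact ⟨a, ha⟩

theorem lastTops_nonempty {T : Set (Trace A)} (hT : Proper T) : (lastTops T).Nonempty := by
  obtain ⟨t, ht⟩ := hT.nonempty
  obtain ⟨_, _, a, ha, _⟩ := hT.exists_last ht
  exact ⟨a, ha⟩

theorem restrict_append (V : Set A) (s t : Trace A) :
    restrict V (s ++ t) = restrict V s ++ restrict V t :=
  List.filter_append ..

theorem restrictCompl_append (V : Set A) (s t : Trace A) :
    restrictCompl V (s ++ t) = restrictCompl V s ++ restrictCompl V t :=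
  List.filter_append ..

theorem restrict_eq_self {V : Set A} {t : Trace A} (h : ∀ x ∈ t, InPart V x) :
    restrict V t = t :=
  List.filter_eq_self.2 (by simpa using h)

theorem restrict_eq_nil {V : Set A} {t : Trace A} (h : ∀ x ∈ t, ¬ InPart V x) :
    restrict V t = [] :=
  List.filter_eq_nil_iff.2 (by simpa using h)

theorem restrictCompl_eq_self {V : Set A} {t : Trace A} (h : ∀ x ∈ t, ¬ InPart V x) :
    restrictCompl V t = t :=
  List.filter_eq_self.2 (by simpa using h)

theorem restrictCompl_eq_nil {V : Set A} {t : Trace A} (h : ∀ x ∈ t, InPart V x) :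
    restrictCompl V t = [] :=
  List.filter_eq_nil_iff.2 (by simpa using h)

theorem mem_restrict {V : Set A} {t : Trace A} {x : Event A} :
    x ∈ restrict V t ↔ x ∈ t ∧ InPart V x := by
  simp [restrict]

theorem mem_restrictCompl {V : Set A} {t : Trace A} {x : Event A} :
    x ∈ restrictCompl V t ↔ x ∈ t ∧ ¬ InPart V x := by
  simp [restrictCompl]

theorem restrict_cons_of_mem {V : Set A} {x : Event A} (t : Trace A) (h : InPart V x) :
    restrict V (x :: t) = x :: restrict V t := by
  simp [restrict, h]

theorem restrict_restrictCompl {V W : Set A} (h : Disjoint V W) (t : Trace A) :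
    restrict V (restrictCompl W t) = restrict V t := by
  rw [restrict, restrictCompl, List.filter_filter]
  refine List.filter_congr fun x _ => ?_
  by_cases hx : InPart V x
  · have : ¬ InPart W x := by
      rintro ⟨b, hb, hxb⟩
      obtain ⟨a, ha, hxa⟩ := hx
      obtain rfl : a = b := by simpa [hxa] using hxb
      exact Set.disjoint_left.1 h ha hb
    simp [hx, this]
  · simp [hx]

section Family

variable {n : ℕ} {Ts : Fin n → Set (Trace A)}

theorem IsFamily.eq_of_mem (h : IsFamily Ts) {i j : Fin n} {a : A} (hi : a ∈ tops (Ts i))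
    (hj : a ∈ tops (Ts j)) : i = j := by
  by_contra hij
  exact Set.disjoint_left.1 (h.disjoint i j hij) hi hj

theorem IsFamily.inPart_iff (h : IsFamily Ts) {i j : Fin n} {t : Trace A} (ht : t ∈ Ts j)
    {x : Event A} (hx : x ∈ t) : InPart (tops (Ts i)) x ↔ i = j := by
  constructor
  · rintro ⟨a, ha, hxa⟩
    exact h.eq_of_mem ha ⟨t, ht, x, hx, hxa⟩
  · rintro rfl
    exact (h.proper i).inPart ht hx

theorem IsFamily.inPart_inj (h : IsFamily Ts) {i j : Fin n} {x : Event A}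
    (hi : InPart (tops (Ts i)) x) (hj : InPart (tops (Ts j)) x) : i = j := by
  obtain ⟨a, ha, hxa⟩ := hi
  obtain ⟨b, hb, hxb⟩ := hj
  obtain rfl : a = b := by simpa [hxa] using hxb
  exact h.eq_of_mem ha hb

theorem IsFamily.restrict_flatten (h : IsFamily Ts) {ts : Fin n → Trace A}
    (hts : ∀ i, ts i ∈ Ts i) (i : Fin n) :
    restrict (tops (Ts i)) (List.ofFn ts).flatten = ts i := by
  obtain ⟨p, q, hpq, hp, hq⟩ := flatten_ofFn_split ts i
  rw [hpq, restrict_append, restrict_append,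
    restrict_eq_self fun x hx => (h.proper i).inPart (hts i) hx,
    restrict_eq_nil (t := p), restrict_eq_nil (t := q)]
  · simp
  · intro x hx
    obtain ⟨j, hj, hx⟩ := (hq x).1 hx
    rw [h.inPart_iff (hts j) hx]
    exact hj.ne
  · intro x hx
    obtain ⟨j, hj, hx⟩ := (hp x).1 hx
    rw [h.inPart_iff (hts j) hx]
    exact hj.ne'

/-- With disjoint alphabets, the shuffle is determined by the restrictions. -/
theorem IsFamily.mem_par_iff (h : IsFamily Ts) {t : Trace A} :
    t ∈ Op.par.join Ts ↔
      (∀ x ∈ t, ∃ i, InPart (tops (Ts i)) x) ∧ ∀ i, restrict (tops (Ts i)) t ∈ Ts i := by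
  classical
  constructor
  · rintro ⟨ts, hts, hi⟩
    refine ⟨fun x hx => ?_, fun i => ?_⟩
    · obtain ⟨i, hx⟩ := hi.mem_iff.1 hx
      exact ⟨i, (h.proper i).inPart (hts i) hx⟩
    · have := hi.filter_eq (p := fun i x => decide (InPart (tops (Ts i)) x))
        (fun i j x hx => by simp [h.inPart_iff (hts j) hx]) i
      rw [show restrict (tops (Ts i)) t = ts i by rw [← this, restrict]]
      exact hts i
  · rintro ⟨hc, hr⟩
    refine ⟨_, hr, ?_⟩
    refine interleave_filter (fun i x => @decide (InPart (tops (Ts i)) x) (Classical.propDecidable _))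
      t fun x hx => ?_
    obtain ⟨i, hi⟩ := hc x hx
    refine ⟨i, fun j => ?_⟩
    by_cases hji : j = i
    · subst hji
      simp [hi]
    · have : ¬ InPart (tops (Ts j)) x := fun hj => hji (h.inPart_inj hj hi)
      simp [hji, this]

/-- A concatenation is a particular shuffle; restrictions of sequence traces and non-emptiness of
shuffles are obtained from this. -/
theorem IsFamily.seq_subset_par (h : IsFamily Ts) : Op.seq.join Ts ⊆ Op.par.join Ts := by
  rintro _ ⟨ts, hts, rfl⟩
  rw [h.mem_par_iff]
  refine ⟨fun x hx => ?_, fun i => ?_⟩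
  · simp only [List.mem_flatten, List.mem_ofFn] at hx
    obtain ⟨_, ⟨i, rfl⟩, hx⟩ := hx
    exact ⟨i, (h.proper i).inPart (hts i) hx⟩
  · rw [h.restrict_flatten hts]
    exact hts i

theorem IsFamily.restrict_mem (h : IsFamily Ts) {op : Op} (hop : op = .seq ∨ op = .par)
    {t : Trace A} (ht : t ∈ op.join Ts) (i : Fin n) : restrict (tops (Ts i)) t ∈ Ts i := by
  rcases hop with rfl | rfl
  · exact (h.mem_par_iff.1 (h.seq_subset_par ht)).2 i
  · exact (h.mem_par_iff.1 ht).2 i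

theorem IsFamily.exists_seq (h : IsFamily Ts) (i : Fin n) {s : Trace A} (hs : s ∈ Ts i) :
    ∃ ts : Fin n → Trace A, (∀ j, ts j ∈ Ts j) ∧ ts i = s := by
  choose f hf using fun j => (h.proper j).nonempty
  refine ⟨Function.update f i s, fun j => ?_, by simp⟩
  by_cases hj : j = i
  · subst hj
    simpa using hs
  · simpa [hj] using hf j

theorem IsFamily.par_nonempty (h : IsFamily Ts) : (Op.par.join Ts).Nonempty := by
  choose f hf using fun j => (h.proper j).nonempty
  exact ⟨_, h.seq_subset_par ⟨f, hf, rfl⟩⟩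

/-- Membership in the shuffle sees only the restrictions, so one strand may be exchanged and placed
anywhere while the others keep their order. -/
theorem IsFamily.par_replace (h : IsFamily Ts) {t₀ t : Trace A} (h₀ : t₀ ∈ Op.par.join Ts)
    {i : Fin n} (hi : restrict (tops (Ts i)) t ∈ Ts i)
    (hc : restrictCompl (tops (Ts i)) t = restrictCompl (tops (Ts i)) t₀) :
    t ∈ Op.par.join Ts := by
  rw [h.mem_par_iff] at h₀ ⊢
  refine ⟨fun x hx => ?_, fun j => ?_⟩
  · by_cases hxi : InPart (tops (Ts i)) x
    · exact ⟨i, hxi⟩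
    · have := mem_restrictCompl.2 ⟨hx, hxi⟩
      rw [hc] at this
      exact h₀.1 x (mem_restrictCompl.1 this).1
  · by_cases hj : j = i
    · exact hj ▸ hi
    · rw [← restrict_restrictCompl (h.disjoint j i hj), hc, restrict_restrictCompl (h.disjoint j i hj)]
      exact h₀.2 j

theorem IsFamily.par_extend (h : IsFamily Ts) {t₀ : Trace A} (h₀ : t₀ ∈ Op.par.join Ts)
    {i : Fin n} {s : Trace A} (hs : s ∈ Ts i) :
    s ++ restrictCompl (tops (Ts i)) t₀ ∈ Op.par.join Ts ∧
      restrictCompl (tops (Ts i)) t₀ ++ s ∈ Op.par.join Ts := by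
  have h₁ : ∀ x ∈ s, InPart (tops (Ts i)) x := fun x hx => (h.proper i).inPart hs hx
  have h₂ : ∀ x ∈ restrictCompl (tops (Ts i)) t₀, ¬ InPart (tops (Ts i)) x :=
    fun x hx => (mem_restrictCompl.1 hx).2
  constructor
  · refine h.par_replace h₀ (i := i) ?_ ?_
    · rw [restrict_append, restrict_eq_self h₁, restrict_eq_nil h₂]
      simpa using hs
    · rw [restrictCompl_append, restrictCompl_eq_nil h₁, restrictCompl_eq_self h₂]
      simp
  · refine h.par_replace h₀ (i := i) ?_ ?_
    · rw [restrict_append, restrict_eq_self h₁, restrict_eq_nil h₂]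
      simpa using hs
    · rw [restrictCompl_append, restrictCompl_eq_nil h₁, restrictCompl_eq_self h₂]
      simp

/-- Every child trace can be executed without interruption under every operator. Events,
directly-follows pairs and length bounds are transferred between a child and its node this way. -/
theorem IsFamily.exists_infix (h : IsFamily Ts) (op : Op) {i : Fin n} {s : Trace A}
    (hs : s ∈ Ts i) : ∃ t ∈ op.join Ts, s <:+: t := by
  cases op with
  | xor => exact ⟨s, ⟨i, hs⟩, List.infix_refl s⟩
  | seq =>
    obtain ⟨ts, hts, rfl⟩ := h.exists_seq i hs
    obtain ⟨p, q, hpq, _⟩ := flatten_ofFn_split ts i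
    exact ⟨_, ⟨ts, hts, rfl⟩, p, q, hpq.symm⟩
  | par =>
    obtain ⟨t₀, h₀⟩ := h.par_nonempty
    exact ⟨_, (h.par_extend h₀ hs).1, List.infix_append_left⟩
  | loop =>
    by_cases hi : i.val = 0
    · exact ⟨s, mem_loop_body hi hs, List.infix_refl s⟩
    · obtain ⟨b, hb⟩ := (h.proper ⟨0, i.pos⟩).nonempty
      exact ⟨b ++ s ++ b, mem_loop_step rfl hb hi hs (mem_loop_body rfl hb), b, b, rfl⟩

theorem IsFamily.exists_mem (h : IsFamily Ts) (op : Op) {i : Fin n} {s : Trace A}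
    (hs : s ∈ Ts i) {x : Event A} (hx : x ∈ s) : ∃ t ∈ op.join Ts, x ∈ t :=
  let ⟨t, ht, hi⟩ := h.exists_infix op hs
  ⟨t, ht, hi.subset hx⟩

theorem IsFamily.follows (h : IsFamily Ts) (op : Op) {i : Fin n} {x y : Event A}
    (hf : Follows (Ts i) x y) : Follows (op.join Ts) x y := by
  obtain ⟨s, hs, hi⟩ := hf
  obtain ⟨t, ht, hi'⟩ := h.exists_infix op hs
  exact ⟨t, ht, hi.trans hi'⟩

theorem IsFamily.tops_join (h : IsFamily Ts) (op : Op) :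
    tops (op.join Ts) = ⋃ i, tops (Ts i) := by
  ext a
  rw [Set.mem_iUnion]
  constructor
  · rintro ⟨t, ht, x, hx, ha⟩
    obtain ⟨i, s, hs, hx⟩ := exists_mem_of_mem_join ht hx
    exact ⟨i, s, hs, x, hx, ha⟩
  · rintro ⟨i, s, hs, x, hx, ha⟩
    obtain ⟨t, ht, hx⟩ := h.exists_mem op hs hx
    exact ⟨t, ht, x, hx, ha⟩

theorem IsFamily.tops_subset (h : IsFamily Ts) (op : Op) (i : Fin n) :
    tops (Ts i) ⊆ tops (op.join Ts) := by
  rw [h.tops_join op]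
  exact Set.subset_iUnion (fun i => tops (Ts i)) i

theorem ne_nil_of_mem_join {X : Type u} {op : Op} {n : ℕ} (hn : 0 < n) {Ts : Fin n → Set (List X)}
    (h : ∀ i, ∀ t ∈ Ts i, t ≠ []) {t : List X} (ht : t ∈ op.join Ts) : t ≠ [] := by
  cases op with
  | xor => exact let ⟨i, hi⟩ := ht; h i t hi
  | seq =>
    obtain ⟨ts, hts, rfl⟩ := ht
    obtain ⟨x, hx⟩ := List.exists_mem_of_ne_nil _ (h ⟨0, hn⟩ _ (hts ⟨0, hn⟩))
    exact List.ne_nil_of_mem (List.mem_flatten.2 ⟨_, List.mem_ofFn.2 ⟨_, rfl⟩, hx⟩)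
  | par =>
    obtain ⟨ts, hts, hi⟩ := ht
    obtain ⟨x, hx⟩ := List.exists_mem_of_ne_nil _ (h ⟨0, hn⟩ _ (hts ⟨0, hn⟩))
    exact List.ne_nil_of_mem (hi.mem_iff.2 ⟨_, hx⟩)
  | loop =>
    cases ht with
    | body ht => exact let ⟨i, _, hi⟩ := ht; h i t hi
    | step ht hr hs =>
      obtain ⟨i, _, hi⟩ := ht
      simp [h i _ hi]

theorem IsFamily.join_proper (h : IsFamily Ts) (op : Op) (hn : 0 < n) : Proper (op.join Ts) where
  nonempty := by
    obtain ⟨s, hs⟩ := (h.proper ⟨0, hn⟩).nonempty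
    obtain ⟨t, ht, _⟩ := h.exists_infix op hs
    exact ⟨t, ht⟩
  ne_nil _ := ne_nil_of_mem_join hn fun i => (h.proper i).ne_nil
  event_ne_nil t ht x hx := by
    obtain ⟨i, s, hs, hx⟩ := exists_mem_of_mem_join ht hx
    exact (h.proper i).event_ne_nil s hs x hx

/-! ### The directly-follows relations of joins -/

theorem Follows.inPart_left {T : Set (Trace A)} (hT : Proper T) {x y : Event A}
    (h : Follows T x y) : InPart (tops T) x :=
  let ⟨_, ht, hx⟩ := h.mem_left
  hT.inPart ht hx

theorem Follows.inPart_right {T : Set (Trace A)} (hT : Proper T) {x y : Event A}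
    (h : Follows T x y) : InPart (tops T) y :=
  let ⟨_, ht, hx⟩ := h.mem_right
  hT.inPart ht hx

theorem inPart_of_starts {T : Set (Trace A)} (hT : Proper T) {x : Event A}
    (h : x ∈ starts T) : InPart (tops T) x :=
  let ⟨_, ht, hx⟩ := mem_of_starts h
  hT.inPart ht hx

theorem inPart_of_ends {T : Set (Trace A)} (hT : Proper T) {x : Event A}
    (h : x ∈ ends T) : InPart (tops T) x :=
  let ⟨_, ht, hx⟩ := mem_of_ends h
  hT.inPart ht hx

theorem pair_infix_restrict {V : Set A} {t : Trace A} {x y : Event A} (h : [x, y] <:+: t)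
    (hx : InPart V x) (hy : InPart V y) : [x, y] <:+: restrict V t := by
  obtain ⟨u, v, rfl⟩ := pair_infix_iff.1 h
  rw [restrict_append, restrict_cons_of_mem _ hx, restrict_cons_of_mem _ hy]
  exact pair_infix_iff.2 ⟨_, _, rfl⟩

theorem loop_starts_subset {B R : Set (Trace A)} (hB : ∀ t ∈ B, t ≠ []) :
    starts {t | LoopLang B R t} ⊆ starts B := by
  rintro x ⟨t, ht, hx⟩
  cases ht with
  | body ht => exact ⟨_, ht, hx⟩
  | step ht hr hs =>
    rw [List.append_assoc, List.head?_append_of_ne_nil _ (hB _ ht)] at hx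
    exact ⟨_, ht, hx⟩

theorem loop_ends_subset {B R : Set (Trace A)} (hB : ∀ t ∈ B, t ≠ []) :
    ends {t | LoopLang B R t} ⊆ ends B := by
  rintro x ⟨t, ht, hx⟩
  change LoopLang B R t at ht
  induction ht with
  | body ht => exact ⟨_, ht, hx⟩
  | step ht hr hs ih =>
    refine ih ?_
    rwa [List.getLast?_append_of_ne_nil] at hx
    cases hs with
    | body hb => exact hB _ hb
    | step hb _ _ => simp [hB _ hb]

/-- Since no block is empty, an adjacent pair lies inside one block or at the seam of two
consecutive blocks, and those alternate between body and loop-back. -/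
theorem loop_follows {B R : Set (Trace A)} (hB : ∀ t ∈ B, t ≠ []) (hR : ∀ t ∈ R, t ≠ [])
    {x y : Event A} (h : Follows {t | LoopLang B R t} x y) :
    Follows B x y ∨ Follows R x y ∨ (x ∈ ends B ∧ y ∈ starts R) ∨ (x ∈ ends R ∧ y ∈ starts B) := by
  obtain ⟨t, ht, h⟩ := h
  change LoopLang B R t at ht
  induction ht with
  | body ht => exact Or.inl ⟨_, ht, h⟩
  | step ht hr hs ih =>
    rcases pair_infix_append.1 h with h | h | ⟨h₁, h₂⟩
    · rcases pair_infix_append.1 h with h | h | ⟨h₁, h₂⟩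
      · exact Or.inl ⟨_, ht, h⟩
      · exact Or.inr (Or.inl ⟨_, hr, h⟩)
      · exact Or.inr (Or.inr (Or.inl ⟨⟨_, ht, h₁⟩, ⟨_, hr, h₂⟩⟩))
    · exact ih h
    · rw [List.getLast?_append_of_ne_nil _ (hR _ hr)] at h₁
      exact Or.inr (Or.inr (Or.inr ⟨⟨_, hr, h₁⟩, loop_starts_subset hB ⟨_, hs, h₂⟩⟩))

theorem IsFamily.loop_starts (h : IsFamily Ts) {x : Event A} :
    x ∈ starts (Op.loop.join Ts) ↔ ∃ i, i.val = 0 ∧ x ∈ starts (Ts i) := by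
  constructor
  · intro hx
    obtain ⟨t, ⟨i, hi, ht⟩, hx⟩ := loop_starts_subset
      (by rintro t ⟨i, _, ht⟩; exact (h.proper i).ne_nil t ht) hx
    exact ⟨i, hi, t, ht, hx⟩
  · rintro ⟨i, hi, t, ht, hx⟩
    exact ⟨t, mem_loop_body hi ht, hx⟩

theorem IsFamily.loop_ends (h : IsFamily Ts) {x : Event A} :
    x ∈ ends (Op.loop.join Ts) ↔ ∃ i, i.val = 0 ∧ x ∈ ends (Ts i) := by
  constructor
  · intro hx
    obtain ⟨t, ⟨i, hi, ht⟩, hx⟩ := loop_ends_subset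
      (by rintro t ⟨i, _, ht⟩; exact (h.proper i).ne_nil t ht) hx
    exact ⟨i, hi, t, ht, hx⟩
  · rintro ⟨i, hi, t, ht, hx⟩
    exact ⟨t, mem_loop_body hi ht, hx⟩

theorem IsFamily.loop_follows (h : IsFamily Ts) {x y : Event A}
    (hf : Follows (Op.loop.join Ts) x y) :
    (∃ i, Follows (Ts i) x y) ∨
      (∃ i j, i.val = 0 ∧ j.val ≠ 0 ∧ x ∈ ends (Ts i) ∧ y ∈ starts (Ts j)) ∨
      ∃ i j, i.val = 0 ∧ j.val ≠ 0 ∧ x ∈ ends (Ts j) ∧ y ∈ starts (Ts i) := by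
  rcases HierDisc.loop_follows (by rintro t ⟨i, _, ht⟩; exact (h.proper i).ne_nil t ht)
    (by rintro t ⟨i, _, ht⟩; exact (h.proper i).ne_nil t ht) hf with
    ⟨t, ⟨i, hi, ht⟩, h⟩ | ⟨t, ⟨i, hi, ht⟩, h⟩ | ⟨⟨t, ⟨i, hi, ht⟩, hx⟩, ⟨s, ⟨j, hj, hs⟩, hy⟩⟩ |
    ⟨⟨t, ⟨i, hi, ht⟩, hx⟩, ⟨s, ⟨j, hj, hs⟩, hy⟩⟩
  · exact Or.inl ⟨i, t, ht, h⟩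
  · exact Or.inl ⟨i, t, ht, h⟩
  · exact Or.inr (Or.inl ⟨i, j, hi, hj, ⟨t, ht, hx⟩, ⟨s, hs, hy⟩⟩)
  · exact Or.inr (Or.inr ⟨j, i, hj, hi, ⟨t, ht, hx⟩, ⟨s, hs, hy⟩⟩)

theorem loop_leave {i j : Fin n} (hi : i.val = 0) (hj : j.val ≠ 0)
    {x y : Event A} (hx : x ∈ ends (Ts i)) (hy : y ∈ starts (Ts j)) :
    Follows (Op.loop.join Ts) x y := by
  obtain ⟨b, hb, hx⟩ := hx
  obtain ⟨r, hr, hy⟩ := hy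
  refine ⟨b ++ r ++ b, mem_loop_step hi hb hj hr (mem_loop_body hi hb), ?_⟩
  exact List.infix_append_of_infix_left (pair_infix_append.2 (Or.inr (Or.inr ⟨hx, hy⟩)))

theorem loop_enter {i j : Fin n} (hi : i.val = 0) (hj : j.val ≠ 0)
    {x y : Event A} (hx : x ∈ ends (Ts j)) (hy : y ∈ starts (Ts i)) :
    Follows (Op.loop.join Ts) x y := by
  obtain ⟨r, hr, hx⟩ := hx
  obtain ⟨b, hb, hy⟩ := hy
  refine ⟨b ++ r ++ b, mem_loop_step hi hb hj hr (mem_loop_body hi hb), ?_⟩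
  rw [List.append_assoc]
  exact List.infix_append_of_infix_right (pair_infix_append.2 (Or.inr (Or.inr ⟨hx, hy⟩)))

/-- No operator creates new adjacencies inside a child. For sequence and parallel, restriction keeps
the pair adjacent; in a loop, a non-empty block of another child separates two blocks of the same
child. -/
theorem IsFamily.follows_child (h : IsFamily Ts) {op : Op} {i : Fin n} {x y : Event A}
    (hf : Follows (op.join Ts) x y) (hx : InPart (tops (Ts i)) x) (hy : InPart (tops (Ts i)) y) :
    Follows (Ts i) x y := by
  cases op with
  | xor =>
    obtain ⟨t, ⟨j, hj⟩, hf⟩ := hf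
    obtain rfl := (h.inPart_iff hj (hf.subset (by simp))).1 hx
    exact ⟨t, hj, hf⟩
  | seq =>
    obtain ⟨t, ht, hf⟩ := hf
    exact ⟨_, h.restrict_mem (Or.inl rfl) ht i, pair_infix_restrict hf hx hy⟩
  | par =>
    obtain ⟨t, ht, hf⟩ := hf
    exact ⟨_, h.restrict_mem (Or.inr rfl) ht i, pair_infix_restrict hf hx hy⟩
  | loop =>
    rcases h.loop_follows hf with ⟨j, hj⟩ | ⟨k, j, hk, hj, hxk, hyj⟩ | ⟨k, j, hk, hj, hxj, hyk⟩
    · obtain rfl := h.inPart_inj hx (hj.inPart_left (h.proper j))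
      exact hj
    · have h₁ := h.inPart_inj hx (inPart_of_ends (h.proper k) hxk)
      have h₂ := h.inPart_inj hy (inPart_of_starts (h.proper j) hyj)
      subst h₁
      exact absurd (h₂ ▸ hk) hj
    · have h₁ := h.inPart_inj hx (inPart_of_ends (h.proper j) hxj)
      have h₂ := h.inPart_inj hy (inPart_of_starts (h.proper k) hyk)
      subst h₁
      exact absurd (h₂ ▸ hk) hj

theorem IsFamily.edge_child (h : IsFamily Ts) {op : Op} {i : Fin n} {a b : A}
    (hf : DFEdge (op.join Ts) a b) (ha : a ∈ tops (Ts i)) (hb : b ∈ tops (Ts i)) :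
    DFEdge (Ts i) a b :=
  let ⟨x, y, hf, hx, hy⟩ := hf
  ⟨x, y, h.follows_child hf ⟨a, ha, hx⟩ ⟨b, hb, hy⟩, hx, hy⟩

theorem IsFamily.edge (h : IsFamily Ts) (op : Op) {i : Fin n} {a b : A}
    (hf : DFEdge (Ts i) a b) : DFEdge (op.join Ts) a b :=
  let ⟨x, y, hf, hx, hy⟩ := hf
  ⟨x, y, h.follows op hf, hx, hy⟩

theorem IsFamily.xor_edge (h : IsFamily Ts) {i j : Fin n} {a b : A}
    (hf : DFEdge (Op.xor.join Ts) a b) (ha : a ∈ tops (Ts i)) (hb : b ∈ tops (Ts j)) : i = j := by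
  obtain ⟨x, y, ⟨t, ⟨k, hk⟩, hf⟩, hx, hy⟩ := hf
  have h₁ := (h.inPart_iff (i := i) hk (x := x) (hf.subset (by simp))).1 ⟨a, ha, hx⟩
  have h₂ := (h.inPart_iff (i := j) hk (x := y) (hf.subset (by simp))).1 ⟨b, hb, hy⟩
  rw [h₁, h₂]

/-- The child index never decreases along a sequence trace; all acyclicity statements for sequences
come from here. -/
theorem IsFamily.seq_sorted (h : IsFamily Ts) {t : Trace A} (ht : t ∈ Op.seq.join Ts) :
    t.Pairwise fun x y => ∀ i j, InPart (tops (Ts i)) x → InPart (tops (Ts j)) y → i ≤ j := by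
  obtain ⟨ts, hts, rfl⟩ := ht
  rw [List.pairwise_flatten]
  constructor
  · intro s hs
    obtain ⟨k, rfl⟩ := List.mem_ofFn.1 hs
    refine List.pairwise_iff_forall_sublist.2 fun hxy i j hi hj => ?_
    rw [h.inPart_iff (hts k) (hxy.subset (by simp))] at hi hj
    rw [hi, hj]
  · rw [List.pairwise_ofFn]
    intro k l hkl x hx y hy i j hi hj
    rw [h.inPart_iff (hts k) hx] at hi
    rw [h.inPart_iff (hts l) hy] at hj
    rw [hi, hj]
    exact hkl.le

theorem IsFamily.seq_edge_le (h : IsFamily Ts) {i j : Fin n} {a b : A}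
    (hf : DFEdge (Op.seq.join Ts) a b) (ha : a ∈ tops (Ts i)) (hb : b ∈ tops (Ts j)) : i ≤ j := by
  obtain ⟨x, y, ⟨t, ht, hf⟩, hx, hy⟩ := hf
  have := (h.seq_sorted ht).sublist hf.sublist
  simp only [List.pairwise_cons, List.mem_singleton, forall_eq] at this
  exact this.1 i j ⟨a, ha, hx⟩ ⟨b, hb, hy⟩

theorem IsFamily.par_starts (h : IsFamily Ts) (i : Fin n) :
    starts (Ts i) ⊆ starts (Op.par.join Ts) := by
  rintro x ⟨s, hs, hx⟩
  obtain ⟨t₀, h₀⟩ := h.par_nonempty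
  refine ⟨_, (h.par_extend h₀ hs).1, ?_⟩
  rw [List.head?_append_of_ne_nil _ ((h.proper i).ne_nil s hs), hx]

theorem IsFamily.par_ends (h : IsFamily Ts) (i : Fin n) :
    ends (Ts i) ⊆ ends (Op.par.join Ts) := by
  rintro x ⟨s, hs, hx⟩
  obtain ⟨t₀, h₀⟩ := h.par_nonempty
  refine ⟨_, (h.par_extend h₀ hs).2, ?_⟩
  rw [List.getLast?_append_of_ne_nil _ ((h.proper i).ne_nil s hs), hx]

/-- With `s = u x v` and `s' = u' y v'`, the trace `u u' x y v v'` followed by the other strands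
makes `x` and `y` adjacent. -/
theorem IsFamily.par_follows (h : IsFamily Ts) {i j : Fin n} (hij : i ≠ j) {s s' : Trace A}
    (hs : s ∈ Ts i) (hs' : s' ∈ Ts j) {x y : Event A} (hx : x ∈ s) (hy : y ∈ s') :
    Follows (Op.par.join Ts) x y := by
  obtain ⟨t₀, h₀⟩ := h.par_nonempty
  obtain ⟨u, v, rfl⟩ := List.append_of_mem hx
  obtain ⟨u', v', rfl⟩ := List.append_of_mem hy
  have h₁ := (h.par_extend h₀ hs').1
  have hi : ∀ z ∈ u ++ x :: v, InPart (tops (Ts i)) z := fun z hz => (h.proper i).inPart hs hz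
  have hj : ∀ z ∈ u' ++ y :: v', ¬ InPart (tops (Ts i)) z := fun z hz hzi =>
    hij ((h.inPart_iff hs' hz).1 hzi)
  -- The trace `s' ++ w` already has the desired strand `j`; what is left is to exchange its strand
  -- `i` by `par_replace`.
  set w := restrictCompl (tops (Ts j)) t₀
  have hw : ∀ z ∈ restrictCompl (tops (Ts i)) w, ¬ InPart (tops (Ts i)) z := fun z hz =>
    (mem_restrictCompl.1 hz).2
  have e : u ++ u' ++ [x] ++ [y] ++ v ++ v' ++ restrictCompl (tops (Ts i)) w =
      u ++ (u' ++ x :: y :: (v ++ v' ++ restrictCompl (tops (Ts i)) w)) := by simp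
  refine ⟨u ++ u' ++ [x] ++ [y] ++ v ++ v' ++ restrictCompl (tops (Ts i)) w,
    h.par_replace h₁ (i := i) ?_ ?_, ?_⟩
  · simp only [restrict_append]
    rw [restrict_eq_self (t := u), restrict_eq_self (t := [x]), restrict_eq_self (t := v),
      restrict_eq_nil (t := u'), restrict_eq_nil (t := [y]), restrict_eq_nil (t := v'),
      restrict_eq_nil hw]
    · simpa using hs
    all_goals
      intro z hz
      first
        | exact hi z (by simp at hz ⊢; tauto)
        | exact hj z (by simp at hz ⊢; tauto)
  · rw [restrictCompl_append _ (u' ++ y :: v'), restrictCompl_eq_self hj]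
    simp only [restrictCompl_append]
    rw [restrictCompl_eq_nil (t := u), restrictCompl_eq_nil (t := [x]),
      restrictCompl_eq_nil (t := v), restrictCompl_eq_self (t := u'),
      restrictCompl_eq_self (t := [y]), restrictCompl_eq_self (t := v'),
      restrictCompl_eq_self hw]
    · simp
    all_goals
      intro z hz
      first
        | exact hi z (by simp at hz ⊢; tauto)
        | exact hj z (by simp at hz ⊢; tauto)
  · rw [e]
    exact List.infix_append_of_infix_right (pair_infix_iff.2 ⟨_, _, rfl⟩)

theorem IsFamily.par_edge (h : IsFamily Ts) {i j : Fin n} (hij : i ≠ j) {a b : A}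
    (ha : a ∈ tops (Ts i)) (hb : b ∈ tops (Ts j)) : DFEdge (Op.par.join Ts) a b :=
  let ⟨_, hs, x, hx, hxa⟩ := ha
  let ⟨_, hs', y, hy, hyb⟩ := hb
  ⟨x, y, h.par_follows hij hs hs' hx hy, hxa, hyb⟩

end Family

end Languages

-- Languages in normal form

section NormalForms

variable {A : Type u}

/-- `NF k T`: the language `T` is built up from single activities by naming and by operators, with
operators of the same kind merged. The kind `k` is the topmost operator, if there is one. -/
inductive NF : Option Op → Set (Trace A) → Prop
  | act (a : A) : NF none {[[a]]}
  | named (f : A) {k : Option Op} {T : Set (Trace A)} (h : NF k T) :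
      NF none (List.map (List.cons f) '' T)
  | node (op : Op) {n : ℕ} (hn : 2 ≤ n) {ks : Fin n → Option Op} {Ts : Fin n → Set (Trace A)}
      (h : ∀ i, NF (ks i) (Ts i)) (hd : ∀ i j, i ≠ j → Disjoint (tops (Ts i)) (tops (Ts j)))
      (hk : op ≠ .loop → ∀ i, ks i ≠ some op)
      (hb : op = .loop → ∀ i, i.val = 0 →
        ks i ≠ some .loop ∧ Disjoint (firstTops (Ts i)) (lastTops (Ts i)))
      (hr : op = .loop → ∀ i, i.val ≠ 0 → ks i ≠ some .xor) : NF (some op) (op.join Ts)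

theorem NF.proper {k : Option Op} {T : Set (Trace A)} (h : NF k T) : Proper T := by
  induction h with
  | act a => exact ⟨⟨_, rfl⟩, by simp, by simp⟩
  | named f _ ih =>
    refine ⟨ih.nonempty.image _, ?_, ?_⟩
    · rintro _ ⟨t, ht, rfl⟩
      simpa using ih.ne_nil t ht
    · rintro _ ⟨t, ht, rfl⟩ x hx
      obtain ⟨y, _, rfl⟩ := List.mem_map.1 hx
      simp
  | node op hn h hd _ _ _ ih => exact IsFamily.join_proper ⟨ih, hd⟩ op (by omega)

theorem tops_act (a : A) : tops {[[a]]} = {a} := by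
  ext b
  simp [tops, eq_comm]

theorem tops_named_subset (f : A) (T : Set (Trace A)) :
    tops (List.map (List.cons f) '' T) ⊆ {f} := by
  rintro a ⟨_, ⟨t, ht, rfl⟩, x, hx, ha⟩
  obtain ⟨y, _, rfl⟩ := List.mem_map.1 hx
  simpa [eq_comm] using ha

/-- Without an operator on top the graph has a single node, which no cut can divide. -/
theorem NF.tops_subsingleton {T : Set (Trace A)} (h : NF none T) : (tops T).Subsingleton := by
  cases h with
  | act a =>
    rw [tops_act]
    exact Set.subsingleton_singleton
  | named f _ => exact Set.subsingleton_singleton.anti (tops_named_subset f _)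

/-! ### Paths in the directly-follows graph -/

theorem reach_of_trace {T : Set (Trace A)} (hT : Proper T) {t : Trace A} (ht : t ∈ T)
    {u v : Trace A} {x y : Event A} (e : t = u ++ x :: v) (hy : y ∈ v) {a b : A}
    (ha : x.head? = some a) (hb : y.head? = some b) : Relation.TransGen (DFEdge T) a b := by
  induction v generalizing u x a with
  | nil => simp at hy
  | cons z v ih =>
    have hz : z ∈ t := by simp [e]
    obtain ⟨c, _, hc⟩ := hT.inPart ht hz
    have hac : DFEdge T a c := ⟨x, z, ⟨t, ht, pair_infix_iff.2 ⟨u, v, e⟩⟩, ha, hc⟩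
    rcases List.mem_cons.1 hy with rfl | hy
    · obtain rfl : c = b := by simpa [hc] using hb
      exact .single hac
    · exact .head hac (ih (u := u ++ [x]) (by simp [e]) hy hc)

section Family

variable {n : ℕ} {Ts : Fin n → Set (Trace A)}

theorem exists_ne_fin (hn : 2 ≤ n) (i : Fin n) : ∃ j : Fin n, j ≠ i := by
  have : Nontrivial (Fin n) := Fin.nontrivial_iff_two_le.2 hn
  exact exists_ne i

theorem IsFamily.exists_of_mem_tops (h : IsFamily Ts) {op : Op} {a : A}
    (ha : a ∈ tops (op.join Ts)) : ∃ i, a ∈ tops (Ts i) := by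
  rw [h.tops_join op] at ha
  exact Set.mem_iUnion.1 ha

theorem IsFamily.par_connected (h : IsFamily Ts) (hn : 2 ≤ n) {a b : A}
    (ha : a ∈ tops (Op.par.join Ts)) (hb : b ∈ tops (Op.par.join Ts)) :
    Relation.TransGen (DFEdge (Op.par.join Ts)) a b := by
  obtain ⟨i, ha⟩ := h.exists_of_mem_tops ha
  obtain ⟨j, hb⟩ := h.exists_of_mem_tops hb
  by_cases hij : i = j
  · subst hij
    obtain ⟨k, hk⟩ := exists_ne_fin hn i
    obtain ⟨c, hc⟩ := (h.proper k).tops_nonempty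
    exact .head (h.par_edge hk.symm ha hc) (.single (h.par_edge hk hc hb))
  · exact .single (h.par_edge hij ha hb)

/-- A loop trace through `a`, a loop-back, and a loop trace through `b` together form one loop
trace, and reading along it gives the path. -/
theorem IsFamily.loop_connected (h : IsFamily Ts) (hn : 2 ≤ n) {a b : A}
    (ha : a ∈ tops (Op.loop.join Ts)) (hb : b ∈ tops (Op.loop.join Ts)) :
    Relation.TransGen (DFEdge (Op.loop.join Ts)) a b := by
  obtain ⟨t, ht, x, hx, ha⟩ := ha
  obtain ⟨s, hs, y, hy, hb⟩ := hb
  obtain ⟨r, hr⟩ := (h.proper ⟨1, hn⟩).nonempty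
  have hm : t ++ r ++ s ∈ Op.loop.join Ts :=
    LoopLang.trans ht
      (show r ∈ {s | ∃ i : Fin n, i.val ≠ 0 ∧ s ∈ Ts i} from ⟨⟨1, hn⟩, one_ne_zero, hr⟩) hs
  obtain ⟨u, v, rfl⟩ := List.append_of_mem hx
  exact reach_of_trace (h.join_proper .loop (by omega)) hm (u := u) (v := v ++ r ++ s) (y := y)
    (by simp) (by simp [hy]) ha hb

theorem IsFamily.seq_reach (h : IsFamily Ts) {i j : Fin n} (hij : i < j) {a b : A}
    (ha : a ∈ tops (Ts i)) (hb : b ∈ tops (Ts j)) :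
    Relation.TransGen (DFEdge (Op.seq.join Ts)) a b := by
  obtain ⟨s, hs, x, hx, ha⟩ := ha
  obtain ⟨s', hs', y, hy, hb⟩ := hb
  obtain ⟨ts, hts, rfl⟩ := h.exists_seq i hs
  have hts' : ∀ k, Function.update ts j s' k ∈ Ts k := by
    intro k
    by_cases hk : k = j
    · subst hk
      simpa using hs'
    · simpa [hk] using hts k
  obtain ⟨p, q, hpq, hp, hq⟩ := flatten_ofFn_split (Function.update ts j s') i
  rw [Function.update_of_ne hij.ne] at hpq
  obtain ⟨u, v, huv⟩ := List.append_of_mem hx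
  have hyq : y ∈ q := (hq y).2 ⟨j, hij, by simpa using hy⟩
  exact reach_of_trace (h.join_proper .seq i.pos) ⟨_, hts', rfl⟩ (u := p ++ u) (v := v ++ q)
    (y := y) (by rw [hpq, huv]; simp) (by simp [hyq]) ha hb

theorem IsFamily.seq_reach_le (h : IsFamily Ts) {i j : Fin n} {a b : A}
    (hr : Relation.TransGen (DFEdge (Op.seq.join Ts)) a b) (ha : a ∈ tops (Ts i))
    (hb : b ∈ tops (Ts j)) : i ≤ j := by
  induction hr generalizing j with
  | single he => exact h.seq_edge_le he ha hb
  | tail _ he ih =>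
    obtain ⟨k, hk⟩ := h.exists_of_mem_tops he.left
    exact (ih hk).trans (h.seq_edge_le he hk hb)

/-- The child index is monotone along edges, so a path that starts and ends in child `i` never
leaves it. -/
theorem IsFamily.seq_reach_child (h : IsFamily Ts) {i : Fin n} {a b : A}
    (hr : Relation.TransGen (DFEdge (Op.seq.join Ts)) a b) (ha : a ∈ tops (Ts i))
    (hb : b ∈ tops (Ts i)) : Relation.TransGen (DFEdge (Ts i)) a b := by
  induction hr with
  | single he => exact .single (h.edge_child he ha hb)
  | tail hr he ih =>
    obtain ⟨k, hk⟩ := h.exists_of_mem_tops he.left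
    obtain rfl : k = i := le_antisymm (h.seq_edge_le he hk hb) (h.seq_reach_le hr ha hk)
    exact .tail (ih hk) (h.edge_child he hk hb)

theorem IsFamily.xor_reach (h : IsFamily Ts) {i j : Fin n} {a b : A}
    (hr : Relation.TransGen (DFEdge (Op.xor.join Ts)) a b) (ha : a ∈ tops (Ts i))
    (hb : b ∈ tops (Ts j)) : i = j := by
  induction hr generalizing j with
  | single he => exact h.xor_edge he ha hb
  | tail _ he ih =>
    obtain ⟨k, hk⟩ := h.exists_of_mem_tops he.left
    exact (ih hk).trans (h.xor_edge he hk hb)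

/-- By disjointness of the alphabets, of the possible adjacencies in a loop only the seam from a
body block to a loop-back block fits. -/
theorem IsFamily.loop_edge_leave (h : IsFamily Ts) {i j : Fin n} (hi : i.val = 0)
    (hj : j.val ≠ 0) {a b : A} (he : DFEdge (Op.loop.join Ts) a b) (ha : a ∈ tops (Ts i))
    (hb : b ∈ tops (Ts j)) : a ∈ lastTops (Ts i) ∧ b ∈ firstTops (Ts j) := by
  obtain ⟨x, y, hf, hxa, hyb⟩ := he
  have hx : InPart (tops (Ts i)) x := ⟨a, ha, hxa⟩
  have hy : InPart (tops (Ts j)) y := ⟨b, hb, hyb⟩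
  rcases h.loop_follows hf with ⟨k, hk⟩ | ⟨k, l, hk, hl, hxk, hyl⟩ | ⟨k, l, hk, hl, hxl, hyk⟩
  · have h₁ := h.inPart_inj hx (hk.inPart_left (h.proper k))
    have h₂ := h.inPart_inj hy (hk.inPart_right (h.proper k))
    exact absurd (h₂.trans h₁.symm ▸ hi) hj
  · obtain rfl := h.inPart_inj hx (inPart_of_ends (h.proper k) hxk)
    obtain rfl := h.inPart_inj hy (inPart_of_starts (h.proper l) hyl)
    exact ⟨⟨x, hxk, hxa⟩, ⟨y, hyl, hyb⟩⟩
  · have h₁ := h.inPart_inj hx (inPart_of_ends (h.proper l) hxl)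
    exact absurd (h₁ ▸ hi) hl

theorem IsFamily.loop_edge_enter (h : IsFamily Ts) {i j : Fin n} (hi : i.val = 0)
    (hj : j.val ≠ 0) {a b : A} (he : DFEdge (Op.loop.join Ts) b a) (ha : a ∈ tops (Ts i))
    (hb : b ∈ tops (Ts j)) : a ∈ firstTops (Ts i) ∧ b ∈ lastTops (Ts j) := by
  obtain ⟨y, x, hf, hyb, hxa⟩ := he
  have hx : InPart (tops (Ts i)) x := ⟨a, ha, hxa⟩
  have hy : InPart (tops (Ts j)) y := ⟨b, hb, hyb⟩
  rcases h.loop_follows hf with ⟨k, hk⟩ | ⟨k, l, hk, hl, hyk, hxl⟩ | ⟨k, l, hk, hl, hyl, hxk⟩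
  · have h₁ := h.inPart_inj hx (hk.inPart_right (h.proper k))
    have h₂ := h.inPart_inj hy (hk.inPart_left (h.proper k))
    exact absurd (h₂.trans h₁.symm ▸ hi) hj
  · have h₁ := h.inPart_inj hx (inPart_of_starts (h.proper l) hxl)
    exact absurd (h₁ ▸ hi) hl
  · obtain rfl := h.inPart_inj hx (inPart_of_starts (h.proper k) hxk)
    obtain rfl := h.inPart_inj hy (inPart_of_ends (h.proper l) hyl)
    exact ⟨⟨x, hxk, hxa⟩, ⟨y, hyl, hyb⟩⟩

theorem IsFamily.reach (h : IsFamily Ts) (op : Op) {i : Fin n} {a b : A}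
    (hr : Relation.TransGen (DFEdge (Ts i)) a b) : Relation.TransGen (DFEdge (op.join Ts)) a b :=
  Relation.TransGen.mono (r := DFEdge (Ts i)) (fun _ _ => h.edge op) _ _ hr

end Family

/-! ### Sets of activities that a cut cannot divide -/

/-- There is no way to divide `V` such that `G` holds across the division. -/
def Indivisible (V : Set A) (G : A → A → Prop) : Prop :=
  ∀ U : Set A, (∀ a ∈ V, ∀ b ∈ V, a ∈ U → b ∉ U → G a b) → ∀ a ∈ V, ∀ b ∈ V, a ∈ U → b ∈ U

/-- The two activities are not connected by an edge. -/
def Unlinked (E : A → A → Prop) (a b : A) : Prop :=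
  ¬ E a b ∧ ¬ E b a

/-- There are paths between the two activities in exactly one direction. -/
def Ordered (E : A → A → Prop) (a b : A) : Prop :=
  (Relation.TransGen E a b ∧ ¬ Relation.TransGen E b a) ∨
    (Relation.TransGen E b a ∧ ¬ Relation.TransGen E a b)

/-- The two activities are connected by edges in both directions. -/
def Linked (E : A → A → Prop) (a b : A) : Prop :=
  E a b ∧ E b a

/-- The relation that holds between different parts of a cut. -/
def Op.across (op : Op) (E : A → A → Prop) : A → A → Prop :=
  match op with
  | .xor => Unlinked E
  | .seq => Ordered E
  | .par => Linked E
  | .loop => fun _ _ => True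

theorem Indivisible.mono {V : Set A} {G H : A → A → Prop} (h : Indivisible V G)
    (hG : ∀ a ∈ V, ∀ b ∈ V, H a b → G a b) : Indivisible V H :=
  fun U hU => h U fun a ha b hb hau hbu => hG a ha b hb (hU a ha b hb hau hbu)

theorem indivisible_of_subsingleton {V : Set A} (h : V.Subsingleton) (G : A → A → Prop) :
    Indivisible V G :=
  fun _ _ _ ha _ hb hau => h ha hb ▸ hau

theorem indivisible_of_forall_not {V : Set A} {G : A → A → Prop}
    (h : ∀ a ∈ V, ∀ b ∈ V, ¬ G a b) : Indivisible V G := by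
  intro U hU a ha b hb hau
  by_contra hbu
  exact h a ha b hb (hU a ha b hb hau hbu)

/-- If `G` fails between two complementary subsets, no division is possible. -/
theorem indivisible_of_two {V : Set A} {G : A → A → Prop} {p : A → Prop}
    (h₁ : ∃ a ∈ V, p a) (h₂ : ∃ a ∈ V, ¬ p a)
    (h : ∀ a ∈ V, ∀ b ∈ V, p a → ¬ p b → ¬ G a b ∧ ¬ G b a) : Indivisible V G := by
  intro U hU
  have key : ∀ a ∈ V, ∀ b ∈ V, p a → ¬ p b → (a ∈ U ↔ b ∈ U) := by
    intro a ha b hb hpa hpb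
    constructor
    · intro hau
      by_contra hbu
      exact (h a ha b hb hpa hpb).1 (hU a ha b hb hau hbu)
    · intro hbu
      by_contra hau
      exact (h a ha b hb hpa hpb).2 (hU b hb a ha hbu hau)
  obtain ⟨c, hc, hpc⟩ := h₁
  obtain ⟨d, hd, hpd⟩ := h₂
  intro a ha b hb hau
  by_cases hpa : p a <;> by_cases hpb : p b
  · exact (key b hb d hd hpb hpd).2 ((key a ha d hd hpa hpd).1 hau)
  · exact (key a ha b hb hpa hpb).1 hau
  · exact (key b hb a ha hpb hpa).2 hau
  · exact (key c hc b hb hpc hpb).1 ((key c hc a ha hpc hpa).2 hau)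

/-- Membership in `U` is constant along edges, hence on weakly connected components. The
intermediate `c` serves two activities of the same child of a sequence, which need only be connected
through another child. -/
theorem unlinked_indivisible {V : Set A} {E : A → A → Prop}
    (h : ∀ a ∈ V, ∀ b ∈ V, (Relation.TransGen E a b ∨ Relation.TransGen E b a) ∨
      ∃ c, (Relation.TransGen E a c ∨ Relation.TransGen E c a) ∧
        (Relation.TransGen E c b ∨ Relation.TransGen E b c))
    (hV : ∀ a b, E a b → a ∈ V ∧ b ∈ V) : Indivisible V (Unlinked E) := by
  intro U hU
  have he : ∀ a b, E a b → (a ∈ U ↔ b ∈ U) := by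
    intro a b hab
    obtain ⟨ha, hb⟩ := hV a b hab
    constructor
    · intro hau
      by_contra hbu
      exact (hU a ha b hb hau hbu).1 hab
    · intro hbu
      by_contra hau
      exact (hU b hb a ha hbu hau).2 hab
  have hr : ∀ a b, Relation.TransGen E a b → (a ∈ U ↔ b ∈ U) := by
    intro a b hab
    induction hab with
    | single h => exact he _ _ h
    | tail _ h ih => exact ih.trans (he _ _ h)
  have hr' : ∀ a b, Relation.TransGen E a b ∨ Relation.TransGen E b a → (a ∈ U ↔ b ∈ U) :=
    fun a b h => h.elim (hr a b) fun h => (hr b a h).symm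
  intro a ha b hb
  rcases h a ha b hb with h | ⟨c, h₁, h₂⟩
  · exact (hr' a b h).1
  · exact ((hr' a c h₁).trans (hr' c b h₂)).1

section Family

variable {n : ℕ} {Ts : Fin n → Set (Trace A)}

/-- It suffices that `G` fails between child `0` and the rest: both sides are non-empty, so
`indivisible_of_two` applies. -/
theorem IsFamily.indivisible_of_first (h : IsFamily Ts) (hn : 2 ≤ n) {op : Op}
    {G : A → A → Prop}
    (hG : ∀ i j, i.val = 0 → j.val ≠ 0 → ∀ a ∈ tops (Ts i), ∀ b ∈ tops (Ts j),
      ¬ G a b ∧ ¬ G b a) : Indivisible (tops (op.join Ts)) G := by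
  refine indivisible_of_two (p := fun a => a ∈ tops (Ts ⟨0, by omega⟩)) ?_ ?_ ?_
  · obtain ⟨a, ha⟩ := (h.proper ⟨0, by omega⟩).tops_nonempty
    exact ⟨a, h.tops_subset op _ ha, ha⟩
  · obtain ⟨a, ha⟩ := (h.proper ⟨1, hn⟩).tops_nonempty
    refine ⟨a, h.tops_subset op _ ha, fun ha' => ?_⟩
    simpa using h.eq_of_mem ha ha'
  · intro a _ b hb ha hb'
    obtain ⟨j, hj⟩ := h.exists_of_mem_tops hb
    refine hG _ j rfl (fun e => hb' ?_) a ha b hj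
    rwa [show j = ⟨0, by omega⟩ from Fin.ext e] at hj

theorem IsFamily.xor_indivisible (h : IsFamily Ts) (hn : 2 ≤ n) {op : Op}
    (hop : op = .seq ∨ op = .par) :
    Indivisible (tops (Op.xor.join Ts)) (op.across (DFEdge (Op.xor.join Ts))) := by
  refine h.indivisible_of_first hn fun i j hi hj a ha b hb => ?_
  have hij : i ≠ j := fun e => hj (e ▸ hi)
  have h₁ : ¬ Relation.TransGen (DFEdge (Op.xor.join Ts)) a b := fun hr =>
    hij (h.xor_reach hr ha hb)
  have h₂ : ¬ Relation.TransGen (DFEdge (Op.xor.join Ts)) b a := fun hr =>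
    hij (h.xor_reach hr hb ha).symm
  rcases hop with rfl | rfl
  · simp [Op.across, Ordered, h₁, h₂]
  · exact ⟨fun hl => h₁ (.single hl.1), fun hl => h₁ (.single hl.2)⟩

/-- Paths between different children make the graph weakly connected, against choice; missing edges
backwards exclude the mutual edges of a parallel cut. -/
theorem IsFamily.seq_indivisible (h : IsFamily Ts) (hn : 2 ≤ n) {op : Op}
    (hop : op = .xor ∨ op = .par) :
    Indivisible (tops (Op.seq.join Ts)) (op.across (DFEdge (Op.seq.join Ts))) := by
  rcases hop with rfl | rfl
  · refine unlinked_indivisible (fun a ha b hb => ?_) fun a b hab => ⟨hab.left, hab.right⟩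
    obtain ⟨i, ha⟩ := h.exists_of_mem_tops ha
    obtain ⟨j, hb⟩ := h.exists_of_mem_tops hb
    have key : ∀ {i j a b}, i ≠ j → a ∈ tops (Ts i) → b ∈ tops (Ts j) →
        Relation.TransGen (DFEdge (Op.seq.join Ts)) a b ∨
          Relation.TransGen (DFEdge (Op.seq.join Ts)) b a := fun hij ha hb =>
      hij.lt_or_gt.imp (fun h' => h.seq_reach h' ha hb) fun h' => h.seq_reach h' hb ha
    by_cases hij : i = j
    · obtain ⟨k, hk⟩ := exists_ne_fin hn i
      obtain ⟨c, hc⟩ := (h.proper k).tops_nonempty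
      exact Or.inr ⟨c, key hk.symm ha hc, key (hij ▸ hk) hc hb⟩
    · exact Or.inl (key hij ha hb)
  · refine h.indivisible_of_first hn fun i j hi hj a ha b hb => ?_
    have : ¬ DFEdge (Op.seq.join Ts) b a := fun he => by
      have := h.seq_edge_le he hb ha
      exact hj (by have := Fin.le_def.1 this; omega)
    exact ⟨fun hl => this hl.2, fun hl => this hl.1⟩

theorem indivisible_of_connected {V : Set A} {E : A → A → Prop} {op : Op}
    (h : ∀ a ∈ V, ∀ b ∈ V, Relation.TransGen E a b) (hV : ∀ a b, E a b → a ∈ V ∧ b ∈ V)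
    (hop : op = .xor ∨ op = .seq) : Indivisible V (op.across E) := by
  rcases hop with rfl | rfl
  · exact unlinked_indivisible (fun a ha b hb => Or.inl (Or.inl (h a ha b hb))) hV
  · refine indivisible_of_forall_not fun a ha b hb => ?_
    simp [Op.across, Ordered, h a ha b hb, h b hb a ha]

/-- A body activity with edges to and from a loop-back activity would be an end and a start activity
of the body at once. This is one of the two uses of the start/end condition. -/
theorem IsFamily.loop_linked_indivisible (h : IsFamily Ts) (hn : 2 ≤ n)
    (hd : ∀ i : Fin n, i.val = 0 → Disjoint (firstTops (Ts i)) (lastTops (Ts i))) :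
    Indivisible (tops (Op.loop.join Ts)) (Linked (DFEdge (Op.loop.join Ts))) := by
  refine h.indivisible_of_first hn fun i j hi hj a ha b hb => ?_
  have hij : i ≠ j := fun e => hj (e ▸ hi)
  have key : ¬ (DFEdge (Op.loop.join Ts) a b ∧ DFEdge (Op.loop.join Ts) b a) := by
    rintro ⟨hab, hba⟩
    have h₁ := h.loop_edge_leave hi hj hab ha hb
    have h₂ := h.loop_edge_enter hi hj hba ha hb
    exact Set.disjoint_left.1 (hd i hi) h₂.1 h₁.1
  exact ⟨key, fun hl => key hl.symm⟩

end Family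

/-- A language whose topmost operator is not `op` cannot be divided by a cut for `op`. -/
theorem NF.indivisible {k : Option Op} {T : Set (Trace A)} (h : NF k T) {op : Op}
    (hk : k ≠ some op) (hop : op ≠ .loop) : Indivisible (tops T) (op.across (DFEdge T)) := by
  rcases k with _ | k
  · exact indivisible_of_subsingleton h.tops_subsingleton _
  · have hk : k ≠ op := fun e => hk (e ▸ rfl)
    cases h with
    | node _ hn h hd _ hb _ =>
      have hF : IsFamily _ := ⟨fun i => (h i).proper, hd⟩
      cases k with
      | xor => exact hF.xor_indivisible hn (by cases op <;> simp_all)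
      | seq => exact hF.seq_indivisible hn (by cases op <;> simp_all)
      | par =>
        exact indivisible_of_connected (fun a ha b hb => hF.par_connected hn ha hb)
          (fun a b hab => ⟨hab.left, hab.right⟩) (by cases op <;> simp_all)
      | loop =>
        cases op with
        | xor | seq =>
          exact indivisible_of_connected (fun a ha b hb => hF.loop_connected hn ha hb)
            (fun a b hab => ⟨hab.left, hab.right⟩) (by simp)
        | par => exact hF.loop_linked_indivisible hn fun i hi => (hb rfl i hi).2
        | loop => exact absurd rfl hop

/-- A child that is indivisible in its own graph is so in the graph of the parent. -/
theorem IsFamily.indivisible_child {n : ℕ} {Ts : Fin n → Set (Trace A)} (h : IsFamily Ts)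
    {op : Op} {i : Fin n} (hi : Indivisible (tops (Ts i)) (op.across (DFEdge (Ts i)))) :
    Indivisible (tops (Ts i)) (op.across (DFEdge (op.join Ts))) := by
  refine hi.mono fun a ha b hb hab => ?_
  cases op with
  | xor => exact ⟨fun e => hab.1 (h.edge _ e), fun e => hab.2 (h.edge _ e)⟩
  | seq =>
    -- Paths within a child and paths of the sequence between activities of that child are the same,
    -- so both the existing and the missing path transfer.
    exact hab.imp (fun hl => ⟨h.seq_reach_child hl.1 ha hb, fun e => hl.2 (h.reach _ e)⟩)
      fun hl => ⟨h.seq_reach_child hl.1 hb ha, fun e => hl.2 (h.reach _ e)⟩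
  | par => exact ⟨h.edge_child hab.1 ha hb, h.edge_child hab.2 hb ha⟩
  | loop => trivial

/-! ### The body of a loop -/

section Family

variable {n : ℕ} {Ts : Fin n → Set (Trace A)}

theorem IsFamily.seq_firstTops (h : IsFamily Ts) {i : Fin n} (hi : ∀ j, i ≤ j) :
    firstTops (Ts i) ⊆ firstTops (Op.seq.join Ts) := by
  rintro a ⟨x, ⟨s, hs, hx⟩, ha⟩
  obtain ⟨ts, hts, rfl⟩ := h.exists_seq i hs
  obtain ⟨p, q, hpq, hp, -⟩ := flatten_ofFn_split ts i
  have : p = [] := List.eq_nil_iff_forall_not_mem.2 fun y hy => by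
    obtain ⟨j, hj, _⟩ := (hp y).1 hy
    exact absurd (hi j) (not_le.2 hj)
  refine ⟨x, ⟨_, ⟨ts, hts, rfl⟩, ?_⟩, ha⟩
  rw [hpq, this, List.nil_append, List.head?_append_of_ne_nil _ ((h.proper i).ne_nil _ hs), hx]

theorem IsFamily.seq_lastTops (h : IsFamily Ts) {i : Fin n} (hi : ∀ j, j ≤ i) :
    lastTops (Ts i) ⊆ lastTops (Op.seq.join Ts) := by
  rintro a ⟨x, ⟨s, hs, hx⟩, ha⟩
  obtain ⟨ts, hts, rfl⟩ := h.exists_seq i hs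
  obtain ⟨p, q, hpq, -, hq⟩ := flatten_ofFn_split ts i
  have : q = [] := List.eq_nil_iff_forall_not_mem.2 fun y hy => by
    obtain ⟨j, hj, _⟩ := (hq y).1 hy
    exact absurd (hi j) (not_le.2 hj)
  refine ⟨x, ⟨_, ⟨ts, hts, rfl⟩, ?_⟩, ha⟩
  rw [hpq, this, List.append_nil, List.getLast?_append_of_ne_nil _ ((h.proper i).ne_nil _ hs), hx]

end Family

/-- A loop cut cannot take a part away from the body of a loop. -/
theorem NF.tops_subset_body {k : Option Op} {T : Set (Trace A)} (h : NF k T)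
    (hk : k ≠ some .loop) (hd : Disjoint (firstTops T) (lastTops T)) {U : Set A}
    (hfirst : firstTops T ⊆ U) (hlast : lastTops T ⊆ U)
    (hleave : ∀ a ∈ U, ∀ b, b ∉ U → DFEdge T a b →
      a ∈ lastTops T ∧ ∀ a' ∈ lastTops T, DFEdge T a' b)
    (henter : ∀ a ∈ U, ∀ b, b ∉ U → DFEdge T b a → ∀ a' ∈ firstTops T, DFEdge T b a') :
    tops T ⊆ U := by
  have hT := h.proper
  intro b hb
  by_contra hbU
  have hnot : ∀ {x : Event A} {a : A}, ¬ InPart U x → x.head? = some a → a ∉ U :=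
    fun hx hxa ha => hx ⟨_, ha, hxa⟩
  rcases k with _ | op
  -- A single activity is itself a start activity, hence in `U`.
  · obtain ⟨a, ha⟩ := firstTops_nonempty hT
    exact hbU (h.tops_subsingleton hb (firstTops_subset T ha) ▸ hfirst ha)
  cases h with
  | @node _ n hn ks Ts h hdis _ _ _ =>
    have hF : IsFamily Ts := ⟨fun i => (h i).proper, hdis⟩
    cases op with
    | xor =>
      -- A trace through `b` starts in `U` and leaves it at some `d` of child `i`. By `hleave` all
      -- end activities then have an edge to `d`, including those of another child, which a choice
      -- forbids.
      obtain ⟨i, hi⟩ := hF.exists_of_mem_tops hb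
      obtain ⟨s, hs, y, hy, hyb⟩ := hi
      have hsT : s ∈ Op.xor.join Ts := ⟨i, hs⟩
      obtain ⟨x, hx, a, ha, hxa⟩ := hT.exists_head hsT
      obtain ⟨u, x', y', v, rfl, -, hx', hy'⟩ := exists_crossing (p := InPart U) hx
        ⟨a, hfirst ha, hxa⟩ hy
        (fun ⟨c, hc, hyc⟩ => hbU ((Option.some.inj (hyb.symm.trans hyc)) ▸ hc))
      obtain ⟨c, hc, hxc⟩ := hx'
      obtain ⟨d, hd', hyd⟩ := (h i).proper.inPart hs (x := y') (by simp)
      have he : DFEdge (Op.xor.join Ts) c d :=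
        ⟨x', y', ⟨_, hsT, pair_infix_iff.2 ⟨u, v, rfl⟩⟩, hxc, hyd⟩
      obtain ⟨-, hall⟩ := hleave c hc d (hnot hy' hyd) he
      obtain ⟨j, hj⟩ := exists_ne_fin hn i
      obtain ⟨e, x, ⟨r, hr, hx⟩, hxe⟩ := lastTops_nonempty (hF.proper j)
      have he := hall e ⟨x, ⟨r, ⟨j, hr⟩, hx⟩, hxe⟩
      exact hj (hF.xor_edge he ⟨r, hr, x, List.mem_of_mem_getLast? hx, hxe⟩ hd')
    | seq =>
      -- Take the first exit from `U`, to `d₁`, and the last return, from `d₂`. By `hleave` an end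
      -- activity of the last child has an edge to `d₁`, so `d₁` is in the last child; dually `d₂`
      -- is in the first. But `d₁` does not come after `d₂` in the trace, so the last child would
      -- not be later than the first.
      obtain ⟨t, ht, y, hy, hyb⟩ := hb
      have hyU : ¬ InPart U y :=
        fun ⟨c, hc, hyc⟩ => hbU ((Option.some.inj (hyb.symm.trans hyc)) ▸ hc)
      have hsorted := hF.seq_sorted ht
      obtain ⟨x, hx, a, ha, hxa⟩ := hT.exists_head ht
      obtain ⟨u, x₁, y₁, v, e₁, hu, hx₁, hy₁⟩ := exists_crossing (p := InPart U) hx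
        ⟨a, hfirst ha, hxa⟩ hy hyU
      obtain ⟨x, hx, a, ha, hxa⟩ := hT.exists_last ht
      obtain ⟨u', y₂, x₂, v', e₂, hv', hy₂, hx₂⟩ := exists_crossing_last (p := InPart U) hx
        ⟨a, hlast ha, hxa⟩ hy hyU
      obtain ⟨c₁, hc₁, hxc₁⟩ := hx₁
      obtain ⟨c₂, hc₂, hxc₂⟩ := hx₂
      obtain ⟨d₁, hd₁, hyd₁⟩ := hT.inPart ht (x := y₁) (by simp [e₁])
      obtain ⟨d₂, hd₂, hyd₂⟩ := hT.inPart ht (x := y₂) (by simp [e₂])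
      obtain ⟨-, hall₁⟩ := hleave c₁ hc₁ d₁ (hnot hy₁ hyd₁)
        ⟨x₁, y₁, ⟨_, ht, pair_infix_iff.2 ⟨u, v, e₁⟩⟩, hxc₁, hyd₁⟩
      have hall₂ := henter c₂ hc₂ d₂ (hnot hy₂ hyd₂)
        ⟨y₂, x₂, ⟨_, ht, pair_infix_iff.2 ⟨u', v', e₂⟩⟩, hyd₂, hxc₂⟩
      obtain ⟨i₁, hi₁⟩ := hF.exists_of_mem_tops hd₁
      obtain ⟨i₂, hi₂⟩ := hF.exists_of_mem_tops hd₂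
      obtain ⟨f, hf⟩ := firstTops_nonempty (hF.proper ⟨0, by omega⟩)
      obtain ⟨l, hl⟩ := lastTops_nonempty (hF.proper ⟨n - 1, by omega⟩)
      have h₁ := hF.seq_edge_le
        (hall₁ l (hF.seq_lastTops (fun j => by rw [Fin.le_def]; simp; omega) hl))
        (lastTops_subset _ hl) hi₁
      have h₂ := hF.seq_edge_le
        (hall₂ f (hF.seq_firstTops (fun j => by rw [Fin.le_def]; simp) hf))
        hi₂ (firstTops_subset _ hf)
      have h₁₂ : i₁ ≤ i₂ := by
        have hy₂t : y₂ ∈ u ++ x₁ :: y₁ :: v := by rw [← e₁, e₂]; simp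
        have : y₂ = y₁ ∨ y₂ ∈ v := by
          simp only [List.mem_append, List.mem_cons] at hy₂t
          rcases hy₂t with h | rfl | h | h
          · exact absurd (hu _ h) hy₂
          · exact absurd ⟨c₁, hc₁, hxc₁⟩ hy₂
          · exact Or.inl h
          · exact Or.inr h
        rcases this with rfl | hv
        · obtain rfl : d₂ = d₁ := by simpa [hyd₂] using hyd₁
          exact (hF.eq_of_mem hi₁ hi₂).le
        · rw [e₁, List.pairwise_append] at hsorted
          have := (List.pairwise_cons.1 (List.pairwise_cons.1 hsorted.2.1).2).1 y₂ hv
          exact this i₁ i₂ ⟨d₁, hi₁, hyd₁⟩ ⟨d₂, hi₂, hyd₂⟩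
      simp only [Fin.le_def] at h₁ h₂ h₁₂
      omega
    | par =>
      -- A start activity of another child has an edge to `b`, so by `hleave` it is also an end
      -- activity, against `hd`.
      obtain ⟨i, hi⟩ := hF.exists_of_mem_tops hb
      obtain ⟨j, hj⟩ := exists_ne_fin hn i
      obtain ⟨a, x, hx, hxa⟩ := firstTops_nonempty (hF.proper j)
      have ha : a ∈ firstTops (Op.par.join Ts) := ⟨x, hF.par_starts j hx, hxa⟩
      exact Set.disjoint_left.1 hd ha
        (hleave a (hfirst ha) b hbU (hF.par_edge hj (firstTops_subset _ ⟨x, hx, hxa⟩) hi)).1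
    | loop => exact absurd rfl hk

end NormalForms

-- Cuts of a complete log are determined by the language

section Cuts

variable {A : Type u}

/-- All traces of the log are in the language, and the log is directly-follows complete to it. -/
structure Complete (L : EventLog A) (T : Set (Trace A)) : Prop where
  sound : ∀ t ∈ L, t ∈ T
  follows : ∀ x y, Follows T x y → Follows {t | t ∈ L} x y
  start : starts T ⊆ starts {t | t ∈ L}
  last : ends T ⊆ ends {t | t ∈ L}

theorem Complete.edge_eq {L : EventLog A} {T : Set (Trace A)} (h : Complete L T) :
    Edge L = DFEdge T := by
  funext a b
  refine propext ⟨?_, ?_⟩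
  · rintro ⟨t, ht, x, y, hi, hx, hy⟩
    exact ⟨x, y, ⟨t, h.sound t ht, hi⟩, hx, hy⟩
  · rintro ⟨x, y, hf, hx, hy⟩
    obtain ⟨t, ht, hi⟩ := h.follows x y hf
    exact ⟨t, ht, x, y, hi, hx, hy⟩

theorem Complete.graphStart_eq {L : EventLog A} {T : Set (Trace A)} (h : Complete L T) :
    graphStart L = firstTops T := by
  ext a
  constructor
  · rintro ⟨t, ht, x, hx, ha⟩
    exact ⟨x, ⟨t, h.sound t ht, hx⟩, ha⟩
  · rintro ⟨x, hx, ha⟩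
    obtain ⟨t, ht, hx⟩ := h.start hx
    exact ⟨t, ht, x, hx, ha⟩

theorem Complete.graphEnd_eq {L : EventLog A} {T : Set (Trace A)} (h : Complete L T) :
    graphEnd L = lastTops T := by
  ext a
  constructor
  · rintro ⟨t, ht, x, hx, ha⟩
    exact ⟨x, ⟨t, h.sound t ht, hx⟩, ha⟩
  · rintro ⟨x, hx, ha⟩
    obtain ⟨t, ht, hx⟩ := h.last hx
    exact ⟨t, ht, x, hx, ha⟩

theorem Complete.exists_mem {L : EventLog A} {T : Set (Trace A)} (h : Complete L T) {t : Trace A}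
    (ht : t ∈ T) {x : Event A} (hx : x ∈ t) : ∃ s ∈ L, x ∈ s := by
  rcases head?_or_follows hx with h' | ⟨z, h'⟩
  · exact mem_of_starts (h.start ⟨t, ht, h'⟩)
  · exact (h.follows z x ⟨t, ht, h'⟩).mem_right

theorem Complete.topAlphabet_eq {L : EventLog A} {T : Set (Trace A)} (h : Complete L T) :
    topAlphabet L = tops T := by
  ext a
  constructor
  · rintro ⟨t, ht, x, hx, ha⟩
    exact ⟨t, h.sound t ht, x, hx, ha⟩
  · rintro ⟨t, ht, x, hx, ha⟩
    obtain ⟨s, hs, hx⟩ := h.exists_mem ht hx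
    exact ⟨s, hs, x, hx, ha⟩

/-- Apply indivisibility with `U` the part that contains some chosen element of `V`. -/
theorem Indivisible.exists_subset {V : Set A} {G : A → A → Prop} (h : Indivisible V G)
    (hV : V.Nonempty) {m : ℕ} {S : Fin m → Set A} (hc : V ⊆ ⋃ k, S k)
    (hG : ∀ k l, k ≠ l → ∀ a ∈ V, ∀ b ∈ V, a ∈ S k → b ∈ S l → G a b) : ∃ k, V ⊆ S k := by
  obtain ⟨a, ha⟩ := hV
  obtain ⟨k, hk⟩ := Set.mem_iUnion.1 (hc ha)
  refine ⟨k, fun b hb => h (S k) (fun c hc' d hd hck hdk => ?_) a ha b hb hk⟩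
  obtain ⟨l, hl⟩ := Set.mem_iUnion.1 (hc hd)
  exact hG k l (fun e => hdk (e ▸ hl)) c hc' d hd hck hl

/-- A partition that is coarser than the partition into the sets `V i`. -/
theorem coarser_partition {n m : ℕ} {V : Fin n → Set A} {S : Fin m → Set A}
    (hSd : ∀ i j, i ≠ j → Disjoint (S i) (S j)) (hS : ∀ i, (S i).Nonempty)
    (hc : ⋃ i, S i = ⋃ i, V i) (hsub : ∀ i, ∃ k, V i ⊆ S k) :
    m ≤ n ∧ (n ≤ m → ∃ σ : Fin n ≃ Fin m, ∀ i, S (σ i) = V i) := by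
  -- The map sending a block to the part that contains it is onto, because parts are non-empty. So
  -- `m ≤ n`, and equality makes it bijective, with parts equal to blocks.
  choose f hf using hsub
  have hmem : ∀ k, ∀ a ∈ S k, ∃ i, a ∈ V i ∧ f i = k := by
    intro k a ha
    obtain ⟨i, hi⟩ := Set.mem_iUnion.1 (hc ▸ Set.mem_iUnion.2 ⟨k, ha⟩ : a ∈ ⋃ i, V i)
    refine ⟨i, hi, ?_⟩
    by_contra hne
    exact Set.disjoint_left.1 (hSd _ _ hne) (hf i hi) ha
  have hsurj : Function.Surjective f := by
    intro k
    obtain ⟨a, ha⟩ := hS k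
    obtain ⟨i, -, hi⟩ := hmem k a ha
    exact ⟨i, hi⟩
  have hmn : m ≤ n := by simpa using Fintype.card_le_of_surjective f hsurj
  refine ⟨hmn, fun hnm => ?_⟩
  have hbij : Function.Bijective f :=
    (Fintype.bijective_iff_surjective_and_card f).2 ⟨hsurj, by simp; omega⟩
  refine ⟨Equiv.ofBijective f hbij, fun i => ?_⟩
  refine Set.Subset.antisymm (fun a ha => ?_) (hf i)
  obtain ⟨j, hj, hji⟩ := hmem _ a ha
  rwa [hbij.1 hji] at hj

theorem IsCut.across {L : EventLog A} {op : Op} {m : ℕ} {S : Fin m → Set A} (h : IsCut L op S)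
    {k l : Fin m} (hkl : k ≠ l) {a b : A} (ha : a ∈ S k) (hb : b ∈ S l) :
    op.across (Edge L) a b := by
  cases op with
  | xor => exact ⟨h.2 k l hkl a ha b hb, h.2 l k hkl.symm b hb a ha⟩
  | seq =>
    rcases hkl.lt_or_gt with hkl | hkl
    · exact Or.inl (h.2 k l hkl a ha b hb)
    · exact Or.inr (h.2 l k hkl b hb a ha)
  | par => exact ⟨h.2.2 k l hkl a ha b hb, h.2.2 l k hkl.symm b hb a ha⟩
  | loop => trivial

/-- Indivisibility puts all activities into one part, which leaves nothing for a second one. -/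
theorem NF.not_hasCut {k : Option Op} {T : Set (Trace A)} (h : NF k T) {L : EventLog A}
    (hL : Complete L T) {op : Op} (hk : k ≠ some op) (hop : op ≠ .loop) : ¬ HasCut L op := by
  rintro ⟨m, S, hm, hS⟩
  have hcover := hS.1.cover.trans hL.topAlphabet_eq
  obtain ⟨k, hk⟩ := (h.indivisible hk hop).exists_subset h.proper.tops_nonempty hcover.ge
    (fun k l hkl a _ b _ ha hb => hL.edge_eq ▸ hS.across hkl ha hb)
  obtain ⟨l, hl⟩ := exists_ne_fin hm k
  obtain ⟨a, ha⟩ := hS.1.nonempty l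
  exact Set.disjoint_left.1 (hS.1.disjoint l k hl) ha
    (hk (hcover ▸ Set.mem_iUnion.2 ⟨l, ha⟩))

section Family

variable {n : ℕ} {Ts : Fin n → Set (Trace A)}

theorem loop_firstTops (h : IsFamily Ts) {i : Fin n} (hi : i.val = 0) :
    firstTops (Op.loop.join Ts) = firstTops (Ts i) := by
  ext a
  constructor
  · rintro ⟨x, hx, ha⟩
    obtain ⟨j, hj, hx⟩ := h.loop_starts.1 hx
    obtain rfl : j = i := Fin.ext (hj.trans hi.symm)
    exact ⟨x, hx, ha⟩
  · rintro ⟨x, hx, ha⟩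
    exact ⟨x, h.loop_starts.2 ⟨i, hi, hx⟩, ha⟩

theorem loop_lastTops (h : IsFamily Ts) {i : Fin n} (hi : i.val = 0) :
    lastTops (Op.loop.join Ts) = lastTops (Ts i) := by
  ext a
  constructor
  · rintro ⟨x, hx, ha⟩
    obtain ⟨j, hj, hx⟩ := h.loop_ends.1 hx
    obtain rfl : j = i := Fin.ext (hj.trans hi.symm)
    exact ⟨x, hx, ha⟩
  · rintro ⟨x, hx, ha⟩
    exact ⟨x, h.loop_ends.2 ⟨i, hi, hx⟩, ha⟩

/-- The children of an operator node form a cut. -/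
theorem IsFamily.isCut (h : IsFamily Ts) {op : Op} {L : EventLog A}
    (hL : Complete L (op.join Ts)) : IsCut L op fun i => tops (Ts i) := by
  refine ⟨⟨fun i => (h.proper i).tops_nonempty, h.disjoint, ?_⟩, ?_⟩
  · rw [hL.topAlphabet_eq, h.tops_join]
  cases op with
  | xor =>
    intro i j hij a ha b hb he
    rw [hL.edge_eq] at he
    exact hij (h.xor_edge he ha hb)
  | seq =>
    intro i j hij a ha b hb
    rw [hL.edge_eq]
    exact ⟨h.seq_reach hij ha hb, fun hr => absurd (h.seq_reach_le hr hb ha) (not_le.2 hij)⟩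
  | par =>
    refine ⟨fun i => ?_, fun i j hij a ha b hb => ?_⟩
    · rw [hL.graphStart_eq, hL.graphEnd_eq]
      obtain ⟨a, x, hx, ha⟩ := firstTops_nonempty (h.proper i)
      obtain ⟨b, y, hy, hb⟩ := lastTops_nonempty (h.proper i)
      exact ⟨⟨a, firstTops_subset _ ⟨x, hx, ha⟩, x, h.par_starts i hx, ha⟩,
        ⟨b, lastTops_subset _ ⟨y, hy, hb⟩, y, h.par_ends i hy, hb⟩⟩
    · rw [hL.edge_eq]
      exact h.par_edge hij ha hb
  | loop =>
    constructor
    · intro i hi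
      rw [hL.graphStart_eq, hL.graphEnd_eq, loop_firstTops h hi, loop_lastTops h hi]
      exact Set.union_subset (firstTops_subset _) (lastTops_subset _)
    · intro i j hi hj a ha b hb he
      rw [hL.edge_eq] at he ⊢
      rw [hL.graphEnd_eq, loop_lastTops h hi]
      obtain ⟨ha', y, hy, hyb⟩ := h.loop_edge_leave hi hj he ha hb
      exact ⟨ha', fun a' ⟨x, hx, hxa⟩ => ⟨x, y, loop_leave hi hj hx hy, hxa, hyb⟩⟩
    · intro i j hi hj a ha b hb he
      rw [hL.edge_eq] at he ⊢
      rw [hL.graphStart_eq, loop_firstTops h hi]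
      obtain ⟨ha', y, hy, hyb⟩ := h.loop_edge_enter hi hj he ha hb
      exact ⟨ha', fun a' ⟨x, hx, hxa⟩ => ⟨y, x, loop_enter hi hj hy hx, hyb, hxa⟩⟩
    · intro i j hi hj hij a ha b hb he
      rw [hL.edge_eq] at he
      obtain ⟨x, y, hf, hxa, hyb⟩ := he
      have hx : InPart (tops (Ts i)) x := ⟨a, ha, hxa⟩
      have hy : InPart (tops (Ts j)) y := ⟨b, hb, hyb⟩
      rcases h.loop_follows hf with ⟨k, hk⟩ | ⟨k, l, hk, hl, hxk, hyl⟩ | ⟨k, l, hk, hl, hxl, hyk⟩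
      · exact hij ((h.inPart_inj hx (hk.inPart_left (h.proper k))).trans
          (h.inPart_inj hy (hk.inPart_right (h.proper k))).symm)
      · exact hi (h.inPart_inj hx (inPart_of_ends (h.proper k) hxk) ▸ hk)
      · exact hj (h.inPart_inj hy (inPart_of_starts (h.proper k) hyk) ▸ hk)

/-- The hypotheses on the kinds of the children of an operator node in a normal form. -/
structure NFChildren (op : Op) (Ts : Fin n → Set (Trace A)) (ks : Fin n → Option Op) : Prop where
  two_le : 2 ≤ n
  nf : ∀ i, NF (ks i) (Ts i)
  disjoint : ∀ i j, i ≠ j → Disjoint (tops (Ts i)) (tops (Ts j))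
  kind : op ≠ .loop → ∀ i, ks i ≠ some op
  body : op = .loop → ∀ i, i.val = 0 →
    ks i ≠ some .loop ∧ Disjoint (firstTops (Ts i)) (lastTops (Ts i))
  redo : op = .loop → ∀ i, i.val ≠ 0 → ks i ≠ some .xor

variable {op : Op} {ks : Fin n → Option Op}

theorem NFChildren.join (h : NFChildren op Ts ks) : NF (some op) (op.join Ts) :=
  .node op h.two_le h.nf h.disjoint h.kind h.body h.redo

theorem NFChildren.isFamily (h : NFChildren op Ts ks) : IsFamily Ts :=
  ⟨fun i => (h.nf i).proper, h.disjoint⟩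

/-- Every cut is coarser than the one given by the children. For a loop, its body contains the
body of the node. -/
theorem NFChildren.exists_part (h : NFChildren op Ts ks) {L : EventLog A}
    (hL : Complete L (op.join Ts)) {m : ℕ} {S : Fin m → Set A} (hS : IsCut L op S) (i : Fin n) :
    ∃ k, tops (Ts i) ⊆ S k ∧ (op = .loop → i.val = 0 → k.val = 0) := by
  have hF := h.isFamily
  have hcover := hS.1.cover.trans hL.topAlphabet_eq
  have hsub : tops (Ts i) ⊆ ⋃ k, S k := hcover ▸ hF.tops_subset op i
  have hne := (hF.proper i).tops_nonempty
  by_cases hop : op = .loop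
  · subst hop
    have hcut : LoopCut L S := hS.2
    by_cases hi : i.val = 0
    -- Part `0` of the cut, with its conditions restricted to the edges inside the body child,
    -- satisfies the hypotheses of `NF.tops_subset_body`.
    · obtain ⟨hk, hd⟩ := h.body rfl i hi
      obtain ⟨a, ha⟩ := hne
      obtain ⟨k, -⟩ := Set.mem_iUnion.1 (hsub ha)
      have hbody := hcut.body ⟨0, k.pos⟩ rfl
      rw [hL.graphStart_eq, hL.graphEnd_eq, loop_firstTops hF hi, loop_lastTops hF hi,
        Set.union_subset_iff] at hbody
      have hleave := hcut.leave ⟨0, k.pos⟩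
      have henter := hcut.enter ⟨0, k.pos⟩
      simp only [hL.graphEnd_eq, hL.edge_eq, loop_lastTops hF hi] at hleave
      simp only [hL.graphStart_eq, hL.edge_eq, loop_firstTops hF hi] at henter
      have hother : ∀ b ∈ tops (Ts i), b ∉ S ⟨0, k.pos⟩ → ∃ j : Fin m, j.val ≠ 0 ∧ b ∈ S j := by
        intro b hb hb0
        obtain ⟨j, hj⟩ := Set.mem_iUnion.1 (hsub hb)
        exact ⟨j, fun e => hb0 ((show j = ⟨0, k.pos⟩ from Fin.ext e) ▸ hj), hj⟩
      refine ⟨⟨0, k.pos⟩, (h.nf i).tops_subset_body hk hd hbody.1 hbody.2 ?_ ?_, fun _ _ => rfl⟩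
      · intro a ha b hb he
        obtain ⟨j, hj, hbj⟩ := hother b he.right hb
        obtain ⟨h₁, h₂⟩ := hleave j trivial hj a ha b hbj (hF.edge _ he)
        exact ⟨h₁, fun a' ha' => hF.edge_child (h₂ a' ha') (lastTops_subset _ ha') he.right⟩
      · intro a ha b hb he
        obtain ⟨j, hj, hbj⟩ := hother b he.left hb
        obtain ⟨h₁, h₂⟩ := henter j trivial hj a ha b hbj (hF.edge _ he)
        exact fun a' ha' => hF.edge_child (h₂ a' ha') he.left (firstTops_subset _ ha')
    · have hind := (h.nf i).indivisible (op := .xor) (h.redo rfl i hi) (by simp)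
      have h0 : (⟨0, i.pos⟩ : Fin n).val = 0 := rfl
      have hnot : ∀ a ∈ tops (Ts i), a ∉ graphStart L ∪ graphEnd L := by
        intro a ha hmem
        rw [hL.graphStart_eq, hL.graphEnd_eq, loop_firstTops hF h0, loop_lastTops hF h0] at hmem
        have := Set.union_subset (firstTops_subset _) (lastTops_subset _) hmem
        exact hi (hF.eq_of_mem ha this ▸ h0)
      obtain ⟨k, hk⟩ := hind.exists_subset hne hsub (by
        -- On a loop-back child, a loop cut acts like a choice cut. Edges between part `0` and
        -- another part would need a start or end activity, and these all lie in the body child;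
        -- edges between other parts are forbidden outright. As the child is not itself a choice, it
        -- is not divided.
        have key : ∀ k l, k ≠ l → ∀ a ∈ tops (Ts i), ∀ b ∈ tops (Ts i), a ∈ S k → b ∈ S l →
            ¬ DFEdge (Ts i) a b := by
          intro k l hkl a ha b hb hak hbl he
          have he' : Edge L a b := hL.edge_eq ▸ hF.edge _ he
          by_cases hk : k.val = 0
          · have hl : l.val ≠ 0 := fun e => hkl (Fin.ext (hk.trans e.symm))
            exact hnot a ha (Or.inr (hcut.leave k l hk hl a hak b hbl he').1)
          · by_cases hl : l.val = 0
            · exact hnot b hb (Or.inl (hcut.enter l k hl hk b hbl a hak he').1)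
            · exact hcut.separate k l hk hl hkl a hak b hbl he'
        exact fun k l hkl a ha b hb hak hbl =>
          ⟨key k l hkl a ha b hb hak hbl, key l k hkl.symm b hb a ha hbl hak⟩)
      exact ⟨k, hk, fun _ e => absurd e hi⟩
  · obtain ⟨k, hk⟩ := (hF.indivisible_child ((h.nf i).indivisible (h.kind hop i) hop)).exists_subset
      hne hsub fun k l hkl a _ b _ ha hb => hL.edge_eq ▸ hS.across hkl ha hb
    exact ⟨k, hk, fun e => absurd e hop⟩

theorem NFChildren.cut_le (h : NFChildren op Ts ks) {L : EventLog A}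
    (hL : Complete L (op.join Ts)) {m : ℕ} {S : Fin m → Set A} (hS : IsCut L op S) :
    m ≤ n ∧ (n ≤ m → ∃ σ : Fin n ≃ Fin m, ∀ i, S (σ i) = tops (Ts i)) := by
  have hF := h.isFamily
  refine coarser_partition hS.1.disjoint hS.1.nonempty ?_ fun i =>
    let ⟨k, hk, _⟩ := h.exists_part hL hS i
    ⟨k, hk⟩
  rw [hS.1.cover, hL.topAlphabet_eq, hF.tops_join]

theorem NFChildren.not_hasCut (h : NFChildren op Ts ks) {L : EventLog A}
    (hL : Complete L (op.join Ts)) {op' : Op} (hop : op'.rank < op.rank) : ¬ HasCut L op' := by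
  refine h.join.not_hasCut hL ?_ ?_
  · rintro ⟨⟩
    exact lt_irrefl _ hop
  · rintro rfl
    cases op <;> simp [Op.rank] at hop

theorem NFChildren.selected (h : NFChildren op Ts ks) {L : EventLog A}
    (hL : Complete L (op.join Ts)) : Selected L op fun i => tops (Ts i) where
  cut := h.isFamily.isCut hL
  nontrivial := h.two_le
  maximal _ _ hS := (h.cut_le hL hS).1
  first _ := h.not_hasCut hL

theorem Op.rank_injective : Function.Injective Op.rank := by
  intro a b h
  cases a <;> cases b <;> simp_all [Op.rank]

/-- The cut chosen by the algorithm is the one given by the children, up to the numbering. -/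
theorem NFChildren.exists_perm (h : NFChildren op Ts ks) {L : EventLog A}
    (hL : Complete L (op.join Ts)) {op' : Op} {m : ℕ} {S : Fin m → Set A}
    (hS : Selected L op' S) :
    op' = op ∧ ∃ σ : Fin n ≃ Fin m, (∀ i, S (σ i) = tops (Ts i)) ∧
      (op = .seq → ∀ i, (σ i).val = i.val) ∧
      (op = .loop → ∀ i, (σ i).val = 0 ↔ i.val = 0) := by
  have hF := h.isFamily
  have hcut := hF.isCut hL
  obtain rfl : op' = op := by
    -- Both operators have a non-trivial cut, and neither may be preceded by one that does.
    rcases lt_trichotomy op'.rank op.rank with hlt | heq | hgt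
    · exact absurd ⟨m, S, hS.nontrivial, hS.cut⟩ (h.not_hasCut hL hlt)
    · exact Op.rank_injective heq
    · exact absurd ⟨n, _, h.two_le, hcut⟩ (hS.first op hgt)
  obtain ⟨hmn, hex⟩ := h.cut_le hL hS.cut
  obtain rfl : m = n := le_antisymm hmn (hS.maximal n _ hcut)
  obtain ⟨σ, hσ⟩ := hex le_rfl
  refine ⟨rfl, σ, hσ, ?_, ?_⟩
  · rintro rfl
    -- Paths between children fix the order of the parts, and a strictly monotone permutation of
    -- `Fin m` is the identity.
    have hmono : StrictMono σ := by
      intro i j hij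
      obtain ⟨a, ha⟩ := (hF.proper i).tops_nonempty
      obtain ⟨b, hb⟩ := (hF.proper j).tops_nonempty
      by_contra hlt
      have hlt : σ j < σ i := lt_of_le_of_ne (not_lt.1 hlt) fun e => hij.ne' (σ.injective e)
      have hSc : SeqCut L S := hS.cut.2
      have h₁ := (hSc _ _ hlt b ((hσ j).symm ▸ hb) a ((hσ i).symm ▸ ha)).2
      rw [hL.edge_eq] at h₁
      exact h₁ (h.isFamily.seq_reach hij ha hb)
    have : (σ : Fin m → Fin m) = id :=
      (hmono.range_inj strictMono_id).1 (by simp [σ.surjective.range_eq])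
    intro i
    rw [this]
    rfl
  · rintro rfl
    have key : ∀ i : Fin m, i.val = 0 → (σ i).val = 0 := by
      intro i hi
      obtain ⟨k, hk, hk0⟩ := h.exists_part hL hS.cut i
      obtain ⟨a, ha⟩ := (hF.proper i).tops_nonempty
      have : σ i = k := by
        by_contra hne
        exact Set.disjoint_left.1 (hS.cut.1.disjoint _ _ hne) ((hσ i).symm ▸ ha) (hk ha)
      rw [this]
      exact hk0 rfl hi
    intro i
    refine ⟨fun hi => ?_, key i⟩
    have h0 := key ⟨0, i.pos⟩ rfl
    have := σ.injective (Fin.ext (hi.trans h0.symm))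
    rw [this]

end Family

end Cuts

-- Sublogs are complete for the children

section Sublogs

variable {A : Type u}

open Classical in
/-- The maximal non-empty runs of events with topmost activity in `V`. -/
noncomputable def runs (V : Set A) (t : Trace A) : List (Trace A) :=
  (t.splitOnP (fun x => decide (¬ InPart V x))).filter (fun r => !r.isEmpty)

theorem runs_nil (V : Set A) : runs V [] = [] := by
  simp [runs]

theorem runs_append_cons (V : Set A) (s t : Trace A) {x : Event A} (hx : ¬ InPart V x) :
    runs V (s ++ x :: t) = runs V s ++ runs V t := by
  rw [runs, List.splitOnP_append_cons _ _ (by simpa using hx), List.filter_append]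
  rfl

theorem runs_of_forall {V : Set A} {t : Trace A} (h : ∀ x ∈ t, InPart V x) (ht : t ≠ []) :
    runs V t = [t] := by
  rw [runs, List.splitOnP_eq_singleton (by simpa using h)]
  simp [ht]

theorem runs_append_of_forall_not {V : Set A} {s t : Trace A} (h : ∀ x ∈ s, ¬ InPart V x) :
    runs V (s ++ t) = runs V t := by
  induction s with
  | nil => rfl
  | cons x s ih =>
    have := runs_append_cons V [] (s ++ t) (h x (by simp))
    simp only [List.nil_append, runs_nil] at this
    rw [List.cons_append, this, ih fun y hy => h y (by simp [hy])]

theorem runs_append {V : Set A} {s t : Trace A} (h : ∀ x ∈ s, InPart V x) (hs : s ≠ [])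
    (ht : ∀ x, t.head? = some x → ¬ InPart V x) : runs V (s ++ t) = s :: runs V t := by
  cases t with
  | nil => simp [runs_nil, runs_of_forall h hs]
  | cons x t =>
    have hx := ht x rfl
    have := runs_append_cons V [] t hx
    simp only [List.nil_append, runs_nil] at this
    rw [runs_append_cons V s t hx, this, runs_of_forall h hs]
    rfl

open Classical in
/-- Every occurrence of an event of `V` lies in a run, which extends as far as possible. -/
theorem exists_run {V : Set A} {x : Event A} (hx : InPart V x) (u w : Trace A) :
    u.rtakeWhile (fun y => decide (InPart V y)) ++ x :: w.takeWhile (fun y => decide (InPart V y)) ∈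
      runs V (u ++ x :: w) := by
  -- It is enough to treat the maximal `V`-suffix `s` of `u`; what precedes it is empty or ends in
  -- an event outside `V`, where the trace is split.
  have key : ∀ s : Trace A, (∀ y ∈ s, InPart V y) →
      s ++ x :: w.takeWhile (fun y => decide (InPart V y)) ∈ runs V (s ++ x :: w) := by
    intro s hs
    have h₁ : s ++ x :: w = (s ++ x :: w.takeWhile (fun y => decide (InPart V y))) ++
        w.dropWhile (fun y => decide (InPart V y)) := by simp
    rw [h₁, runs_append]
    · simp
    · intro y hy
      simp only [List.mem_append, List.mem_cons] at hy
      rcases hy with hy | rfl | hy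
      · exact hs y hy
      · exact hx
      · simpa using List.mem_takeWhile_imp hy
    · simp
    · intro y hy
      simpa using List.head?_dropWhile_not (fun y => decide (InPart V y)) w |> fun h => by
        rw [hy] at h
        simpa using h
  obtain ⟨s, hs⟩ : ∃ s, s = u.rtakeWhile (fun y => decide (InPart V y)) := ⟨_, rfl⟩
  have hsV : ∀ y ∈ s, InPart V y := fun y hy => by
    rw [hs] at hy
    simpa using List.mem_rtakeWhile_imp hy
  have hu : u = u.rdropWhile (fun y => decide (InPart V y)) ++ s := by
    rw [hs, List.rdropWhile_append_rtakeWhile]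
  rw [← hs]
  rcases List.eq_nil_or_concat (u.rdropWhile (fun y => decide (InPart V y))) with h | ⟨u', z, h⟩
  · rw [h, List.nil_append] at hu
    rw [hu]
    exact key s hsV
  · have hz : ¬ InPart V z := by
      have := List.rdropWhile_last_not (fun y => decide (InPart V y)) u (by simp [h])
      simpa [h] using this
    have : u ++ x :: w = u' ++ z :: (s ++ x :: w) := by rw [hu, h]; simp
    rw [this, runs_append_cons _ _ _ hz]
    exact List.mem_append_right _ (key s hsV)

theorem follows_runs {V : Set A} {t : Trace A} {x y : Event A} (h : [x, y] <:+: t)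
    (hx : InPart V x) (hy : InPart V y) : ∃ r ∈ runs V t, [x, y] <:+: r := by
  obtain ⟨u, v, rfl⟩ := pair_infix_iff.1 h
  refine ⟨_, exists_run hx u (y :: v), ?_⟩
  rw [List.takeWhile_cons_of_pos (by simpa using hy)]
  exact pair_infix_iff.2 ⟨_, _, rfl⟩

theorem head_runs {V : Set A} {t : Trace A} {x : Event A} (hx : InPart V x)
    (h : t.head? = some x ∨ ∃ z, ¬ InPart V z ∧ [z, x] <:+: t) :
    ∃ r ∈ runs V t, r.head? = some x := by
  rcases h with h | ⟨z, hz, h⟩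
  · obtain ⟨w, rfl⟩ := List.head?_eq_some_iff.1 h
    exact ⟨_, exists_run hx [] w, by simp [List.rtakeWhile]⟩
  · obtain ⟨u, w, rfl⟩ := pair_infix_iff.1 h
    refine ⟨_, (by simpa using exists_run hx (u ++ [z]) w), ?_⟩
    rw [List.rtakeWhile_concat_neg _ _ _ (by simpa using hz)]
    rfl

theorem last_runs {V : Set A} {t : Trace A} {x : Event A} (hx : InPart V x)
    (h : t.getLast? = some x ∨ ∃ z, ¬ InPart V z ∧ [x, z] <:+: t) :
    ∃ r ∈ runs V t, r.getLast? = some x := by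
  rcases h with h | ⟨z, hz, h⟩
  · obtain ⟨w, rfl⟩ := List.getLast?_eq_some_iff.1 h
    exact ⟨_, exists_run hx w [], by simp⟩
  · obtain ⟨u, w, rfl⟩ := pair_infix_iff.1 h
    refine ⟨_, exists_run hx u (z :: w), ?_⟩
    rw [List.takeWhile_cons_of_neg (by simpa using hz)]
    simp

theorem mem_splitLog_xor {L : EventLog A} {V : Set A} {t : Trace A} :
    t ∈ splitLog .xor L V ↔ t ∈ L ∧ ∀ x ∈ t, InPart V x := by
  simp [splitLog]

theorem mem_splitLog_restrict {op : Op} (hop : op = .seq ∨ op = .par) {L : EventLog A} {V : Set A}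
    {s : Trace A} : s ∈ splitLog op L V ↔ ∃ t ∈ L, restrict V t = s := by
  rcases hop with rfl | rfl <;> exact Multiset.mem_map

theorem mem_splitLog_loop {L : EventLog A} {V : Set A} {s : Trace A} :
    s ∈ splitLog .loop L V ↔ ∃ t ∈ L, s ∈ runs V t := by
  exact Multiset.mem_bind

section Family

variable {n : ℕ} {Ts : Fin n → Set (Trace A)}

/-- Blocks of one child are never adjacent in a loop trace, since body and non-empty loop-back
blocks alternate. So maximal runs are single blocks and not concatenations of several. -/
theorem IsFamily.runs_mem (h : IsFamily Ts) {t : Trace A} (ht : t ∈ Op.loop.join Ts) (i : Fin n)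
    {r : Trace A} (hr : r ∈ runs (tops (Ts i)) t) : r ∈ Ts i := by
  have hB : ∀ {j k : Fin n} {s : Trace A}, s ∈ Ts j → j ≠ k → ∀ x ∈ s, ¬ InPart (tops (Ts k)) x :=
    fun hs hjk x hx hk => hjk ((h.inPart_iff hs hx).1 hk).symm
  have hin : ∀ {j : Fin n} {s : Trace A}, s ∈ Ts j → ∀ x ∈ s, InPart (tops (Ts j)) x :=
    fun hs x hx => (h.proper _).inPart hs hx
  have hhead : ∀ {j k : Fin n} {s v : Trace A}, s ∈ Ts j → j ≠ k →
      ∀ x, (s ++ v).head? = some x → ¬ InPart (tops (Ts k)) x := by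
    intro j k s v hs hjk x hx
    rw [List.head?_append_of_ne_nil _ ((h.proper j).ne_nil s hs)] at hx
    exact hB hs hjk x (List.mem_of_mem_head? hx)
  change LoopLang _ _ t at ht
  induction ht with
  | body ht =>
    obtain ⟨j, hj, ht⟩ := ht
    by_cases hji : j = i
    · subst hji
      rw [runs_of_forall (hin ht) ((h.proper j).ne_nil _ ht), List.mem_singleton] at hr
      exact hr ▸ ht
    · have := runs_append_of_forall_not (t := []) (hB ht hji)
      rw [List.append_nil, runs_nil] at this
      simp [this] at hr
  | @step t q s ht hq hs ih =>
    obtain ⟨j, hj, ht⟩ := ht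
    obtain ⟨k, hk, hq⟩ := hq
    have hjk : j ≠ k := fun e => hk (e ▸ hj)
    rw [List.append_assoc] at hr
    by_cases hji : j = i
    · subst hji
      rw [runs_append (hin ht) ((h.proper j).ne_nil _ ht) (hhead hq hjk.symm),
        runs_append_of_forall_not (hB hq hjk.symm)] at hr
      rcases List.mem_cons.1 hr with rfl | hr
      · exact ht
      · exact ih hr
    · rw [runs_append_of_forall_not (hB ht hji)] at hr
      by_cases hki : k = i
      · subst hki
        -- The remaining loop trace starts with a body block, so the loop-back run ends exactly
        -- here.
        have hs' : ∀ x, s.head? = some x → ¬ InPart (tops (Ts k)) x := by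
          intro x hx hxk
          obtain ⟨l, hl, hxl⟩ := h.loop_starts.1 ⟨s, hs, hx⟩
          have := h.inPart_inj hxk (inPart_of_starts (h.proper l) hxl)
          exact hk (this ▸ hl)
        rw [runs_append (hin hq) ((h.proper k).ne_nil _ hq) hs'] at hr
        rcases List.mem_cons.1 hr with rfl | hr
        · exact hq
        · exact ih hr
      · rw [runs_append_of_forall_not (hB hq hki)] at hr
        exact ih hr

theorem IsFamily.xor_complete (h : IsFamily Ts) {L : EventLog A}
    (hL : Complete L (Op.xor.join Ts)) (i : Fin n) :
    Complete (splitLog .xor L (tops (Ts i))) (Ts i) := by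
  have key : ∀ t ∈ L, ∀ x ∈ t, InPart (tops (Ts i)) x → t ∈ splitLog .xor L (tops (Ts i)) := by
    intro t ht x hx hxi
    obtain ⟨j, hj⟩ := hL.sound t ht
    obtain rfl := (h.inPart_iff hj hx).1 hxi
    exact mem_splitLog_xor.2 ⟨ht, fun y hy => (h.inPart_iff hj hy).2 rfl⟩
  refine ⟨fun t ht => ?_, fun x y hf => ?_, ?_, ?_⟩
  · obtain ⟨ht, hV⟩ := mem_splitLog_xor.1 ht
    obtain ⟨j, hj⟩ := hL.sound t ht
    obtain ⟨x, hx⟩ := List.exists_mem_of_ne_nil t ((h.proper j).ne_nil t hj)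
    rwa [(h.inPart_iff hj hx).1 (hV x hx)]
  · obtain ⟨t, ht, hi⟩ := hL.follows x y (h.follows .xor hf)
    exact ⟨t, key t ht x (hi.subset (by simp)) (hf.inPart_left (h.proper i)), hi⟩
  · intro x hx
    obtain ⟨s, hs, hxs⟩ := id hx
    obtain ⟨t, ht, hxt⟩ := hL.start ⟨s, ⟨i, hs⟩, hxs⟩
    exact ⟨t, key t ht x (List.mem_of_mem_head? hxt) (inPart_of_starts (h.proper i) hx), hxt⟩
  · intro x hx
    obtain ⟨s, hs, hxs⟩ := id hx
    obtain ⟨t, ht, hxt⟩ := hL.last ⟨s, ⟨i, hs⟩, hxs⟩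
    exact ⟨t, key t ht x (List.mem_of_mem_getLast? hxt) (inPart_of_ends (h.proper i) hx), hxt⟩

/-- Soundness and pairs are handled alike for both operators; only first and last events of the
child need an argument that depends on the operator. -/
theorem IsFamily.restrict_complete (h : IsFamily Ts) {op : Op} (hop : op = .seq ∨ op = .par)
    {L : EventLog A} (hL : Complete L (op.join Ts)) {i : Fin n}
    (hstart : ∀ x ∈ starts (Ts i), ∃ t ∈ L, (restrict (tops (Ts i)) t).head? = some x)
    (hend : ∀ x ∈ ends (Ts i), ∃ t ∈ L, (restrict (tops (Ts i)) t).getLast? = some x) :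
    Complete (splitLog op L (tops (Ts i))) (Ts i) := by
  have key : ∀ t ∈ L, restrict (tops (Ts i)) t ∈ splitLog op L (tops (Ts i)) :=
    fun t ht => (mem_splitLog_restrict hop).2 ⟨t, ht, rfl⟩
  refine ⟨fun s hs => ?_, fun x y hf => ?_, fun x hx => ?_, fun x hx => ?_⟩
  · obtain ⟨t, ht, rfl⟩ := (mem_splitLog_restrict hop).1 hs
    exact h.restrict_mem hop (hL.sound t ht) i
  · obtain ⟨t, ht, hi⟩ := hL.follows x y (h.follows op hf)
    exact ⟨_, key t ht, pair_infix_restrict hi (hf.inPart_left (h.proper i))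
      (hf.inPart_right (h.proper i))⟩
  · obtain ⟨t, ht, hxt⟩ := hstart x hx
    exact ⟨_, key t ht, hxt⟩
  · obtain ⟨t, ht, hxt⟩ := hend x hx
    exact ⟨_, key t ht, hxt⟩

theorem head?_restrict {V : Set A} {t : Trace A} {x : Event A} (hx : InPart V x)
    (ht : t.head? = some x) : (restrict V t).head? = some x := by
  obtain ⟨w, rfl⟩ := List.head?_eq_some_iff.1 ht
  rw [restrict_cons_of_mem _ hx]
  rfl

theorem getLast?_restrict {V : Set A} {t : Trace A} {x : Event A} (hx : InPart V x)
    (ht : t.getLast? = some x) : (restrict V t).getLast? = some x := by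
  obtain ⟨w, rfl⟩ := List.getLast?_eq_some_iff.1 ht
  rw [restrict_append, restrict_cons_of_mem _ hx]
  simp [restrict]

theorem IsFamily.par_complete (h : IsFamily Ts) {L : EventLog A}
    (hL : Complete L (Op.par.join Ts)) (i : Fin n) :
    Complete (splitLog .par L (tops (Ts i))) (Ts i) := by
  refine h.restrict_complete (Or.inr rfl) hL (fun x hx => ?_) fun x hx => ?_
  · obtain ⟨t, ht, hxt⟩ := hL.start (h.par_starts i hx)
    exact ⟨t, ht, head?_restrict (inPart_of_starts (h.proper i) hx) hxt⟩
  · obtain ⟨t, ht, hxt⟩ := hL.last (h.par_ends i hx)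
    exact ⟨t, ht, getLast?_restrict (inPart_of_ends (h.proper i) hx) hxt⟩

/-- A first event `x` of child `i` either starts a trace of the sequence or directly follows an
event `z` of an earlier child. In a log trace containing `z, x`, sortedness excludes events of child
`i` before `x`, so `x` is first in the restriction. Last events are dual. -/
theorem IsFamily.seq_complete (h : IsFamily Ts) {L : EventLog A}
    (hL : Complete L (Op.seq.join Ts)) (i : Fin n) :
    Complete (splitLog .seq L (tops (Ts i))) (Ts i) := by
  refine h.restrict_complete (Or.inl rfl) hL (fun x hx => ?_) fun x hx => ?_
  · have hxi := inPart_of_starts (h.proper i) hx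
    obtain ⟨s, hs, hxs⟩ := hx
    obtain ⟨ts, hts, rfl⟩ := h.exists_seq i hs
    obtain ⟨p, q, hpq, hp, -⟩ := flatten_ofFn_split ts i
    have hne := (h.proper i).ne_nil _ hs
    rcases List.eq_nil_or_concat p with rfl | ⟨p, z, rfl⟩
    · obtain ⟨t, ht, hxt⟩ := hL.start ⟨_, ⟨ts, hts, rfl⟩, by
        rw [hpq, List.nil_append, List.head?_append_of_ne_nil _ hne, hxs]⟩
      exact ⟨t, ht, head?_restrict hxi hxt⟩
    · obtain ⟨j, hj, hz⟩ := (hp z).1 (by simp)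
      obtain ⟨t, ht, hzx⟩ := hL.follows z x ⟨_, ⟨ts, hts, rfl⟩, by
        rw [hpq]
        refine List.infix_append_of_infix_left (pair_infix_append.2 (Or.inr (Or.inr ⟨?_, hxs⟩)))
        simp⟩
      refine ⟨t, ht, ?_⟩
      have hsorted := h.seq_sorted (hL.sound t ht)
      obtain ⟨u, w, rfl⟩ := pair_infix_iff.1 hzx
      have hzj := (h.proper j).inPart (hts j) hz
      have hu : ∀ y ∈ u ++ [z], ¬ InPart (tops (Ts i)) y := by
        intro y hy hyi
        rw [List.mem_append, List.mem_singleton] at hy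
        rcases hy with hy | rfl
        · exact absurd ((List.pairwise_append.1 hsorted).2.2 y hy z (by simp) i j hyi hzj)
            (not_le.2 hj)
        · exact hj.ne (h.inPart_inj hzj hyi)
      rw [show u ++ z :: x :: w = (u ++ [z]) ++ x :: w by simp, restrict_append,
        restrict_eq_nil hu, restrict_cons_of_mem _ hxi]
      rfl
  · have hxi := inPart_of_ends (h.proper i) hx
    obtain ⟨s, hs, hxs⟩ := hx
    obtain ⟨ts, hts, rfl⟩ := h.exists_seq i hs
    obtain ⟨p, q, hpq, -, hq⟩ := flatten_ofFn_split ts i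
    have hne := (h.proper i).ne_nil _ hs
    rcases q with _ | ⟨z, q⟩
    · obtain ⟨t, ht, hxt⟩ := hL.last ⟨_, ⟨ts, hts, rfl⟩, by
        rw [hpq, List.append_nil, List.getLast?_append_of_ne_nil _ hne, hxs]⟩
      exact ⟨t, ht, getLast?_restrict hxi hxt⟩
    · obtain ⟨j, hj, hz⟩ := (hq z).1 (by simp)
      obtain ⟨t, ht, hzx⟩ := hL.follows x z ⟨_, ⟨ts, hts, rfl⟩, by
        rw [hpq, List.append_assoc]
        exact List.infix_append_of_infix_right
          (pair_infix_append.2 (Or.inr (Or.inr ⟨hxs, rfl⟩)))⟩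
      refine ⟨t, ht, ?_⟩
      have hsorted := h.seq_sorted (hL.sound t ht)
      obtain ⟨u, w, rfl⟩ := pair_infix_iff.1 hzx
      have hzj := (h.proper j).inPart (hts j) hz
      have hw : ∀ y ∈ z :: w, ¬ InPart (tops (Ts i)) y := by
        intro y hy hyi
        rcases List.mem_cons.1 hy with rfl | hy
        · exact hj.ne' (h.inPart_inj hzj hyi)
        · have := (List.pairwise_cons.1 (List.pairwise_cons.1
            (List.pairwise_append.1 hsorted).2.1).2).1 y hy
          exact absurd (this j i hzj hyi) (not_le.2 hj)
      rw [show u ++ x :: z :: w = (u ++ [x]) ++ z :: w by simp, restrict_append,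
        restrict_eq_nil hw, List.append_nil]
      exact getLast?_restrict hxi (by simp)

/-- First events of the body start loop traces. Those of a loop-back directly follow a body end,
which lies outside the child, so the log shows them at the beginning of a run; last events are dual.
-/
theorem IsFamily.loop_complete (h : IsFamily Ts) {L : EventLog A}
    (hL : Complete L (Op.loop.join Ts)) (i : Fin n) :
    Complete (splitLog .loop L (tops (Ts i))) (Ts i) := by
  have h0 : (⟨0, i.pos⟩ : Fin n).val = 0 := rfl
  have key : ∀ t ∈ L, ∀ r ∈ runs (tops (Ts i)) t, r ∈ splitLog .loop L (tops (Ts i)) :=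
    fun t ht r hr => mem_splitLog_loop.2 ⟨t, ht, hr⟩
  refine ⟨fun s hs => ?_, fun x y hf => ?_, fun x hx => ?_, fun x hx => ?_⟩
  · obtain ⟨t, ht, hs⟩ := mem_splitLog_loop.1 hs
    exact h.runs_mem (hL.sound t ht) i hs
  · obtain ⟨t, ht, hi⟩ := hL.follows x y (h.follows .loop hf)
    obtain ⟨r, hr, hi⟩ := follows_runs hi (hf.inPart_left (h.proper i))
      (hf.inPart_right (h.proper i))
    exact ⟨r, key t ht r hr, hi⟩
  · have hxi := inPart_of_starts (h.proper i) hx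
    obtain ⟨t, ht, hxt⟩ : ∃ t ∈ L, t.head? = some x ∨
        ∃ z, ¬ InPart (tops (Ts i)) z ∧ [z, x] <:+: t := by
      by_cases hi : i.val = 0
      · obtain ⟨t, ht, hxt⟩ := hL.start (h.loop_starts.2 ⟨i, hi, hx⟩)
        exact ⟨t, ht, Or.inl hxt⟩
      · obtain ⟨_, z, hz, _⟩ := lastTops_nonempty (h.proper ⟨0, i.pos⟩)
        obtain ⟨t, ht, hzx⟩ := hL.follows z x (loop_leave h0 hi hz hx)
        exact ⟨t, ht, Or.inr ⟨z, fun hzi => hi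
          (h.inPart_inj hzi (inPart_of_ends (h.proper _) hz) ▸ h0), hzx⟩⟩
    obtain ⟨r, hr, hxr⟩ := head_runs hxi hxt
    exact ⟨r, key t ht r hr, hxr⟩
  · have hxi := inPart_of_ends (h.proper i) hx
    obtain ⟨t, ht, hxt⟩ : ∃ t ∈ L, t.getLast? = some x ∨
        ∃ z, ¬ InPart (tops (Ts i)) z ∧ [x, z] <:+: t := by
      by_cases hi : i.val = 0
      · obtain ⟨t, ht, hxt⟩ := hL.last (h.loop_ends.2 ⟨i, hi, hx⟩)
        exact ⟨t, ht, Or.inl hxt⟩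
      · obtain ⟨_, z, hz, _⟩ := firstTops_nonempty (h.proper ⟨0, i.pos⟩)
        obtain ⟨t, ht, hzx⟩ := hL.follows x z (loop_enter h0 hi hx hz)
        exact ⟨t, ht, Or.inr ⟨z, fun hzi => hi
          (h.inPart_inj hzi (inPart_of_starts (h.proper _) hz) ▸ h0), hzx⟩⟩
    obtain ⟨r, hr, hxr⟩ := last_runs hxi hxt
    exact ⟨r, key t ht r hr, hxr⟩

/-- The sublogs are complete to the children. -/
theorem IsFamily.splitLog_complete (h : IsFamily Ts) {op : Op} {L : EventLog A}
    (hL : Complete L (op.join Ts)) (i : Fin n) :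
    Complete (splitLog op L (tops (Ts i))) (Ts i) := by
  cases op with
  | xor => exact h.xor_complete hL i
  | seq => exact h.seq_complete hL i
  | par => exact h.par_complete hL i
  | loop => exact h.loop_complete hL i

end Family

end Sublogs

-- Rediscovery of normal forms by induction

section Rediscovery

variable {A : Type u}

/-- A plain event, seen as an event without an unresolved recursive call. -/
def plain (x : Event A) : MEvent A := ⟨x, none⟩

theorem plain_injective : Function.Injective (plain : Event A → MEvent A) :=
  fun _ _ h => congrArg MEvent.path h

theorem Resolve.self {f : A} {L : Set (MTrace A)} {t : MTrace A} (h : ∀ x ∈ t, x.mark ≠ some f) :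
    Resolve f L t t := by
  induction t with
  | nil => exact .nil
  | cons x t ih => exact .keep (h x (by simp)) (ih fun y hy => h y (by simp [hy]))

theorem Resolve.eq_self {f : A} {L : Set (MTrace A)} {xs t : MTrace A} (h : Resolve f L xs t)
    (hx : ∀ x ∈ xs, x.mark ≠ some f) : t = xs := by
  induction xs generalizing t with
  | nil =>
    cases h
    rfl
  | cons x xs ih =>
    cases h with
    | keep _ h => rw [ih h fun y hy => hx y (by simp [hy])]
    | recurse _ _ => exact absurd rfl (hx _ List.mem_cons_self)

theorem prependTrace_plain (f : A) (t : Trace A) :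
    prependTrace [f] (t.map plain) = (t.map (List.cons f)).map plain := by
  simp only [prependTrace, List.map_map]
  rfl

/-- Without recursive calls, the fixed point is reached by prefixing alone. This evaluates the named
subtrees that the algorithm returns. -/
theorem namedLang_image_plain (f : A) (T : Set (Trace A)) :
    {t | NamedLang f (List.map plain '' T) t} =
      List.map plain '' (List.map (List.cons f) '' T) := by
  have hmark : ∀ t : Trace A, ∀ x ∈ t.map plain, x.mark ≠ some f := by
    intro t x hx
    obtain ⟨y, _, rfl⟩ := List.mem_map.1 hx
    simp [plain]
  ext t
  constructor
  · intro h
    cases h with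
    | intro hx ht =>
      obtain ⟨s, hs, rfl⟩ := hx
      rw [ht.eq_self (hmark s), prependTrace_plain]
      exact ⟨_, ⟨s, hs, rfl⟩, rfl⟩
  · rintro ⟨_, ⟨s, hs, rfl⟩, rfl⟩
    change NamedLang _ _ _
    rw [← prependTrace_plain]
    exact .intro ⟨s, hs, rfl⟩ (.self (hmark s))

/-- No event is dropped because none is empty, so projection inverts the prefixing exactly. -/
theorem projectTrace_map_cons {f : A} {t : Trace A} (h : ∀ x ∈ t, x ≠ []) :
    projectTrace 1 (t.map (List.cons f)) = t := by
  rw [projectTrace, List.map_map]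
  have : ((fun x : Event A => x.drop 1) ∘ List.cons f) = id := by
    funext x
    simp
  rw [this, List.map_id, List.filter_eq_self]
  intro x hx
  simp [h x hx]

theorem Complete.exists_ne_nil {L : EventLog A} {T : Set (Trace A)} (hL : Complete L T)
    (hT : Proper T) : ∃ t ∈ L, t ≠ [] := by
  obtain ⟨t, ht⟩ := hT.nonempty
  obtain ⟨x, hx⟩ := List.exists_mem_of_ne_nil t (hT.ne_nil t ht)
  obtain ⟨s, hs, hx⟩ := hL.exists_mem ht hx
  exact ⟨s, hs, List.ne_nil_of_mem hx⟩

theorem naive_act (a : A) {L : EventLog A} (hL : Complete L {[[a]]}) :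
    (∃ P, Naive L P) ∧ ∀ P, Naive L P → P.lang = List.map plain '' {[[a]]} := by
  obtain ⟨t, ht, hne⟩ := hL.exists_ne_nil (NF.act a).proper
  have hnot : ¬ ∀ t ∈ L, t = [] := fun h => hne (h t ht)
  refine ⟨⟨_, .single a hnot hL.sound⟩, fun P hP => ?_⟩
  cases hP with
  | silent h => exact absurd h hnot
  | single b _ h =>
    have := (h t ht).symm.trans (hL.sound t ht)
    simp only [List.cons.injEq, and_true] at this
    simp [HTree.lang, plain, this]
  | subtree f h _ =>
    obtain ⟨-, s, hs, x, hx, hlen⟩ := h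
    rw [hL.sound s hs] at hx
    simp only [List.mem_singleton] at hx
    simp [hx] at hlen
  | emptyTraces h _ _ => exact absurd hL.sound (h.2.1 a)
  | split _ _ _ h _ _ _ => exact absurd hL.sound (h.2.1 a)
  | flower _ _ h _ _ _ _ => exact absurd hL.sound (h.2.1 a)

theorem follows_image_iff {X Y : Type u} {f : X → Y} (hf : Function.Injective f)
    {T : Set (List X)} {x y : X} :
    Follows (List.map f '' T) (f x) (f y) ↔ Follows T x y := by
  constructor
  · rintro ⟨_, ⟨t, ht, rfl⟩, hi⟩
    obtain ⟨u, v, h⟩ := pair_infix_iff.1 hi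
    obtain ⟨u', w, rfl, -, h⟩ := List.map_eq_append_iff.1 h
    obtain ⟨x', w', rfl, hx, h⟩ := List.map_eq_cons_iff.1 h
    obtain ⟨y', v', rfl, hy, h⟩ := List.map_eq_cons_iff.1 h
    rw [← hf hx, ← hf hy]
    exact ⟨_, ht, pair_infix_iff.2 ⟨_, _, rfl⟩⟩
  · rintro ⟨t, ht, hi⟩
    obtain ⟨u, v, rfl⟩ := pair_infix_iff.1 hi
    exact ⟨_, ⟨_, ht, rfl⟩, pair_infix_iff.2 ⟨u.map f, v.map f, by simp⟩⟩

theorem starts_image_iff {X Y : Type u} {f : X → Y} (hf : Function.Injective f)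
    {T : Set (List X)} {x : X} : f x ∈ starts (List.map f '' T) ↔ x ∈ starts T := by
  simp [starts, hf.eq_iff]

theorem ends_image_iff {X Y : Type u} {f : X → Y} (hf : Function.Injective f)
    {T : Set (List X)} {x : X} : f x ∈ ends (List.map f '' T) ↔ x ∈ ends T := by
  simp [ends, hf.eq_iff]

/-- Completeness depends only on the set of traces, which an injective relabelling transports back.
-/
theorem Complete.of_image {f : Event A → Event A} (hf : Function.Injective f) {L : EventLog A}
    {T : Set (Trace A)} (hL : Complete L (List.map f '' T)) {L' : EventLog A}
    (h : ∀ t ∈ T, t.map f ∈ L ↔ t ∈ L') (hL' : ∀ t ∈ L', t ∈ T) : Complete L' T := by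
  have e : {t | t ∈ L} = List.map f '' {t | t ∈ L'} := by
    ext s
    constructor
    · intro hs
      obtain ⟨t, ht, rfl⟩ := hL.sound s hs
      exact ⟨t, (h t ht).1 hs, rfl⟩
    · rintro ⟨t, ht, rfl⟩
      exact (h t (hL' t ht)).2 ht
  refine ⟨hL', fun x y hxy => ?_, fun x hx => ?_, fun x hx => ?_⟩
  · have := hL.follows _ _ ((follows_image_iff hf).2 hxy)
    rwa [e, follows_image_iff hf] at this
  · have := hL.start ((starts_image_iff hf).2 hx)
    rwa [e, starts_image_iff hf] at this
  · have := hL.last ((ends_image_iff hf).2 hx)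
    rwa [e, ends_image_iff hf] at this

theorem naive_named (f : A) {T : Set (Trace A)} (hT : Proper T)
    (ih : ∀ L, Complete L T →
      (∃ P, Naive L P) ∧ ∀ P, Naive L P → P.lang = List.map plain '' T)
    {L : EventLog A} (hL : Complete L (List.map (List.cons f) '' T)) :
    (∃ P, Naive L P) ∧
      ∀ P, Naive L P → P.lang = List.map plain '' (List.map (List.cons f) '' T) := by
  have hmem : ∀ s, s ∈ project 1 L ↔ s ∈ T ∧ s.map (List.cons f) ∈ L := by
    intro s
    constructor
    · intro hs
      obtain ⟨t, ht, rfl⟩ := Multiset.mem_map.1 hs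
      obtain ⟨s, hsT, rfl⟩ := hL.sound t ht
      rw [projectTrace_map_cons (hT.event_ne_nil s hsT)]
      exact ⟨hsT, ht⟩
    · rintro ⟨hs, ht⟩
      exact Multiset.mem_map.2 ⟨_, ht, projectTrace_map_cons (hT.event_ne_nil s hs)⟩
  have hproj : Complete (project 1 L) T :=
    hL.of_image (List.cons_injective) (fun t ht => by simp [hmem, ht]) fun t ht => ((hmem t).1 ht).1
  have hcase : SubtreeCase L f := by
    refine ⟨fun t ht x hx => ?_, ?_⟩
    · obtain ⟨s, _, rfl⟩ := hL.sound t ht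
      obtain ⟨y, _, rfl⟩ := List.mem_map.1 hx
      rfl
    -- Some event has length at least two: the prefix `f` in front of a non-empty event.
    · obtain ⟨s, hs, hne⟩ := hproj.exists_ne_nil hT
      obtain ⟨x, hx⟩ := List.exists_mem_of_ne_nil s hne
      obtain ⟨hs, hsL⟩ := (hmem s).1 hs
      refine ⟨_, hsL, _, List.mem_map_of_mem hx, ?_⟩
      have := List.length_pos_of_ne_nil (hT.event_ne_nil s hs x hx)
      simp only [List.length_cons]
      omega
  obtain ⟨⟨P, hP⟩, hall⟩ := ih _ hproj
  refine ⟨⟨_, .subtree f hcase hP⟩, fun Q hQ => ?_⟩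
  obtain ⟨t, ht, x, hx, hlen⟩ := id hcase.2
  cases hQ with
  | silent h => simp [h t ht] at hx
  | single b _ h =>
    rw [h t ht, List.mem_singleton] at hx
    simp [hx] at hlen
  | subtree g h hQ =>
    have := (h.1 t ht x hx).symm.trans (hcase.1 t ht x hx)
    obtain rfl : g = f := by simpa using this
    rw [HTree.lang, hall _ hQ, namedLang_image_plain]
  | emptyTraces h _ _ => exact absurd hcase (h.2.2 f)
  | split _ _ _ h _ _ _ => exact absurd hcase (h.2.2 f)
  | flower _ _ h _ _ _ _ => exact absurd hcase (h.2.2 f)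

/-- Every base case leaves at most one topmost activity, while an operator node has at least two
non-empty disjoint alphabets. -/
theorem noBaseCase_of_two {L : EventLog A} {a b : A} (hab : a ≠ b) (ha : a ∈ topAlphabet L)
    (hb : b ∈ topAlphabet L) : NoBaseCase L := by
  obtain ⟨t, ht, x, hx, hxa⟩ := ha
  obtain ⟨s, hs, y, hy, hyb⟩ := hb
  refine ⟨fun h => ?_, fun c h => ?_, fun f h => ?_⟩
  · simp [h t ht] at hx
  · rw [h t ht, List.mem_singleton] at hx
    rw [h s hs, List.mem_singleton] at hy
    subst hx hy
    exact hab (Option.some.inj (hxa.symm.trans hyb))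
  · exact hab (Option.some.inj (hxa.symm.trans ((h.1 t ht x hx).trans
      ((h.1 s hs y hy).symm.trans hyb))))

theorem naive_node {op : Op} {n : ℕ} {Ts : Fin n → Set (Trace A)} {ks : Fin n → Option Op}
    (h : NFChildren op Ts ks)
    (ih : ∀ i, ∀ L, Complete L (Ts i) →
      (∃ P, Naive L P) ∧ ∀ P, Naive L P → P.lang = List.map plain '' Ts i)
    {L : EventLog A} (hL : Complete L (op.join Ts)) :
    (∃ P, Naive L P) ∧ ∀ P, Naive L P → P.lang = List.map plain '' op.join Ts := by
  have hF := h.isFamily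
  have hn := h.two_le
  have hbase : NoBaseCase L := by
    obtain ⟨a, ha⟩ := (hF.proper ⟨0, by omega⟩).tops_nonempty
    obtain ⟨b, hb⟩ := (hF.proper ⟨1, hn⟩).tops_nonempty
    have hab : a ≠ b := fun e => zero_ne_one (congrArg Fin.val (hF.eq_of_mem ha (e ▸ hb)))
    exact noBaseCase_of_two hab (hL.topAlphabet_eq ▸ hF.tops_subset op _ ha)
      (hL.topAlphabet_eq ▸ hF.tops_subset op _ hb)
  have hnil : [] ∉ L := fun hm => (hF.join_proper op (by omega)).ne_nil _ (hL.sound _ hm) rfl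
  have hsub := fun i => hF.splitLog_complete hL i
  have hsel := h.selected hL
  have hmin : op.minArity ≤ n := by cases op <;> simp [Op.minArity] <;> omega
  constructor
  · choose c hc using fun i => (ih i _ (hsub i)).1
    exact ⟨_, .split op _ hmin hbase hnil hsel hc⟩
  · intro P hP
    cases hP with
    | silent h => exact absurd h hbase.1
    | single a _ h => exact absurd h (hbase.2.1 a)
    | subtree f h _ => exact absurd h (hbase.2.2 f)
    | emptyTraces _ h _ => exact absurd h hnil
    | flower _ _ _ _ h _ _ => exact absurd ⟨n, _, hn, hsel.cut⟩ (h op)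
    | @split _ op' m S hm c _ _ hS hc =>
      -- Whichever maximal cut was chosen, it is the children's cut renumbered by `σ`, so the
      -- induction hypothesis applies to each sublog and `join_perm` absorbs `σ`.
      obtain ⟨rfl, σ, hσ, hseq, hloop⟩ := h.exists_perm hL hS
      obtain rfl : n = m := by simpa using Fintype.card_congr σ
      have hlang : ∀ i, (c (σ i)).lang = List.map plain '' Ts i := fun i =>
        (ih i _ (hsub i)).2 _ (hσ i ▸ hc (σ i))
      rw [HTree.lang, image_map_join plain_injective,
        ← join_perm σ (fun e => Equiv.ext fun i => Fin.ext (hseq e i)) hloop]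
      simp only [hlang]

/-- The algorithm rediscovers every language in normal form from a complete log. -/
theorem NF.rediscovered {k : Option Op} {T : Set (Trace A)} (h : NF k T) :
    ∀ L, Complete L T → (∃ P, Naive L P) ∧ ∀ P, Naive L P → P.lang = List.map plain '' T := by
  induction h with
  | act a => exact fun L hL => naive_act a hL
  | named f h ih => exact fun L hL => naive_named f h.proper ih hL
  | node op hn h hd hk hb hr ih => exact fun L hL => naive_node ⟨hn, h, hd, hk, hb, hr⟩ ih hL

end Rediscovery

-- Merging nested operators

section Flattening

variable {A : Type u}

/-- Unary nodes are invisible. The unary loop has only a body and no loop-back; it serves to view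
any language as a loop. -/
theorem join_single {X : Type u} {op : Op} (T : Set (List X)) :
    op.join (fun _ : Fin 1 => T) = T := by
  ext t
  cases op with
  | xor => simp [Op.join]
  | seq =>
    constructor
    · rintro ⟨ts, hts, rfl⟩
      simpa using hts 0
    · exact fun ht => ⟨fun _ => t, fun _ => ht, by simp⟩
  | par =>
    constructor
    · rintro ⟨ts, hts, h⟩
      have := h.filter_eq (p := fun _ _ => true) (fun i j x _ => by simp [Subsingleton.elim i j]) 0
      rw [List.filter_true] at this
      exact this ▸ hts 0
    · intro ht
      refine ⟨fun _ => t, fun _ => ht, ?_⟩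
      have := interleave_filter (n := 1) (fun _ _ => true) t
        (fun x _ => ⟨0, fun j => by simp [Subsingleton.elim j 0]⟩)
      simpa using this
  | loop =>
    constructor
    · intro h
      cases h with
      | body ht => exact let ⟨_, _, ht⟩ := ht; ht
      | step _ hr _ => exact let ⟨i, hi, _⟩ := hr; absurd (by omega) hi
    · exact fun ht => mem_loop_body (i := 0) rfl ht

theorem restrict_restrict {V W : Set A} (h : V ⊆ W) (t : Trace A) :
    restrict V (restrict W t) = restrict V t := by
  rw [restrict, restrict, List.filter_filter]
  refine List.filter_congr fun x _ => ?_
  by_cases hx : InPart V x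
  · have : InPart W x := let ⟨a, ha, hxa⟩ := hx; ⟨a, h ha, hxa⟩
    simp [hx, this]
  · simp [hx]

theorem InPart.mono {V W : Set A} (h : V ⊆ W) {x : Event A} (hx : InPart V x) : InPart W x :=
  let ⟨a, ha, hxa⟩ := hx
  ⟨a, h ha, hxa⟩

section Family

variable {n m : ℕ} {Ts : Fin n → Set (Trace A)} {Us : Fin m → Set (Trace A)}

theorem isFamily_append (hT : IsFamily Ts) (hU : IsFamily Us)
    (hd : ∀ i j, Disjoint (tops (Ts i)) (tops (Us j))) : IsFamily (Fin.append Ts Us) := by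
  constructor
  · intro i
    refine Fin.addCases (fun i => ?_) (fun i => ?_) i
    · simpa using hT.proper i
    · simpa using hU.proper i
  · intro i j
    refine Fin.addCases (fun i => ?_) (fun i => ?_) i <;>
      refine Fin.addCases (fun j => ?_) (fun j => ?_) j <;> intro hij
    · simpa using hT.disjoint i j (by rintro rfl; exact hij rfl)
    · simpa using hd i j
    · simpa using (hd j i).symm
    · simpa using hU.disjoint i j (by rintro rfl; exact hij rfl)

theorem IsFamily.join_restrict_iff (h : IsFamily Ts) {t : Trace A} :
    restrict (tops (Op.par.join Ts)) t ∈ Op.par.join Ts ↔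
      ∀ i, restrict (tops (Ts i)) t ∈ Ts i := by
  rw [h.mem_par_iff]
  simp only [fun i => restrict_restrict (h.tops_subset .par i) t, and_iff_right_iff_imp]
  intro _ x hx
  obtain ⟨a, ha, hxa⟩ := (mem_restrict.1 hx).2
  obtain ⟨i, hi⟩ := h.exists_of_mem_tops ha
  exact ⟨i, a, hi, hxa⟩

/-- Nested joins with the same operator can be merged. -/
theorem join_append (hT : IsFamily Ts) (hU : IsFamily Us)
    (hd : ∀ i j, Disjoint (tops (Ts i)) (tops (Us j))) (hn : 0 < n) (hm : 0 < m) {op : Op}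
    (hop : op ≠ .loop) : op.join (Fin.append Ts Us) = op.join ![op.join Ts, op.join Us] := by
  ext t
  cases op with
  | xor =>
    constructor
    · rintro ⟨i, hi⟩
      revert hi
      refine Fin.addCases (fun i hi => ?_) (fun i hi => ?_) i
      · exact ⟨0, i, by simpa using hi⟩
      · exact ⟨1, i, by simpa using hi⟩
    · rintro ⟨i, hi⟩
      fin_cases i
      · obtain ⟨i, hi⟩ := hi
        exact ⟨Fin.castAdd m i, by simpa using hi⟩
      · obtain ⟨i, hi⟩ := hi
        exact ⟨Fin.natAdd n i, by simpa using hi⟩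
  | seq =>
    constructor
    · rintro ⟨ts, hts, rfl⟩
      refine ⟨![(List.ofFn fun i => ts (Fin.castAdd m i)).flatten,
        (List.ofFn fun i => ts (Fin.natAdd n i)).flatten], fun i => ?_, ?_⟩
      · fin_cases i
        · exact ⟨_, fun i => by simpa using hts (Fin.castAdd m i), rfl⟩
        · exact ⟨_, fun i => by simpa using hts (Fin.natAdd n i), rfl⟩
      · have : ts = Fin.append (fun i => ts (Fin.castAdd m i)) (fun i => ts (Fin.natAdd n i)) :=
          Fin.append_castAdd_natAdd.symm
        conv_lhs => rw [this, List.ofFn_fin_append]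
        simp
    · rintro ⟨ts, hts, rfl⟩
      obtain ⟨us, hus, h₀⟩ := hts 0
      obtain ⟨vs, hvs, h₁⟩ := hts 1
      refine ⟨Fin.append us vs, fun i => ?_, ?_⟩
      · refine Fin.addCases (fun i => ?_) (fun i => ?_) i
        · simpa using hus i
        · simpa using hvs i
      · rw [List.ofFn_fin_append, List.flatten_append, ← h₀, ← h₁]
        simp
  | par =>
    have h2 : IsFamily ![Op.par.join Ts, Op.par.join Us] := by
      have hdis : Disjoint (tops (Op.par.join Ts)) (tops (Op.par.join Us)) := by
        rw [hT.tops_join, hU.tops_join]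
        simpa using fun i j => hd j i
      constructor
      · intro i
        fin_cases i
        · exact hT.join_proper .par hn
        · exact hU.join_proper .par hm
      · intro i j hij
        fin_cases i <;> fin_cases j
        · exact absurd rfl hij
        · exact hdis
        · exact hdis.symm
        · exact absurd rfl hij
    rw [(isFamily_append hT hU hd).mem_par_iff, h2.mem_par_iff]
    simp only [Fin.forall_fin_two, Fin.exists_fin_two, Matrix.cons_val_zero, Matrix.cons_val_one]
    rw [hT.join_restrict_iff, hU.join_restrict_iff]
    refine and_congr (forall₂_congr fun x _ => ?_) ?_
    · constructor
      · rintro ⟨i, hi⟩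
        revert hi
        refine Fin.addCases (fun i hi => ?_) (fun i hi => ?_) i
        · rw [Fin.append_left] at hi
          exact Or.inl (hi.mono (hT.tops_subset _ i))
        · rw [Fin.append_right] at hi
          exact Or.inr (hi.mono (hU.tops_subset _ i))
      · rintro (⟨a, ha, hxa⟩ | ⟨a, ha, hxa⟩)
        · obtain ⟨i, hi⟩ := hT.exists_of_mem_tops ha
          exact ⟨Fin.castAdd m i, a, by simpa using hi, hxa⟩
        · obtain ⟨i, hi⟩ := hU.exists_of_mem_tops ha
          exact ⟨Fin.natAdd n i, a, by simpa using hi, hxa⟩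
    · constructor
      · intro h
        exact ⟨fun i => by simpa using h (Fin.castAdd m i),
          fun i => by simpa using h (Fin.natAdd n i)⟩
      · rintro ⟨h₁, h₂⟩ i
        refine Fin.addCases (fun i => ?_) (fun i => ?_) i
        · simpa using h₁ i
        · simpa using h₂ i
  | loop => exact absurd rfl hop

end Family

/-- `T` is the join of languages in normal form whose topmost operators are not `op`. -/
def HasComponents (op : Op) (T : Set (Trace A)) : Prop :=
  ∃ (n : ℕ) (ks : Fin n → Option Op) (Ts : Fin n → Set (Trace A)), 0 < n ∧
    (∀ i, NF (ks i) (Ts i)) ∧ (∀ i j, i ≠ j → Disjoint (tops (Ts i)) (tops (Ts j))) ∧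
    (∀ i, ks i ≠ some op) ∧ T = op.join Ts

/-- If `op` is on top, its children are the components; otherwise `T` is its own single component.
-/
theorem NF.hasComponents {k : Option Op} {T : Set (Trace A)} (h : NF k T) {op : Op}
    (hop : op ≠ .loop) : HasComponents op T := by
  by_cases hk : k = some op
  · subst hk
    cases h with
    | node _ hn h hd hk _ _ => exact ⟨_, _, _, by omega, h, hd, hk hop, rfl⟩
  · exact ⟨1, fun _ => k, fun _ => T, one_pos, fun _ => h,
      fun i j hij => absurd (Subsingleton.elim i j) hij, fun _ => hk, (join_single T).symm⟩

theorem HasComponents.exists_nf {op : Op} {T : Set (Trace A)} (h : HasComponents op T)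
    (hop : op ≠ .loop) : ∃ k, NF k T := by
  obtain ⟨n, ks, Ts, hn, hT, hd, hk, rfl⟩ := h
  by_cases hn1 : n = 1
  · subst hn1
    refine ⟨ks 0, ?_⟩
    rw [show Ts = fun _ => Ts 0 from funext fun i => by rw [Subsingleton.elim i 0], join_single]
    exact hT 0
  · exact ⟨_, .node op (by omega) hT hd (fun _ => hk) (fun e => absurd e hop)
      fun e => absurd e hop⟩

theorem HasComponents.join {op : Op} (hop : op ≠ .loop) {T U : Set (Trace A)}
    (hT : HasComponents op T) (hU : HasComponents op U) (hd : Disjoint (tops T) (tops U)) :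
    HasComponents op (op.join ![T, U]) := by
  obtain ⟨n, ks, Ts, hn, hTs, hTd, hTk, rfl⟩ := hT
  obtain ⟨m, ls, Us, hm, hUs, hUd, hUk, rfl⟩ := hU
  have hFT : IsFamily Ts := ⟨fun i => (hTs i).proper, hTd⟩
  have hFU : IsFamily Us := ⟨fun i => (hUs i).proper, hUd⟩
  have hd' : ∀ i j, Disjoint (tops (Ts i)) (tops (Us j)) := fun i j =>
    hd.mono (hFT.tops_subset op i) (hFU.tops_subset op j)
  refine ⟨n + m, Fin.append ks ls, Fin.append Ts Us, by omega, fun i => ?_,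
    (isFamily_append hFT hFU hd').disjoint, fun i => ?_, (join_append hFT hFU hd' hn hm hop).symm⟩
  · refine Fin.addCases (fun i => ?_) (fun i => ?_) i
    · simpa using hTs i
    · simpa using hUs i
  · refine Fin.addCases (fun i => ?_) (fun i => ?_) i
    · simpa using hTk i
    · simpa using hUk i

/-- The children are merged one at a time, splitting off the last, so that only binary nesting has
to be flattened. -/
theorem hasComponents_join {op : Op} (hop : op ≠ .loop) {n : ℕ} (hn : 0 < n)
    {ks : Fin n → Option Op} {Ts : Fin n → Set (Trace A)} (h : ∀ i, NF (ks i) (Ts i))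
    (hd : ∀ i j, i ≠ j → Disjoint (tops (Ts i)) (tops (Ts j))) :
    HasComponents op (op.join Ts) := by
  induction n, hn using Nat.le_induction with
  | base =>
    rw [show Ts = fun _ => Ts 0 from funext fun i => by rw [Subsingleton.elim i 0], join_single]
    exact (h 0).hasComponents hop
  | succ n hn ih =>
    have hF : IsFamily fun i : Fin n => Ts i.castSucc :=
      ⟨fun i => (h _).proper, fun i j hij => hd _ _ fun e => hij (Fin.castSucc_injective n e)⟩
    have hl : IsFamily fun _ : Fin 1 => Ts (Fin.last n) :=
      ⟨fun _ => (h _).proper, fun i j hij => absurd (Subsingleton.elim i j) hij⟩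
    have hdl : ∀ i : Fin n, Disjoint (tops (Ts i.castSucc)) (tops (Ts (Fin.last n))) := fun i =>
      hd _ _ (Fin.castSucc_lt_last i).ne
    have e : Ts = Fin.append (fun i : Fin n => Ts i.castSucc) fun _ : Fin 1 => Ts (Fin.last n) := by
      rw [Fin.append_right_eq_snoc]
      exact (Fin.snoc_init_self Ts).symm
    rw [e, join_append hF hl (fun i _ => hdl i) hn one_pos hop, join_single]
    refine HasComponents.join hop (ih (fun i => h _) hF.disjoint) ((h _).hasComponents hop) ?_
    rw [hF.tops_join]
    exact Set.disjoint_iUnion_left.2 hdl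

/-- A general finite index type is convenient once the children with empty language have been
discarded. -/
theorem hasComponents_union {ι : Type*} [Finite ι] [Nonempty ι] {ks : ι → Option Op}
    {Ts : ι → Set (Trace A)} (h : ∀ i, NF (ks i) (Ts i))
    (hd : ∀ i j, i ≠ j → Disjoint (tops (Ts i)) (tops (Ts j))) :
    HasComponents .xor {t | ∃ i, t ∈ Ts i} := by
  have := Fintype.ofFinite ι
  let e := Fintype.equivFin ι
  have := hasComponents_join (op := .xor) (by simp) (Fintype.card_pos (α := ι))
    (fun i => h (e.symm i)) fun i j hij => hd _ _ fun he => hij (e.symm.injective he)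
  convert this using 1
  ext t
  exact e.exists_congr_left

/-- A loop in the body of a loop adds its loop-backs to those of the outer loop. -/
theorem loopLang_loopLang {X : Type u} (B R S : Set (List X)) (t : List X) :
    LoopLang {t | LoopLang B R t} S t ↔ LoopLang B (R ∪ S) t := by
  constructor
  · intro h
    induction h with
    | body ht => exact LoopLang.mono subset_rfl Set.subset_union_left ht
    | step ht hr _ ih =>
      exact LoopLang.trans (LoopLang.mono subset_rfl Set.subset_union_left ht) (Or.inr hr) ih
  · intro h
    induction h with
    | body ht => exact .body (show _ ∈ {t | LoopLang B R t} from LoopLang.body ht)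
    | @step t r s ht hr _ ih =>
      rcases hr with hr | hr
      · cases ih with
        | body hs =>
          exact .body (show t ++ r ++ _ ∈ {t | LoopLang B R t} from LoopLang.step ht hr hs)
        -- A loop-back from `R` stays inside the inner loop, so `t ++ r ++ t'` becomes one body
        -- trace of the outer loop.
        | @step t' r' s' hs hr' hs' =>
          have := LoopLang.step (R := S) (show t ++ r ++ t' ∈ {t | LoopLang B R t} from
            LoopLang.step ht hr hs) hr' hs'
          simpa using this
      · exact .step (show t ∈ {t | LoopLang B R t} from LoopLang.body ht) hr ih

theorem exists_loop_components {k : Option Op} {B : Set (Trace A)} (h : NF k B)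
    (hd : Disjoint (firstTops B) (lastTops B)) :
    ∃ (n : ℕ) (ks : Fin n → Option Op) (Ts : Fin n → Set (Trace A)), 0 < n ∧
      (∀ i, NF (ks i) (Ts i)) ∧ (∀ i j, i ≠ j → Disjoint (tops (Ts i)) (tops (Ts j))) ∧
      (∀ i, i.val = 0 → ks i ≠ some .loop ∧ Disjoint (firstTops (Ts i)) (lastTops (Ts i))) ∧
      (∀ i, i.val ≠ 0 → ks i ≠ some .xor) ∧ B = Op.loop.join Ts := by
  by_cases hk : k = some .loop
  · subst hk
    cases h with
    | node _ hn h hdis hk hb hr => exact ⟨_, _, _, by omega, h, hdis, hb rfl, hr rfl, rfl⟩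
  · exact ⟨1, fun _ => k, fun _ => B, one_pos, fun _ => h,
      fun i j hij => absurd (Subsingleton.elim i j) hij, fun _ _ => ⟨hk, hd⟩,
      fun i hi => absurd (by omega) hi, (join_single B).symm⟩

/-- A body that is a loop is opened by `loopLang_loopLang`, and the loop-backs enter as choice
components. Hence the new body is no loop and no loop-back is a choice, as `NF` demands. -/
theorem exists_nf_loop {k : Option Op} {B R : Set (Trace A)} (hB : NF k B)
    (hd : Disjoint (firstTops B) (lastTops B)) (hR : HasComponents .xor R)
    (hBR : Disjoint (tops B) (tops R)) : ∃ k, NF k {t | LoopLang B R t} := by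
  obtain ⟨n, ks, Ts, hn, hTs, hTd, hTb, hTr, rfl⟩ := exists_loop_components hB hd
  obtain ⟨m, ls, Us, hm, hUs, hUd, hUk, rfl⟩ := hR
  have hFT : IsFamily Ts := ⟨fun i => (hTs i).proper, hTd⟩
  have hFU : IsFamily Us := ⟨fun i => (hUs i).proper, hUd⟩
  have hd' : ∀ i j, Disjoint (tops (Ts i)) (tops (Us j)) := fun i j =>
    hBR.mono (hFT.tops_subset _ i) (hFU.tops_subset _ j)
  refine ⟨some .loop, ?_⟩
  have e : {t | LoopLang (Op.loop.join Ts) (Op.xor.join Us) t} =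
      Op.loop.join (Fin.append Ts Us) := by
    ext t
    refine (loopLang_loopLang _ _ _ t).trans ⟨fun h => ?_, fun h => ?_⟩
    · refine LoopLang.mono ?_ ?_ h
      · rintro s ⟨i, hi, hs⟩
        exact ⟨Fin.castAdd m i, hi, by simpa using hs⟩
      · rintro s (⟨i, hi, hs⟩ | ⟨i, hs⟩)
        · exact ⟨Fin.castAdd m i, hi, by simpa using hs⟩
        · exact ⟨Fin.natAdd n i, by simp; omega, by simpa using hs⟩
    · refine LoopLang.mono ?_ ?_ (show LoopLang _ _ t from h)
      · rintro s ⟨i, hi, hs⟩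
        revert hi hs
        refine Fin.addCases (fun i hi hs => ?_) (fun i hi hs => ?_) i
        · exact ⟨i, hi, by simpa using hs⟩
        · simp at hi
          omega
      · rintro s ⟨i, hi, hs⟩
        revert hi hs
        refine Fin.addCases (fun i hi hs => ?_) (fun i hi hs => ?_) i
        · exact Or.inl ⟨i, hi, by simpa using hs⟩
        · exact Or.inr ⟨i, by simpa using hs⟩
  rw [e]
  refine .node (ks := Fin.append ks ls) .loop (by omega) (fun i => ?_)
    (isFamily_append hFT hFU hd').disjoint (fun h => absurd rfl h) (fun _ i => ?_) (fun _ i => ?_)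
  · refine Fin.addCases (fun i => ?_) (fun i => ?_) i
    · simpa using hTs i
    · simpa using hUs i
  · refine Fin.addCases (fun i hi => ?_) (fun i hi => ?_) i
    · simpa using hTb i hi
    · simp at hi
      omega
  · refine Fin.addCases (fun i hi => ?_) (fun i hi => ?_) i
    · simpa using hTr i hi
    · simpa using hUk i

end Flattening

-- From trees to bounded languages in normal form

section Trees

variable {A : Type u}

/-- The traces of a language that have no unresolved recursive calls. -/
def clean (T : Set (MTrace A)) : Set (Trace A) :=
  {t | t.map plain ∈ T}

/-- The lengths of the events are bounded. -/
def Bounded (T : Set (Trace A)) : Prop :=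
  ∃ N, ∀ t ∈ T, ∀ x ∈ t, x.length ≤ N

theorem Bounded.of_subset {S T : Set (Trace A)} (hT : Bounded T)
    (h : ∀ s ∈ S, ∃ t ∈ T, s ⊆ t) : Bounded S := by
  obtain ⟨N, hN⟩ := hT
  refine ⟨N, fun s hs x hx => ?_⟩
  obtain ⟨t, ht, hst⟩ := h s hs
  exact hN t ht x (hst hx)

theorem exists_longest {T : Set (Trace A)} (hT : Proper T) (hb : Bounded T) :
    ∃ s ∈ T, ∃ y ∈ s, ∀ t ∈ T, ∀ x ∈ t, x.length ≤ y.length := by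
  classical
  obtain ⟨N, hN⟩ := hb
  let p : ℕ → Prop := fun l => ∃ s ∈ T, ∃ y ∈ s, y.length = l
  obtain ⟨t, ht⟩ := hT.nonempty
  obtain ⟨x, hx⟩ := List.exists_mem_of_ne_nil t (hT.ne_nil t ht)
  have hp : p (Nat.findGreatest p N) := Nat.findGreatest_spec (hN t ht x hx) ⟨t, ht, x, hx, rfl⟩
  obtain ⟨s, hs, y, hy, hlen⟩ := hp
  refine ⟨s, hs, y, hy, fun t ht x hx => ?_⟩
  rw [hlen]
  exact Nat.le_findGreatest (hN t ht x hx) ⟨t, ht, x, hx, rfl⟩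

/-! ### Named subtrees -/

/-- By mutual induction: a call is never replaced by the empty trace, so resolving cannot erase
events. -/
theorem Resolve.ne_nil {f : A} {L : Set (MTrace A)} (hL : [] ∉ L) {xs t : MTrace A}
    (h : Resolve f L xs t) : xs ≠ [] → t ≠ [] := by
  refine Resolve.rec (f := f) (L := L) (motive_1 := fun t _ => t ≠ [])
    (motive_2 := fun xs t _ => xs ≠ [] → t ≠ []) ?_ ?_ ?_ ?_ h
  · intro xs t hx _ ih
    simpa [prependTrace] using ih fun e => hL (e ▸ hx)
  · exact fun h => h
  · intros
    simp
  · intro p xs s t _ _ hs _ _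
    simp [prependTrace, hs]

theorem NamedLang.ne_nil {f : A} {L : Set (MTrace A)} (hL : [] ∉ L) {t : MTrace A}
    (h : NamedLang f L t) : t ≠ [] := by
  cases h with
  | intro hx ht => simpa [prependTrace] using ht.ne_nil hL fun e => hL (e ▸ hx)

theorem NamedLang.topActivity {f : A} {L : Set (MTrace A)} {t : MTrace A}
    (h : NamedLang f L t) {x : MEvent A} (hx : x ∈ t) : x.topActivity = some f := by
  cases h with
  | intro _ _ =>
    obtain ⟨y, _, rfl⟩ := List.mem_map.1 hx
    simp [MEvent.topActivity, MEvent.prepend]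

/-- The node `▽_f` resolves all calls to `f`, also inside inserted traces, and lets only the other
calls escape. -/
theorem NamedLang.mark_mem {f : A} {L : Set (MTrace A)} {C : Set A}
    (hL : ∀ t ∈ L, ∀ x ∈ t, ∀ g, x.mark = some g → g ∈ insert f C) {t : MTrace A}
    (h : NamedLang f L t) : ∀ x ∈ t, ∀ g, x.mark = some g → g ∈ C := by
  refine NamedLang.rec (f := f) (L := L)
    (motive_1 := fun t _ => ∀ x ∈ t, ∀ g, x.mark = some g → g ∈ C)
    (motive_2 := fun xs t _ => (∀ x ∈ xs, ∀ g, x.mark = some g → g ∈ insert f C) →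
      ∀ x ∈ t, ∀ g, x.mark = some g → g ∈ C) ?_ ?_ ?_ ?_ h
  · intro xs t hx _ ih x hxt
    obtain ⟨y, hy, rfl⟩ := List.mem_map.1 hxt
    exact ih (hL xs hx) y hy
  · simp
  · intro x xs t hx _ ih hxs y hy g hg
    rcases List.mem_cons.1 hy with rfl | hy
    · rcases hxs y (by simp) g hg with rfl | h
      · exact absurd hg hx
      · exact h
    · exact ih (fun z hz => hxs z (by simp [hz])) y hy g hg
  · intro p xs s t _ _ ihs iht hxs y hy g hg
    rcases List.mem_append.1 hy with hy | hy
    · obtain ⟨z, hz, rfl⟩ := List.mem_map.1 hy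
      exact ihs z hz g hg
    · exact iht (fun z hz => hxs z (by simp [hz])) y hy g hg

theorem exists_map_plain {t : MTrace A} (h : ∀ x ∈ t, x.mark = none) :
    ∃ s : Trace A, s.map plain = t := by
  refine ⟨t.map MEvent.path, ?_⟩
  rw [List.map_map]
  refine (List.map_congr_left fun x hx => ?_).trans t.map_id
  exact MEvent.ext rfl (h x hx).symm

theorem mark_of_mem_map_plain {t : Trace A} {x : MEvent A} (hx : x ∈ t.map plain) :
    x.mark = none := by
  obtain ⟨y, _, rfl⟩ := List.mem_map.1 hx
  rfl

theorem Resolve.mark_of_unmarked {f : A} {L : Set (MTrace A)} {xs t : MTrace A}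
    (h : Resolve f L xs t) (ht : ∀ x ∈ t, x.mark = none) :
    ∀ x ∈ xs, x.mark = none ∨ x.mark = some f := by
  induction xs generalizing t with
  | nil => simp
  | cons x xs ih =>
    cases h with
    | keep _ h =>
      intro y hy
      rcases List.mem_cons.1 hy with rfl | hy
      · exact Or.inl (ht y (by simp))
      · exact ih h (fun z hz => ht z (by simp [hz])) y hy
    | recurse _ h =>
      intro y hy
      rcases List.mem_cons.1 hy with rfl | hy
      · exact Or.inr rfl
      · exact ih h (fun z hz => ht z (by simp [hz])) y hy

/-- All recursive calls can be resolved by the same trace. -/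
theorem exists_resolve {f : A} {L : Set (MTrace A)} {s : Trace A}
    (hs : NamedLang f L (s.map plain)) {xs : MTrace A}
    (hxs : ∀ x ∈ xs, x.mark = none ∨ x.mark = some f) :
    ∃ t : Trace A, Resolve f L xs (t.map plain) ∧
      ∀ x ∈ xs, x.mark = some f → ∀ y ∈ s, x.path ++ y ∈ t := by
  induction xs with
  | nil => exact ⟨[], .nil, by simp⟩
  | cons x xs ih =>
    obtain ⟨t, ht, hmem⟩ := ih fun y hy => hxs y (by simp [hy])
    obtain ⟨p, g⟩ := x
    rcases hxs ⟨p, g⟩ (by simp) with hg | hg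
    · obtain rfl : g = none := hg
      refine ⟨p :: t, .keep (by simp) ht, fun y hy hyf z hz => ?_⟩
      rcases List.mem_cons.1 hy with rfl | hy
      · simp at hyf
      · exact List.mem_cons_of_mem _ (hmem y hy hyf z hz)
    · obtain rfl : g = some f := hg
      refine ⟨s.map (p ++ ·) ++ t, ?_, fun y hy hyf z hz => ?_⟩
      · have := Resolve.recurse (p := p) hs ht
        have e : prependTrace p (s.map plain) = (s.map (p ++ ·)).map plain := by
          simp only [prependTrace, List.map_map]
          rfl
        rwa [e, ← List.map_append] at this
      · rcases List.mem_cons.1 hy with rfl | hy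
        · exact List.mem_append_left _ (List.mem_map.2 ⟨z, hz, rfl⟩)
        · exact List.mem_append_right _ (hmem y hy hyf z hz)

/-- If the events are bounded in length, then no recursive call is ever resolved. -/
theorem clean_named {f : A} {L : Set (MTrace A)} (hp : Proper (clean {t | NamedLang f L t}))
    (hb : Bounded (clean {t | NamedLang f L t})) :
    clean {t | NamedLang f L t} = List.map (List.cons f) '' clean L := by
  have hback : ∀ t : Trace A, ∀ xs ∈ L, Resolve f L xs (t.map plain) →
      t.map (List.cons f) ∈ clean {t | NamedLang f L t} := by
    intro t xs hxs h
    change NamedLang f L _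
    rw [← prependTrace_plain]
    exact .intro hxs h
  ext t
  constructor
  · intro ht
    generalize hu : t.map plain = u
    have hu' : NamedLang f L u := hu ▸ ht
    cases hu' with
    | @intro xs r hx hr =>
      have hrm : ∀ x ∈ r, x.mark = none := fun x hx =>
        mark_of_mem_map_plain (x := MEvent.prepend [f] x) (t := t)
          (hu ▸ List.mem_map_of_mem hx)
      have hxm := hr.mark_of_unmarked hrm
      have hno : ∀ x ∈ xs, x.mark ≠ some f := by
        intro x hxs hxf
        -- Resolving all calls with the trace of a longest event `y` yields the event `f.p.y`, where
        -- `p` is the path of the call. The prefix `f` makes it longer than `y` even when `p` is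
        -- empty.
        obtain ⟨s, hs, y, hy, hmax⟩ := exists_longest hp hb
        obtain ⟨v, hv, hmem⟩ := exists_resolve hs hxm
        have := hmax _ (hback v xs hx hv) _ (List.mem_map_of_mem (hmem x hxs hxf y hy))
        simp only [List.length_cons, List.length_append] at this
        omega
      obtain rfl := hr.eq_self hno
      obtain ⟨s, rfl⟩ := exists_map_plain hrm
      rw [prependTrace_plain] at hu
      exact ⟨s, hx, (List.map_injective_iff.2 plain_injective hu).symm⟩
  · rintro ⟨s, hs, rfl⟩
    exact hback s _ hs (.self fun x hx => by simp [mark_of_mem_map_plain hx])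

/-! ### From trees to normal forms -/

theorem HTree.exists_topActivity (P : HTree A) :
    ∀ t ∈ P.lang, ∀ x ∈ t, ∃ a ∈ P.activities, x.topActivity = some a := by
  induction P with
  | tau =>
    rintro t rfl
    simp
  | act a =>
    rintro t rfl x hx
    obtain rfl := List.mem_singleton.1 hx
    exact ⟨a, rfl, rfl⟩
  | recur f =>
    rintro t rfl x hx
    obtain rfl := List.mem_singleton.1 hx
    exact ⟨f, rfl, rfl⟩
  | named f P _ => exact fun t ht x hx => ⟨f, Set.mem_insert .., NamedLang.topActivity ht hx⟩
  | node op n hn c ih =>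
    intro t ht x hx
    obtain ⟨i, s, hs, hx⟩ := exists_mem_of_mem_join ht hx
    obtain ⟨a, ha, hxa⟩ := ih i s hs x hx
    exact ⟨a, ⟨i, ha⟩, hxa⟩

theorem HTree.mark_mem (P : HTree A) {C : Set A} (hP : P.RecursionBound C) :
    ∀ t ∈ P.lang, ∀ x ∈ t, ∀ g, x.mark = some g → g ∈ C := by
  induction P generalizing C with
  | tau =>
    rintro t rfl
    simp
  | act a =>
    rintro t rfl
    simp
  | recur f =>
    rintro t rfl
    simpa [HTree.RecursionBound] using hP
  | named f P ih => exact fun t ht => NamedLang.mark_mem (ih hP) ht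
  | node op n hn c ih =>
    intro t ht x hx
    obtain ⟨i, s, hs, hx⟩ := exists_mem_of_mem_join ht hx
    exact ih i (hP i) s hs x hx

theorem Op.minArity_pos (op : Op) : 0 < op.minArity := by
  cases op <;> simp [Op.minArity]

/-- As no child is `τ`, the empty trace never arises; the disjoint-alphabet and loop arguments all
rely on non-empty traces. -/
theorem HTree.ne_nil_of_mem_lang (P : HTree A) (hP : P.NodesOK) (hτ : P ≠ .tau) :
    ∀ t ∈ P.lang, t ≠ [] := by
  induction P with
  | tau => exact absurd rfl hτ
  | act a =>
    rintro t rfl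
    simp
  | recur f =>
    rintro t rfl
    simp
  | named f P ih => exact fun t ht => NamedLang.ne_nil (fun h => ih hP.2 hP.1 _ h rfl) ht
  | node op n hn c ih =>
    exact fun t => ne_nil_of_mem_join (op.minArity_pos.trans_le hn)
      fun i => ih i (hP.2.2.2 i) (hP.2.2.1 i)

theorem HTree.activities_nonempty (P : HTree A) (hP : P.NodesOK) (hτ : P ≠ .tau) :
    P.activities.Nonempty := by
  induction P with
  | tau => exact absurd rfl hτ
  | act a => exact ⟨a, rfl⟩
  | recur f => exact ⟨f, rfl⟩
  | named f P ih => exact ⟨f, Set.mem_insert ..⟩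
  | node op n hn c ih =>
    have i : Fin n := ⟨0, op.minArity_pos.trans_le hn⟩
    obtain ⟨a, ha⟩ := ih i (hP.2.2.2 i) (hP.2.2.1 i)
    exact ⟨a, i, ha⟩

theorem topActivity_plain (x : Event A) : (plain x).topActivity = x.head? := by
  simp [MEvent.topActivity, plain]

theorem HTree.clean_proper {P : HTree A} (hP : P.NodesOK) (hτ : P ≠ .tau)
    (hne : (clean P.lang).Nonempty) : Proper (clean P.lang) where
  nonempty := hne
  ne_nil t ht := by simpa using P.ne_nil_of_mem_lang hP hτ _ ht
  event_ne_nil t ht x hx := by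
    obtain ⟨a, _, ha⟩ := P.exists_topActivity _ ht _ (List.mem_map_of_mem hx)
    rw [topActivity_plain] at ha
    rintro rfl
    simp at ha

theorem HTree.tops_clean_subset (P : HTree A) : tops (clean P.lang) ⊆ P.activities := by
  rintro a ⟨t, ht, x, hx, ha⟩
  obtain ⟨b, hb, hxb⟩ := P.exists_topActivity _ ht _ (List.mem_map_of_mem hx)
  rw [topActivity_plain, ha] at hxb
  exact Option.some.inj hxb ▸ hb

theorem firstTops_clean_subset (T : Set (MTrace A)) : firstTops (clean T) ⊆ startActivities T := by
  rintro a ⟨x, ⟨t, ht, hx⟩, ha⟩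
  exact ⟨plain x, ⟨_, ht, by simp [hx]⟩, (topActivity_plain x).trans ha⟩

theorem lastTops_clean_subset (T : Set (MTrace A)) : lastTops (clean T) ⊆ endActivities T := by
  rintro a ⟨x, ⟨t, ht, hx⟩, ha⟩
  exact ⟨plain x, ⟨_, ht, by simp [hx]⟩, (topActivity_plain x).trans ha⟩

theorem clean_node (op : Op) {n : ℕ} (hn : op.minArity ≤ n) (c : Fin n → HTree A) :
    clean (HTree.node op n hn c).lang = op.join fun i => clean (c i).lang := by
  ext t
  rw [clean, Set.mem_ofPred_eq, HTree.lang, map_mem_join_iff]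
  rfl

theorem loopLang_empty {X : Type u} {B R : Set (List X)} (hR : R = ∅) :
    {t | LoopLang B R t} = B := by
  subst hR
  ext t
  constructor
  · intro h
    cases h with
    | body ht => exact ht
    | step _ hr _ => exact absurd hr (Set.notMem_empty _)
  · exact fun ht => LoopLang.body ht

/-- Children may have no resolved trace at all, such as a bare `△_f`. In a non-empty sequence or
parallel this cannot happen; in a choice or among loop-backs such children are dropped, and the body
of a loop is non-empty. -/
theorem exists_nf_join {op : Op} {n : ℕ} (hn : op.minArity ≤ n) {Ts : Fin n → Set (Trace A)}
    (hp : ∀ i, (Ts i).Nonempty → Proper (Ts i))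
    (hd : ∀ i j, i ≠ j → Disjoint (tops (Ts i)) (tops (Ts j)))
    (hloop : op = .loop → ∀ i, i.val = 0 → Disjoint (firstTops (Ts i)) (lastTops (Ts i)))
    (ih : ∀ i, (Ts i).Nonempty → Bounded (Ts i) → ∃ k, NF k (Ts i))
    (hne : (op.join Ts).Nonempty) (hb : Bounded (op.join Ts)) : ∃ k, NF k (op.join Ts) := by
  replace hn : 0 < n := op.minArity_pos.trans_le hn
  have hall : op = .seq ∨ op = .par → ∀ i, (Ts i).Nonempty := by
    obtain ⟨t, ht⟩ := hne
    rintro (rfl | rfl) i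
    · exact let ⟨ts, hts, _⟩ := ht; ⟨_, hts i⟩
    · exact let ⟨ts, hts, _⟩ := ht; ⟨_, hts i⟩
  have hbounded : (∀ i, (Ts i).Nonempty) → ∀ i, Bounded (Ts i) := by
    intro h i
    refine hb.of_subset fun s hs => ?_
    obtain ⟨t, ht, hi⟩ := IsFamily.exists_infix ⟨fun i => hp i (h i), hd⟩ op hs
    exact ⟨t, ht, hi.subset⟩
  have hseqpar : op = .seq ∨ op = .par → ∃ k, NF k (op.join Ts) := by
    intro hop
    choose ks hks using fun i => ih i (hall hop i) (hbounded (hall hop) i)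
    have hop' : op ≠ .loop := by rcases hop with rfl | rfl <;> simp
    exact (hasComponents_join hop' hn hks hd).exists_nf hop'
  cases op with
  | seq => exact hseqpar (Or.inl rfl)
  | par => exact hseqpar (Or.inr rfl)
  | xor =>
    let ι := {i // (Ts i).Nonempty}
    obtain ⟨t, i, hi⟩ := hne
    have : Nonempty ι := ⟨⟨i, t, hi⟩⟩
    choose ks hks using fun i : ι => ih i.1 i.2
      (hb.of_subset fun s hs => ⟨s, ⟨i.1, hs⟩, List.Subset.refl s⟩)
    have := (hasComponents_union hks fun i j hij => hd i.1 j.1 fun e => hij (Subtype.ext e)).exists_nf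
      (by simp)
    convert this using 3
    ext s
    exact ⟨fun ⟨i, hi⟩ => ⟨⟨i, s, hi⟩, hi⟩, fun ⟨i, hi⟩ => ⟨i.1, hi⟩⟩
  | loop =>
    let z : Fin n := ⟨0, hn⟩
    let ι := {i : Fin n // i.val ≠ 0 ∧ (Ts i).Nonempty}
    have hbody : (Ts z).Nonempty := by
      obtain ⟨t, ht⟩ := hne
      have hz : ∀ i : Fin n, i.val = 0 → i = z := fun i hi => Fin.ext hi
      cases ht with
      | body ht => exact let ⟨i, hi, ht⟩ := ht; hz i hi ▸ ⟨_, ht⟩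
      | step ht _ _ => exact let ⟨i, hi, ht⟩ := ht; hz i hi ▸ ⟨_, ht⟩
    obtain ⟨b, hbz⟩ := id hbody
    obtain ⟨k, hk⟩ := ih z hbody
      (hb.of_subset fun s hs => ⟨s, mem_loop_body rfl hs, List.Subset.refl s⟩)
    have e : Op.loop.join Ts = {t | LoopLang (Ts z) {t | ∃ i : ι, t ∈ Ts i.1} t} := by
      ext t
      constructor
      · refine fun h => LoopLang.mono ?_ ?_ (show LoopLang _ _ t from h)
        · rintro s ⟨i, hi, hs⟩
          rwa [show i = z from Fin.ext hi] at hs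
        · rintro s ⟨i, hi, hs⟩
          exact ⟨⟨i, hi, s, hs⟩, hs⟩
      · refine LoopLang.mono ?_ ?_
        · exact fun s hs => ⟨z, rfl, hs⟩
        · rintro s ⟨i, hs⟩
          exact ⟨i.1, i.2.1, hs⟩
    rw [e]
    -- If no loop-back has a trace, the loop is just its body.
    rcases isEmpty_or_nonempty ι with hι | hι
    · rw [loopLang_empty]
      · exact ⟨k, hk⟩
      · ext s
        simp
    · choose ks hks using fun i : ι => ih i.1 i.2.2
        (hb.of_subset fun s hs =>
          ⟨b ++ s ++ b, mem_loop_step rfl hbz i.2.1 hs (mem_loop_body rfl hbz), by simp⟩)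
      refine exists_nf_loop hk (hloop rfl z rfl) (hasComponents_union hks
        fun i j hij => hd i.1 j.1 fun e => hij (Subtype.ext e)) ?_
      rw [Set.disjoint_left]
      rintro a ha ⟨t, ⟨i, ht⟩, x, hx, hxa⟩
      exact Set.disjoint_left.1 (hd z i.1 fun e => i.2.1 (e ▸ rfl)) ha ⟨t, ht, x, hx, hxa⟩

/-- The resolved traces of a tree of the class, if they are bounded, form a language in normal
form. -/
theorem HTree.exists_nf (P : HTree A) (hP : P.NodesOK) (hτ : P ≠ .tau)
    (hne : (clean P.lang).Nonempty) (hb : Bounded (clean P.lang)) :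
    ∃ k, NF k (clean P.lang) := by
  induction P with
  | tau => exact absurd rfl hτ
  | act a =>
    have e : clean (HTree.act a).lang = {[[a]]} := by
      ext t
      have : t.map plain = [[a]].map plain ↔ t = [[a]] :=
        (List.map_injective_iff.2 plain_injective).eq_iff
      exact this
    rw [e]
    exact ⟨_, .act a⟩
  | recur f =>
    -- The only trace of `△_f` is an unresolved call, so the assumption of a resolved trace is
    -- contradictory.
    obtain ⟨t, ht⟩ := hne
    have ht : t.map plain = [⟨[], some f⟩] := ht
    have := mark_of_mem_map_plain (ht ▸ List.mem_singleton_self (⟨[], some f⟩ : MEvent A))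
    simp at this
  | named f P ih =>
    have e : clean (HTree.named f P).lang = List.map (List.cons f) '' clean P.lang :=
      clean_named (HTree.clean_proper hP hτ hne) hb
    rw [e] at hne hb ⊢
    obtain ⟨N, hN⟩ := hb
    obtain ⟨k, hk⟩ := ih hP.2 hP.1 hne.of_image ⟨N, fun t ht x hx => by
      have := hN _ ⟨t, ht, rfl⟩ _ (List.mem_map_of_mem hx)
      simp only [List.length_cons] at this
      omega⟩
    exact ⟨_, .named f hk⟩
  | node op n hn c ih =>
    obtain ⟨hdis, hloop, hchild, hok⟩ := hP
    rw [clean_node] at hne hb ⊢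
    exact exists_nf_join hn (fun i => HTree.clean_proper (hok i) (hchild i))
      (fun i j hij => (hdis i j hij).mono (c i).tops_clean_subset (c j).tops_clean_subset)
      (fun e i hi => (hloop e i hi).mono (firstTops_clean_subset _) (lastTops_clean_subset _))
      (fun i => ih i (hok i) (hchild i)) hne hb

theorem logTraces_eq (L : EventLog A) : logTraces L = List.map plain '' {t | t ∈ L} := by
  ext s
  exact ⟨fun ⟨t, ht, e⟩ => ⟨t, ht, e.symm⟩, fun ⟨t, ht, e⟩ => ⟨t, ht, e.symm⟩⟩

/-- At the root every call has been resolved by an enclosing `▽_f`, so nothing is lost by keeping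
only the resolved traces. -/
theorem HTree.lang_eq_image {P : HTree A} (hP : P.RecursionBound ∅) :
    P.lang = List.map plain '' clean P.lang := by
  ext s
  constructor
  · intro hs
    obtain ⟨t, rfl⟩ := exists_map_plain (t := s) fun x hx =>
      Option.eq_none_iff_forall_ne_some.2 fun g hg => P.mark_mem hP s hs x hx g hg
    exact ⟨t, hs, rfl⟩
  · rintro ⟨t, ht, rfl⟩
    exact ht

theorem complete_clean {P : HTree A} (hP : P.RecursionBound ∅) {L : EventLog A}
    (hL : logTraces L ⊆ P.lang) (hdf : DFComplete L P) : Complete L (clean P.lang) := by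
  have e := HTree.lang_eq_image hP
  refine ⟨fun t ht => hL ⟨t, ht, rfl⟩, fun x y h => ?_, fun x hx => ?_, fun x hx => ?_⟩
  · have h' := (follows_image_iff plain_injective).2 h
    rw [← e] at h'
    have := hdf.follows _ _ h'
    rwa [logTraces_eq, follows_image_iff plain_injective] at this
  · have h' := (starts_image_iff plain_injective).2 hx
    rw [← e] at h'
    have := hdf.start h'
    rwa [logTraces_eq, starts_image_iff plain_injective] at this
  · have h' := (ends_image_iff plain_injective).2 hx
    rw [← e] at h'
    have := hdf.last h'
    rwa [logTraces_eq, ends_image_iff plain_injective] at this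

theorem Complete.bounded {L : EventLog A} {T : Set (Trace A)} (h : Complete L T) : Bounded T := by
  -- The total length of all events in the finite log is a crude bound for each of them.
  refine ⟨(L.map fun t => (t.map List.length).sum).sum, fun t ht x hx => ?_⟩
  obtain ⟨s, hs, hx⟩ := h.exists_mem ht hx
  exact (List.le_sum_of_mem (List.mem_map_of_mem hx)).trans
    (Multiset.single_le_sum (by simp) _ (Multiset.mem_map_of_mem _ hs))

theorem naive_tau {L : EventLog A} (h : ∀ t ∈ L, t = []) :
    (∃ P, Naive L P) ∧ ∀ P, Naive L P → P.lang = (HTree.tau : HTree A).lang := by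
  refine ⟨⟨_, .silent h⟩, fun P hP => ?_⟩
  cases hP with
  | silent _ => rfl
  | single _ h₀ _ => exact absurd h h₀
  | subtree f h' _ =>
    obtain ⟨-, t, ht, x, hx, -⟩ := h'
    simp [h t ht] at hx
  | emptyTraces h' _ _ => exact absurd h h'.1
  | split _ _ _ h' _ _ _ => exact absurd h h'.1
  | flower _ _ h' _ _ _ _ => exact absurd h h'.1

end Trees

end HierDisc

-- The rediscoverability theorem

theorem mainTheorem5 {A : Type*} (P : HierDisc.HTree A) (hP : P.Rediscoverable)
    (L : HierDisc.EventLog A) (hL : HierDisc.logTraces L ⊆ P.lang)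
    (hdf : HierDisc.DFComplete L P) :
    (∃ P' : HierDisc.HTree A, HierDisc.Naive L P') ∧
      ∀ P' : HierDisc.HTree A, HierDisc.Naive L P' → P'.lang = P.lang := by
  -- The tree `τ` is the one tree of the class with an empty trace, which normal forms exclude.
  by_cases hτ : P = .tau
  · subst hτ
    refine HierDisc.naive_tau fun t ht => ?_
    have : t.map _ = [] := hL ⟨t, ht, rfl⟩
    simpa using this
  · have hcomplete := HierDisc.complete_clean hP.2 hL hdf
    have hne : (HierDisc.clean P.lang).Nonempty := by
      -- Completeness of activities rules out an empty language, as for `▽_f(△_f)`: the tree has an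
      -- activity, so the log has a trace.
      obtain ⟨a, ha⟩ := P.activities_nonempty hP.1 hτ
      obtain ⟨t, ht, _⟩ := hdf.activities ha
      exact ⟨t, hcomplete.sound t ht⟩
    obtain ⟨k, hk⟩ := P.exists_nf hP.1 hτ hne hcomplete.bounded
    rw [HierDisc.HTree.lang_eq_image hP.2]
    exact hk.rediscovered L hcomplete
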